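/- Let $T=(V,E,\omega)$ be a tree with $n\ge 1$ vertices and edge weights $\omega:E\to\mathbb{R}_{\ge 0}$. A rounding of $T$ is a function $\tilde\omega:E\to\mathbb{N}_0=\{0,1,2,\dots\}$. For a simple path $\pi$ in $T$ (paths consisting of a single vertex included), let $\omega(\pi)$ and $\tilde\omega(\pi)$ be the sums of $\omega$ and of $\tilde\omega$ over the edges of $\pi$; the absolute rounding error of $\tilde\omega$ on $\pi$ is $|\tilde\omega(\pi)-\omega(\pi)|$. Consider a random access machine with integer cells and real cells that performs each of the following operations in one step: copying a value, addition, subtraction, halving an integer (rounding down), comparison, indirect addressing, converting an integer to a real number, and taking the floor of a real number. Its programs contain integer constants only. There are a single program for this machine and a constant $C$ such that the following holds for every such weighted tree $T$ with vertices numbered $0,\dots,n-1$. Given $n$ and a list of the $n-1$ edges of $T$, in any order, each with its two endpoints and its weight, the program halts after at most $C\,n^2\log(n+1)$ steps (that is, in $O(n^2\log n)$ time), and it outputs, in the order of the list, the integer weights $\tilde\omega(e)$, $e\in E$, of a rounding $\tilde\omega$ of $T$ that minimizes, among all roundings of $T$, the maximum absolute rounding error on any simple path in $T$. -/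

import Mathlib

open scoped NNReal

/-! ### A real random access machine with a unit-cost floor function

The store has integer cells and real cells: scalar variables, and arrays indexed by integers.
The only primitive operations are copying, addition, subtraction, halving of an integer (rounding
down), comparison, indirect addressing, the conversion of an integer to a real, and the floor of a
real. Programs contain integer constants only. Every primitive operation costs one step. General
multiplication and division are deliberately absent: at unit cost, combined with the floor
function, they would give the machine unreasonable power. -/

namespace RealRAM

/-- The memory: integer and real scalar variables `ivar x`, `rvar x`, and integer and real arrays
`iarr a`, `rarr a`, whose names are natural numbers. -/
structure Store where
  ivar : ℕ → ℤ
  rvar : ℕ → ℝ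
  iarr : ℕ → ℤ → ℤ
  rarr : ℕ → ℤ → ℝ

mutual

/-- Integer expressions. -/
inductive IExpr : Type
  | const (z : ℤ)
  | var (x : ℕ)
  | arr (a : ℕ) (i : IExpr)
  | add (e f : IExpr)
  | sub (e f : IExpr)
  | half (e : IExpr)
  | floor (e : RExpr)

/-- Real expressions. -/
inductive RExpr : Type
  | ofInt (e : IExpr)
  | var (x : ℕ)
  | arr (a : ℕ) (i : IExpr)
  | add (e f : RExpr)
  | sub (e f : RExpr)

end

/-- Boolean expressions. -/
inductive BExpr : Type
  | ile (e f : IExpr)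
  | rle (e f : RExpr)
  | not (b : BExpr)
  | and (b c : BExpr)

mutual

/-- The value of an integer expression. -/
noncomputable def IExpr.eval (s : Store) : IExpr → ℤ
  | .const z => z
  | .var x => s.ivar x
  | .arr a i => s.iarr a (i.eval s)
  | .add e f => e.eval s + f.eval s
  | .sub e f => e.eval s - f.eval s
  | .half e => e.eval s / 2
  | .floor e => ⌊e.eval s⌋

/-- The value of a real expression. -/
noncomputable def RExpr.eval (s : Store) : RExpr → ℝ
  | .ofInt e => (e.eval s : ℝ)
  | .var x => s.rvar x
  | .arr a i => s.rarr a (i.eval s)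
  | .add e f => e.eval s + f.eval s
  | .sub e f => e.eval s - f.eval s

end

/-- The truth value of a boolean expression. -/
def BExpr.eval (s : Store) : BExpr → Prop
  | .ile e f => e.eval s ≤ f.eval s
  | .rle e f => e.eval s ≤ f.eval s
  | .not b => ¬ b.eval s
  | .and b c => b.eval s ∧ c.eval s

mutual

/-- The number of steps that the evaluation of an integer expression takes: one per node. -/
def IExpr.cost : IExpr → ℕ
  | .const _ => 1
  | .var _ => 1
  | .arr _ i => i.cost + 1
  | .add e f => e.cost + f.cost + 1
  | .sub e f => e.cost + f.cost + 1
  | .half e => e.cost + 1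
  | .floor e => e.cost + 1

/-- The number of steps that the evaluation of a real expression takes: one per node. -/
def RExpr.cost : RExpr → ℕ
  | .ofInt e => e.cost + 1
  | .var _ => 1
  | .arr _ i => i.cost + 1
  | .add e f => e.cost + f.cost + 1
  | .sub e f => e.cost + f.cost + 1

end

/-- The number of steps that the evaluation of a boolean expression takes: one per node. -/
def BExpr.cost : BExpr → ℕ
  | .ile e f => e.cost + f.cost + 1
  | .rle e f => e.cost + f.cost + 1
  | .not b => b.cost + 1
  | .and b c => b.cost + c.cost + 1

/-- Programs: assignments to variables and to array cells, sequences, branches, while-loops. -/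
inductive Program : Type
  | skip
  | setIVar (x : ℕ) (e : IExpr)
  | setRVar (x : ℕ) (e : RExpr)
  | setIArr (a : ℕ) (i : IExpr) (e : IExpr)
  | setRArr (a : ℕ) (i : IExpr) (e : RExpr)
  | seq (P Q : Program)
  | branch (b : BExpr) (P Q : Program)
  | loop (b : BExpr) (P : Program)

/-- `Runs P s t s'`: started in store `s`, the program `P` halts after exactly `t` steps in
store `s'`. -/
inductive Runs : Program → Store → ℕ → Store → Prop
  | skip (s : Store) : Runs .skip s 1 s
  | setIVar (x : ℕ) (e : IExpr) (s : Store) :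
      Runs (.setIVar x e) s (e.cost + 1)
        { s with ivar := Function.update s.ivar x (e.eval s) }
  | setRVar (x : ℕ) (e : RExpr) (s : Store) :
      Runs (.setRVar x e) s (e.cost + 1)
        { s with rvar := Function.update s.rvar x (e.eval s) }
  | setIArr (a : ℕ) (i : IExpr) (e : IExpr) (s : Store) :
      Runs (.setIArr a i e) s (i.cost + e.cost + 1)
        { s with iarr :=
            Function.update s.iarr a (Function.update (s.iarr a) (i.eval s) (e.eval s)) }
  | setRArr (a : ℕ) (i : IExpr) (e : RExpr) (s : Store) :
      Runs (.setRArr a i e) s (i.cost + e.cost + 1)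
        { s with rarr :=
            Function.update s.rarr a (Function.update (s.rarr a) (i.eval s) (e.eval s)) }
  | seq {P Q : Program} {s s₁ s₂ : Store} {t₁ t₂ : ℕ} :
      Runs P s t₁ s₁ → Runs Q s₁ t₂ s₂ → Runs (.seq P Q) s (t₁ + t₂) s₂
  | branchTrue {b : BExpr} {P Q : Program} {s s₁ : Store} {t : ℕ} :
      b.eval s → Runs P s t s₁ → Runs (.branch b P Q) s (b.cost + 1 + t) s₁
  | branchFalse {b : BExpr} {P Q : Program} {s s₁ : Store} {t : ℕ} :
      ¬ b.eval s → Runs Q s t s₁ → Runs (.branch b P Q) s (b.cost + 1 + t) s₁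
  | loopTrue {b : BExpr} {P : Program} {s s₁ s₂ : Store} {t₁ t₂ : ℕ} :
      b.eval s → Runs P s t₁ s₁ → Runs (.loop b P) s₁ t₂ s₂ →
        Runs (.loop b P) s (b.cost + 1 + t₁ + t₂) s₂
  | loopFalse {b : BExpr} {P : Program} {s : Store} :
      ¬ b.eval s → Runs (.loop b P) s (b.cost + 1) s

/-- The machine is deterministic: the step count and the final store are determined by the
program and the initial store. -/
theorem Runs.deterministic {P : Program} {s s₁ s₂ : Store} {t₁ t₂ : ℕ}
    (h₁ : Runs P s t₁ s₁) (h₂ : Runs P s t₂ s₂) : t₁ = t₂ ∧ s₁ = s₂ := by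
  induction h₁ generalizing t₂ s₂ with
  | skip | setIVar | setRVar | setIArr | setRArr => cases h₂; exact ⟨rfl, rfl⟩
  | seq _ _ ih ih' =>
    cases h₂ with
    | seq k k' =>
      obtain ⟨rfl, rfl⟩ := ih k
      obtain ⟨rfl, rfl⟩ := ih' k'
      exact ⟨rfl, rfl⟩
  | branchTrue hb _ ih =>
    cases h₂ with
    | branchTrue _ k => obtain ⟨rfl, rfl⟩ := ih k; exact ⟨rfl, rfl⟩
    | branchFalse hb' _ => exact absurd hb hb'
  | branchFalse hb _ ih =>
    cases h₂ with
    | branchTrue hb' _ => exact absurd hb' hb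
    | branchFalse _ k => obtain ⟨rfl, rfl⟩ := ih k; exact ⟨rfl, rfl⟩
  | loopTrue hb _ _ ih ih' =>
    cases h₂ with
    | loopTrue _ k k' =>
      obtain ⟨rfl, rfl⟩ := ih k
      obtain ⟨rfl, rfl⟩ := ih' k'
      exact ⟨rfl, rfl⟩
    | loopFalse hb' => exact absurd hb hb'
  | loopFalse hb =>
    cases h₂ with
    | loopTrue hb' _ _ => exact absurd hb' hb
    | loopFalse _ => exact ⟨rfl, rfl⟩

end RealRAM

/-! ### Roundings of edge weights -/

namespace EdgeRounding

/-- The weight of a walk with respect to edge weights `f`: the sum of the weights of its edges. -/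
def walkWeight {V M : Type*} [AddMonoid M] {G : SimpleGraph V} (f : G.edgeSet → M) :
    {u v : V} → G.Walk u v → M
  | _, _, .nil => 0
  | u, _, .cons (v := x) h p => f ⟨s(u, x), h⟩ + walkWeight f p

/-- The absolute rounding error of the integer weights `r` on a walk. -/
noncomputable def absError {V : Type*} {G : SimpleGraph V} (ω : G.edgeSet → ℝ≥0)
    (r : G.edgeSet → ℕ) {u v : V} (p : G.Walk u v) : ℝ :=
  |((walkWeight r p : ℕ) : ℝ) - ((walkWeight ω p : ℝ≥0) : ℝ)|

/-- The set of the absolute rounding errors of `r` on all simple paths. -/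
def pathErrors {V : Type*} {G : SimpleGraph V} (ω : G.edgeSet → ℝ≥0) (r : G.edgeSet → ℕ) :
    Set ℝ :=
  {x | ∃ (u v : V) (p : G.Walk u v), p.IsPath ∧ x = absError ω r p}

/-- The maximum absolute rounding error of `r` on any simple path. -/
noncomputable def maxError {V : Type*} {G : SimpleGraph V} (ω : G.edgeSet → ℝ≥0)
    (r : G.edgeSet → ℕ) : ℝ :=
  sSup (pathErrors ω r)

/-- In a nonempty finite graph the supremum that defines `maxError` is a maximum. -/
theorem isGreatest_maxError {V : Type*} [Finite V] [Nonempty V] {G : SimpleGraph V}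
    (ω : G.edgeSet → ℝ≥0) (r : G.edgeSet → ℕ) :
    IsGreatest (pathErrors ω r) (maxError ω r) := by
  classical
  have := Fintype.ofFinite V
  have hne : (pathErrors ω r).Nonempty :=
    ⟨_, Classical.arbitrary V, _, SimpleGraph.Walk.nil, SimpleGraph.Walk.IsPath.nil, rfl⟩
  have hfin : (pathErrors ω r).Finite := by
    have : (⋃ (u : V) (v : V), Set.range fun p : G.Path u v => absError ω r p.1).Finite :=
      Set.finite_iUnion fun u => Set.finite_iUnion fun v => Set.finite_range _
    refine this.subset ?_
    rintro x ⟨u, v, p, hp, rfl⟩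
    simp only [Set.mem_iUnion]
    exact ⟨u, v, ⟨p, hp⟩, rfl⟩
  exact ⟨hne.csSup_mem hfin, fun x hx => le_csSup hfin.bddAbove hx⟩

/-- The integer edge weights `r` minimize the maximum absolute rounding error on any simple path
among all non-negative integer edge weights. -/
def IsOptimalRounding {V : Type*} {G : SimpleGraph V} (ω : G.edgeSet → ℝ≥0)
    (r : G.edgeSet → ℕ) : Prop :=
  ∀ r' : G.edgeSet → ℕ, maxError ω r ≤ maxError ω r'

/-- A list of the `n - 1` edges of a tree on the vertices `0, …, n - 1`, in an arbitrary order and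
with each edge given by its two endpoints in an arbitrary order. -/
structure EdgeListing {n : ℕ} (G : SimpleGraph (Fin n)) where
  dart : Fin (n - 1) → G.Dart
  bijective : Function.Bijective fun i => (⟨(dart i).edge, (dart i).edge_mem⟩ : G.edgeSet)

/-- The `i`-th edge of the list. -/
def EdgeListing.edge {n : ℕ} {G : SimpleGraph (Fin n)} (L : EdgeListing G) (i : Fin (n - 1)) :
    G.edgeSet :=
  ⟨(L.dart i).edge, (L.dart i).edge_mem⟩

/-- The store `s` holds the weighted tree as input: integer variable `0` holds the number of
vertices, integer arrays `0` and `1` hold the two endpoints of the listed edges, and real array `0`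
holds their weights. The content of all other cells is arbitrary. -/
def IsInput {n : ℕ} {G : SimpleGraph (Fin n)} (ω : G.edgeSet → ℝ≥0) (L : EdgeListing G)
    (s : RealRAM.Store) : Prop :=
  s.ivar 0 = (n : ℤ) ∧
    ∀ i : Fin (n - 1),
      s.iarr 0 ((i : ℕ) : ℤ) = (((L.dart i).fst : ℕ) : ℤ) ∧
      s.iarr 1 ((i : ℕ) : ℤ) = (((L.dart i).snd : ℕ) : ℤ) ∧
      s.rarr 0 ((i : ℕ) : ℤ) = (ω (L.edge i) : ℝ)

/-- The store `s` holds the integer edge weights `r` as output: integer array `2` holds the weights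
of the edges in the order of the input list. -/
def IsOutput {n : ℕ} {G : SimpleGraph (Fin n)} (r : G.edgeSet → ℕ) (L : EdgeListing G)
    (s : RealRAM.Store) : Prop :=
  ∀ i : Fin (n - 1), s.iarr 2 ((i : ℕ) : ℤ) = (r (L.edge i) : ℤ)

end EdgeRounding

-- Root the tree, number the vertices so that parents precede children, and let d v be the distance
-- of v from the root. Roundings correspond to integers x v with x 0 = 0 that do not decrease from
-- parent to child. With f = x - d, the error on the path between u and v is |f u + f v - 2 f (lca u
-- v)| (`absError_eq_dist`). The choice x = ⌊d⌋ keeps all errors within 2 (`exists_isGood_two`), so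
-- only thresholds ε ≤ 2 matter. For these, the paths from the root force |x v - d v| ≤ 2, which
-- leaves five candidates per vertex.
--
-- Deciding a threshold. Take two disjoint parts of the tree such that every pair of vertices, one
-- from each part, has the same lowest common ancestor a. The error conditions for these pairs say
-- that the maxima of f over the two parts add up to at most ε + 2 f a, and the minima to at least
-- -ε + 2 f a. A partial solution thus matters only through the state of its top vertex, its maximum
-- and its minimum. The table entry F v k p is the largest possible minimum when v is in state k and
-- no error exceeds the p-th value of the sorted list S of candidate errors. Vertices are merged
-- into their parents, the last one first. A feasible choice passes through a merge in both
-- directions (`Folds.feasible`, `Folds.feasible_succ`), so the entry of the root decides the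
-- threshold (`Chain.of_isGood`, `Chain.feasible`).
--
-- Time of a decision. As tables are nondecreasing in p, a combination with bound p may use p for
-- one part and the largest admissible index not exceeding p for the other. That admissible limit
-- moves down as p moves up, so two pointers fill a row in O(N) steps with N = O(n)
-- (`computeEntry_ends`, `computeRow_ends`). One decision costs O(n²).
--
-- Search. The largest error of a rounding has the form |k - D| with k an integer and D the length
-- of a path. If it is at most 2, it is one of f, 1 - f, 1 + f, 2 - f, where f is the fractional
-- part of D (`abs_intCast_sub_le_two`). Sorting these O(n²) values and a binary search with O(log
-- n) decisions give O(n² log n) steps; the recorded choices then yield a rounding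
-- (`outputProgram_ends`, `isOptimalRounding`). As there is no multiplication, row addresses come
-- from tables of multiples built by repeated addition.

namespace RealRAM

/-! ### Reasoning about programs -/

/-- `P` does not assign to the integer variable `x`. -/
def Program.keepsI (x : ℕ) : Program → Bool
  | .setIVar y _ => !(x == y)
  | .seq P Q => P.keepsI x && Q.keepsI x
  | .branch _ P Q => P.keepsI x && Q.keepsI x
  | .loop _ P => P.keepsI x
  | _ => true

/-- `P` does not assign to the real variable `x`. -/
def Program.keepsR (x : ℕ) : Program → Bool
  | .setRVar y _ => !(x == y)
  | .seq P Q => P.keepsR x && Q.keepsR x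
  | .branch _ P Q => P.keepsR x && Q.keepsR x
  | .loop _ P => P.keepsR x
  | _ => true

/-- `P` does not assign to the integer array `a`. -/
def Program.keepsIA (a : ℕ) : Program → Bool
  | .setIArr y _ _ => !(a == y)
  | .seq P Q => P.keepsIA a && Q.keepsIA a
  | .branch _ P Q => P.keepsIA a && Q.keepsIA a
  | .loop _ P => P.keepsIA a
  | _ => true

/-- `P` does not assign to the real array `a`. -/
def Program.keepsRA (a : ℕ) : Program → Bool
  | .setRArr y _ _ => !(a == y)
  | .seq P Q => P.keepsRA a && Q.keepsRA a
  | .branch _ P Q => P.keepsRA a && Q.keepsRA a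
  | .loop _ P => P.keepsRA a
  | _ => true

/-- The test is a Boolean recursion over the syntax, so for a concrete program it is settled by
`rfl`. This is the meaning of most `rfl` arguments in the analyses of programs below. -/
theorem Runs.ivar_eq {P : Program} {s s' : Store} {t : ℕ} (h : Runs P s t s') {x : ℕ}
    (hx : P.keepsI x = true) : s'.ivar x = s.ivar x := by
  induction h <;> simp_all [Program.keepsI]

theorem Runs.rvar_eq {P : Program} {s s' : Store} {t : ℕ} (h : Runs P s t s') {x : ℕ}
    (hx : P.keepsR x = true) : s'.rvar x = s.rvar x := by
  induction h <;> simp_all [Program.keepsR]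

theorem Runs.iarr_eq {P : Program} {s s' : Store} {t : ℕ} (h : Runs P s t s') {a : ℕ}
    (ha : P.keepsIA a = true) : s'.iarr a = s.iarr a := by
  induction h <;> simp_all [Program.keepsIA, Function.update_of_ne]

theorem Runs.rarr_eq {P : Program} {s s' : Store} {t : ℕ} (h : Runs P s t s') {a : ℕ}
    (ha : P.keepsRA a = true) : s'.rarr a = s.rarr a := by
  induction h <;> simp_all [Program.keepsRA, Function.update_of_ne]

/-- Started in `s`, the program `P` halts after at most `c` steps in a store that satisfies `Q`. -/
def Ends (P : Program) (s : Store) (c : ℕ) (Q : Store → Prop) : Prop :=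
  ∃ t s', Runs P s t s' ∧ t ≤ c ∧ Q s'

theorem Ends.mono {P : Program} {s : Store} {c c' : ℕ} {Q Q' : Store → Prop}
    (h : Ends P s c Q) (hc : c ≤ c') (hQ : ∀ s', Q s' → Q' s') : Ends P s c' Q' := by
  obtain ⟨t, s', h, ht, hs⟩ := h
  exact ⟨t, s', h, ht.trans hc, hQ _ hs⟩

theorem Ends.of_le {P : Program} {s : Store} {c c' : ℕ} {Q : Store → Prop} (h : Ends P s c Q)
    (hc : c ≤ c') : Ends P s c' Q :=
  h.mono hc fun _ h => h

theorem Ends.seq {P P' : Program} {s : Store} {c c' : ℕ} {Q : Store → Prop}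
    (h : Ends P s c (fun s' => Ends P' s' c' Q)) : Ends (.seq P P') s (c + c') Q := by
  obtain ⟨t, s', h, ht, t', s'', h', ht', hs⟩ := h
  exact ⟨t + t', s'', .seq h h', by omega, hs⟩

/-- The post-condition may refer to the run, so that everything that the program does not assign
to is known to be unchanged. -/
theorem Ends.seq_runs {P P' : Program} {s : Store} {c c' : ℕ} {Q R : Store → Prop}
    (h : Ends P s c R) (h' : ∀ t s', Runs P s t s' → R s' → Ends P' s' c' Q) :
    Ends (.seq P P') s (c + c') Q := by
  obtain ⟨t, s', h, ht, hs⟩ := h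
  exact Ends.seq ⟨t, s', h, ht, h' _ _ h hs⟩

theorem Ends.branch {b : BExpr} {P P' : Program} {s : Store} {c c' : ℕ} {Q : Store → Prop}
    (h : b.eval s → Ends P s c Q) (h' : ¬ b.eval s → Ends P' s c' Q) :
    Ends (.branch b P P') s (b.cost + 1 + c + c') Q := by
  by_cases hb : b.eval s
  · obtain ⟨t, s', h, ht, hs⟩ := h hb
    exact ⟨_, s', .branchTrue hb h, by omega, hs⟩
  · obtain ⟨t, s', h, ht, hs⟩ := h' hb
    exact ⟨_, s', .branchFalse hb h, by omega, hs⟩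

/-- At most r bodies and r + 1 tests are executed. The counter r is a ghost value that need not be
computable from the store; merge sort and binary search use it as an exponent. -/
theorem Ends.loop_nat {b : BExpr} {P : Program} (I : ℕ → Store → Prop) {c : ℕ}
    (h : ∀ r s, I r s → b.eval s → Ends P s c (fun s' => ∃ r' < r, I r' s')) :
    ∀ r s, I r s →
      Ends (.loop b P) s ((r + 1) * (c + b.cost + 1)) (fun s' => ¬ b.eval s' ∧ ∃ r', I r' s') := by
  intro r
  induction r using Nat.strong_induction_on with
  | _ r ih =>
    intro s hI
    by_cases hb : b.eval s
    · obtain ⟨t, s', hr, ht, r', hr', hI'⟩ := h r s hI hb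
      obtain ⟨t', s'', hr2, ht', hs⟩ := ih r' hr' s' hI'
      refine ⟨_, s'', .loopTrue hb hr hr2, ?_, hs⟩
      have : (r' + 1) * (c + b.cost + 1) + (c + b.cost + 1) ≤ (r + 1) * (c + b.cost + 1) := by
        rw [← Nat.succ_mul]; exact Nat.mul_le_mul_right _ (by omega)
      omega
    · exact ⟨_, s, .loopFalse hb, by nlinarith [Nat.zero_le r, Nat.zero_le c], hb, r, hI⟩

theorem Ends.loop {b : BExpr} {P : Program} (J : Store → Prop) (μ : Store → ℕ) {c : ℕ}
    (h : ∀ s, J s → b.eval s → Ends P s c (fun s' => J s' ∧ μ s' < μ s)) {s : Store} (hs : J s) :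
    Ends (.loop b P) s ((μ s + 1) * (c + b.cost + 1)) (fun s' => ¬ b.eval s' ∧ J s') := by
  refine (Ends.loop_nat (fun r s => J s ∧ μ s = r) (c := c) ?_ (μ s) s ⟨hs, rfl⟩).mono le_rfl ?_
  · rintro r s ⟨hJ, rfl⟩ hb
    exact (h s hJ hb).mono le_rfl fun s' h' => ⟨μ s', h'.2, h'.1, rfl⟩
  · rintro s' ⟨hb, r, hJ, -⟩
    exact ⟨hb, hJ⟩

/-- The store `s` with the value `z` assigned to the integer variable `x`. -/
def Store.setI (s : Store) (x : ℕ) (z : ℤ) : Store :=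
  { s with ivar := Function.update s.ivar x z }

/-- The store `s` with the value `z` assigned to the real variable `x`. -/
def Store.setR (s : Store) (x : ℕ) (z : ℝ) : Store :=
  { s with rvar := Function.update s.rvar x z }

/-- The store `s` with the value `z` assigned to cell `i` of the integer array `a`. -/
def Store.setIA (s : Store) (a : ℕ) (i z : ℤ) : Store :=
  { s with iarr := Function.update s.iarr a (Function.update (s.iarr a) i z) }

/-- The store `s` with the value `z` assigned to cell `i` of the real array `a`. -/
def Store.setRA (s : Store) (a : ℕ) (i : ℤ) (z : ℝ) : Store :=
  { s with rarr := Function.update s.rarr a (Function.update (s.rarr a) i z) }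

section
variable (s : Store) (x y a : ℕ) (i z : ℤ) (w : ℝ)

theorem Store.setI_ivar : (s.setI x z).ivar y = if y = x then z else s.ivar y := by
  simp [Store.setI, Function.update_apply]
@[simp] theorem Store.setI_rvar : (s.setI x z).rvar = s.rvar := rfl
@[simp] theorem Store.setI_iarr : (s.setI x z).iarr = s.iarr := rfl
@[simp] theorem Store.setI_rarr : (s.setI x z).rarr = s.rarr := rfl
theorem Store.setR_rvar : (s.setR x w).rvar y = if y = x then w else s.rvar y := by
  simp [Store.setR, Function.update_apply]
@[simp] theorem Store.setR_ivar : (s.setR x w).ivar = s.ivar := rfl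
@[simp] theorem Store.setR_iarr : (s.setR x w).iarr = s.iarr := rfl
@[simp] theorem Store.setR_rarr : (s.setR x w).rarr = s.rarr := rfl
theorem Store.setIA_iarr : (s.setIA a i z).iarr y =
    if y = a then Function.update (s.iarr a) i z else s.iarr y := by
  simp [Store.setIA, Function.update_apply]
@[simp] theorem Store.setIA_ivar : (s.setIA a i z).ivar = s.ivar := rfl
@[simp] theorem Store.setIA_rvar : (s.setIA a i z).rvar = s.rvar := rfl
@[simp] theorem Store.setIA_rarr : (s.setIA a i z).rarr = s.rarr := rfl
theorem Store.setRA_rarr : (s.setRA a i w).rarr y =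
    if y = a then Function.update (s.rarr a) i w else s.rarr y := by
  simp [Store.setRA, Function.update_apply]
@[simp] theorem Store.setRA_ivar : (s.setRA a i w).ivar = s.ivar := rfl
@[simp] theorem Store.setRA_rvar : (s.setRA a i w).rvar = s.rvar := rfl
@[simp] theorem Store.setRA_iarr : (s.setRA a i w).iarr = s.iarr := rfl

end

/-- A program without loops. -/
def Program.straight : Program → Bool
  | .seq P Q => P.straight && Q.straight
  | .branch _ P Q => P.straight && Q.straight
  | .loop _ _ => false
  | _ => true

/-- The effect of a program without loops. -/
noncomputable def Program.exec (P : Program) (s : Store) : Store :=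
  open Classical in
  match P with
  | .skip => s
  | .setIVar x e => s.setI x (e.eval s)
  | .setRVar x e => s.setR x (e.eval s)
  | .setIArr a i e => s.setIA a (i.eval s) (e.eval s)
  | .setRArr a i e => s.setRA a (i.eval s) (e.eval s)
  | .seq P Q => Q.exec (P.exec s)
  | .branch b P Q => if b.eval s then P.exec s else Q.exec s
  | .loop _ _ => s

/-- A bound on the number of steps of a program without loops. -/
def Program.steps : Program → ℕ
  | .skip => 1
  | .setIVar _ e => e.cost + 1
  | .setRVar _ e => e.cost + 1
  | .setIArr _ i e => i.cost + e.cost + 1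
  | .setRArr _ i e => i.cost + e.cost + 1
  | .seq P Q => P.steps + Q.steps
  | .branch b P Q => b.cost + 1 + P.steps + Q.steps
  | .loop _ _ => 0

/-- Loop-free code is executed symbolically. Charging both sides of each branch makes the bound
independent of the store and costs only a constant factor. -/
theorem Ends.of_exec {P : Program} (hP : P.straight = true) {s : Store} {Q : Store → Prop}
    (h : Q (P.exec s)) : Ends P s P.steps Q := by
  induction P generalizing s Q with
  | skip => exact ⟨_, _, .skip s, le_rfl, h⟩
  | setIVar x e => exact ⟨_, _, .setIVar x e s, le_rfl, h⟩
  | setRVar x e => exact ⟨_, _, .setRVar x e s, le_rfl, h⟩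
  | setIArr a i e => exact ⟨_, _, .setIArr a i e s, le_rfl, h⟩
  | setRArr a i e => exact ⟨_, _, .setRArr a i e s, le_rfl, h⟩
  | seq P P' ih ih' =>
    simp only [Program.straight, Bool.and_eq_true] at hP
    exact Ends.seq (ih hP.1 (ih' hP.2 h))
  | branch b P P' ih ih' =>
    simp only [Program.straight, Bool.and_eq_true] at hP
    refine Ends.branch (fun hb => ih hP.1 ?_) (fun hb => ih' hP.2 ?_) <;>
      simpa [Program.exec, hb] using h
  | loop => simp [Program.straight] at hP

/-- The stores `s` and `s'` agree on everything that `P` does not assign to. -/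
structure Frame (P : Program) (s s' : Store) : Prop where
  ivar : ∀ {x : ℕ}, P.keepsI x = true → s'.ivar x = s.ivar x
  rvar : ∀ {x : ℕ}, P.keepsR x = true → s'.rvar x = s.rvar x
  iarr : ∀ {a : ℕ}, P.keepsIA a = true → s'.iarr a = s.iarr a
  rarr : ∀ {a : ℕ}, P.keepsRA a = true → s'.rarr a = s.rarr a

theorem Runs.frame {P : Program} {s s' : Store} {t : ℕ} (h : Runs P s t s') : Frame P s s' :=
  ⟨h.ivar_eq, h.rvar_eq, h.iarr_eq, h.rarr_eq⟩

theorem Frame.refl (P : Program) (s : Store) : Frame P s s :=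
  ⟨fun _ => rfl, fun _ => rfl, fun _ => rfl, fun _ => rfl⟩

theorem Frame.trans {P : Program} {s s' s'' : Store} (h : Frame P s s') (h' : Frame P s' s'') :
    Frame P s s'' :=
  ⟨fun k => (h'.ivar k).trans (h.ivar k), fun k => (h'.rvar k).trans (h.rvar k),
    fun k => (h'.iarr k).trans (h.iarr k), fun k => (h'.rarr k).trans (h.rarr k)⟩

theorem Ends.frame {P : Program} {s : Store} {c : ℕ} {Q : Store → Prop} (h : Ends P s c Q) :
    Ends P s c (fun s' => Frame P s s' ∧ Q s') := by
  obtain ⟨t, s', hr, ht, hs⟩ := h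
  exact ⟨t, s', hr, ht, hr.frame, hs⟩

theorem Ends.seq_frame {P P' : Program} {s : Store} {c c' : ℕ} {Q R : Store → Prop}
    (h : Ends P s c R) (h' : ∀ s', Frame P s s' → R s' → Ends P' s' c' Q) :
    Ends (.seq P P') s (c + c') Q :=
  Ends.seq_runs h fun _ s' hr hs => h' s' hr.frame hs

theorem Ends.loop_frame {b : BExpr} {P : Program} {s : Store} (J : Store → Prop) (μ : Store → ℕ)
    {c : ℕ} (hs : J s)
    (h : ∀ s', Frame P s s' → J s' → b.eval s' → Ends P s' c (fun s'' => J s'' ∧ μ s'' < μ s')) :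
    Ends (.loop b P) s ((μ s + 1) * (c + b.cost + 1)) (fun s' => ¬ b.eval s' ∧ J s') := by
  refine (Ends.loop (fun s' => Frame P s s' ∧ J s') μ ?_ ⟨Frame.refl P s, hs⟩).mono le_rfl
    fun s' h' => ⟨h'.1, h'.2.2⟩
  rintro s' ⟨hf, hJ⟩ hb
  exact (h s' hf hJ hb).frame.mono le_rfl fun s'' h' => ⟨⟨hf.trans h'.1, h'.2.1⟩, h'.2.2⟩

/-- The loop in which the integer variable `x` runs from `a` to the bound `b` (exclusive). -/
def Program.forTo (x : ℕ) (a b : IExpr) (P : Program) : Program :=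
  .seq (.setIVar x a)
    (.loop (.not (.ile b (.var x))) (.seq P (.setIVar x (.add (.var x) (.const 1)))))

/-- The invariant refers to the head of the loop, so the body has to establish it for the store in
which the counter has already been increased. On exit only M ≤ `ivar x` is known; where equality is
needed, the invariant must contain the opposite inequality. -/
theorem Ends.forTo {x : ℕ} {a b : IExpr} {P : Program} (hP : P.keepsI x = true) {s : Store}
    (J : Store → Prop) {M z : ℤ} {c : ℕ} (hz : a.eval s = z) (h0 : J (s.setI x z))
    (hb : ∀ s, J s → b.eval s = M)
    (h : ∀ s, J s → s.ivar x < M → Ends P s c (fun s' => J (s'.setI x (s.ivar x + 1)))) :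
    Ends (.forTo x a b P) s (((M - z).toNat + 1) * (c + a.cost + b.cost + 9))
      (fun s' => M ≤ s'.ivar x ∧ J s') := by
  refine (Ends.seq ⟨_, _, .setIVar x a s, le_rfl, Ends.loop (c := c + 4) J
    (fun s => (M - s.ivar x).toNat) ?_ (by rw [hz]; exact h0)⟩).mono ?_ ?_
  · intro s hJ hs
    simp only [BExpr.eval, IExpr.eval, hb s hJ, not_le] at hs
    refine Ends.seq ?_
    obtain ⟨t, s', hr, ht, hJ'⟩ := h s hJ hs
    have hx := hr.ivar_eq hP
    refine ⟨t, s', hr, ht, _, _, .setIVar x _ s', le_rfl, ?_⟩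
    simp only [IExpr.eval, hx]
    refine ⟨hJ', ?_⟩
    simp
    omega
  · simp only [hz, Function.update_self, BExpr.cost, IExpr.cost]
    set r := (M - z).toNat
    nlinarith [Nat.zero_le r, Nat.zero_le c, Nat.zero_le a.cost, Nat.zero_le b.cost,
      Nat.zero_le (r * a.cost)]
  · rintro s' ⟨hs, hJ⟩
    simp only [BExpr.eval, IExpr.eval, hb s' hJ, not_not] at hs
    exact ⟨hs, hJ⟩

/-- Agreement with the initial store on everything the loop does not assign is added to the
invariant, so that J has to speak only of what changes. -/
theorem Ends.forTo_frame {x : ℕ} {a b : IExpr} {P : Program} (hP : P.keepsI x = true) {s : Store}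
    (J : Store → Prop) {M z : ℤ} {c : ℕ} (hz : a.eval s = z) (h0 : J (s.setI x z))
    (hb : ∀ s', Frame (.forTo x a b P) s s' → J s' → b.eval s' = M)
    (h : ∀ s', Frame (.forTo x a b P) s s' → J s' → s'.ivar x < M →
      Ends P s' c (fun s'' => Frame P s' s'' → J (s''.setI x (s'.ivar x + 1)))) :
    Ends (.forTo x a b P) s (((M - z).toNat + 1) * (c + a.cost + b.cost + 9))
      (fun s' => M ≤ s'.ivar x ∧ J s') := by
  have hset : ∀ (s' : Store) (z : ℤ), Frame (.forTo x a b P) s' (s'.setI x z) := fun s' z =>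
    ⟨fun k => by
      simp only [Program.forTo, Program.keepsI, Bool.and_eq_true, Bool.not_eq_true',
        beq_eq_false_iff_ne] at k
      simp [Store.setI_ivar, k.1], fun _ => rfl, fun _ => rfl, fun _ => rfl⟩
  have hbody : ∀ s' s'' : Store, Frame P s' s'' → Frame (.forTo x a b P) s' s'' := fun s' s'' hf =>
    ⟨fun k => hf.ivar (by
      simp only [Program.forTo, Program.keepsI, Bool.and_eq_true] at k; exact k.2.1),
      fun k => hf.rvar (by
        simp only [Program.forTo, Program.keepsR, Bool.and_eq_true] at k; exact k.2.1),
      fun k => hf.iarr (by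
        simp only [Program.forTo, Program.keepsIA, Bool.and_eq_true] at k; exact k.2.1),
      fun k => hf.rarr (by
        simp only [Program.forTo, Program.keepsRA, Bool.and_eq_true] at k; exact k.2.1)⟩
  refine (Ends.forTo hP (fun s' => Frame (.forTo x a b P) s s' ∧ J s') hz ⟨hset s z, h0⟩
    (fun s' h' => hb s' h'.1 h'.2) ?_).mono le_rfl fun s' h' => ⟨h'.1, h'.2.2⟩
  rintro s' ⟨hf, hJ⟩ hx
  exact (h s' hf hJ hx).frame.mono le_rfl fun s'' h' =>
    ⟨(hf.trans (hbody _ _ h'.1)).trans (hset _ _), h'.2 h'.1⟩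

end RealRAM

/-! ### Trees given by parent pointers -/

/-- A weighted rooted tree on the vertices `0, …, n - 1`, given by the parent `par i < i` of every
vertex `i ≠ 0`, the distances `d` from the root `0` and the lowest common ancestors. -/
structure ParentTree where
  n : ℤ
  par : ℤ → ℤ
  d : ℤ → ℝ
  lca : ℤ → ℤ → ℤ
  n_pos : 1 ≤ n
  par_nonneg : ∀ i, 1 ≤ i → i < n → 0 ≤ par i
  par_lt : ∀ i, 1 ≤ i → i < n → par i < i
  d_zero : d 0 = 0
  d_par_le : ∀ i, 1 ≤ i → i < n → d (par i) ≤ d i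
  lca_self : ∀ i, 0 ≤ i → i < n → lca i i = i
  lca_comm : ∀ i j, 0 ≤ i → i < n → 0 ≤ j → j < n → lca i j = lca j i
  lca_par : ∀ i j, 0 ≤ j → j < i → i < n → lca i j = lca (par i) j

namespace ParentTree

variable (T : ParentTree)

/-- The quantity `f i + f j - 2 f (lca i j)`: for the distances `f` from the root, this is the
distance of `i` and `j`. -/
def dist (f : ℤ → ℝ) (i j : ℤ) : ℝ := f i + f j - 2 * f (T.lca i j)

theorem lca_bounds : ∀ i j, 0 ≤ i → i < T.n → 0 ≤ j → j < T.n →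
    0 ≤ T.lca i j ∧ T.lca i j ≤ i ∧ T.lca i j ≤ j := by
  -- By symmetry j ≤ i may be assumed; replacing the larger index by its parent lowers i + j.
  have key : ∀ m : ℕ, ∀ i j, 0 ≤ j → j ≤ i → i < T.n → (i + j).toNat = m →
      0 ≤ T.lca i j ∧ T.lca i j ≤ i ∧ T.lca i j ≤ j := by
    intro m
    induction m using Nat.strong_induction_on with
    | _ m ih =>
      intro i j hj hji hi hm
      rcases hji.eq_or_lt with rfl | hlt
      · rw [T.lca_self _ hj hi]; omega
      · rw [T.lca_par i j hj hlt hi]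
        have h1 := T.par_nonneg i (by omega) hi
        have h2 := T.par_lt i (by omega) hi
        rcases le_total j (T.par i) with h | h
        · have := ih _ (by omega) (T.par i) j hj h (by omega) rfl
          omega
        · rw [T.lca_comm _ _ h1 (by omega) hj (by omega)]
          have := ih _ (by omega) j (T.par i) h1 h (by omega) rfl
          omega
  intro i j hi hin hj hjn
  rcases le_total j i with h | h
  · exact key _ i j hj h hin rfl
  · rw [T.lca_comm i j hi hin hj hjn]
    have := key _ j i hi h hjn rfl
    omega

/-- `x` gives the rounded distances from the root for a rounding all of whose path errors are at
most `ε`. -/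
def IsGood (ε : ℝ) (x : ℤ → ℤ) : Prop :=
  x 0 = 0 ∧ (∀ i, 1 ≤ i → i < T.n → x (T.par i) ≤ x i) ∧
    ∀ i j, 0 ≤ i → i < T.n → 0 ≤ j → j < T.n → i ≠ j →
      |T.dist (fun v => (x v : ℝ) - T.d v) i j| ≤ ε

theorem IsGood.mono {ε ε' : ℝ} {x : ℤ → ℤ} (h : T.IsGood ε x) (hε : ε ≤ ε') :
    T.IsGood ε' x :=
  ⟨h.1, h.2.1, fun i j hi hin hj hjn hij => (h.2.2 i j hi hin hj hjn hij).trans hε⟩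

/-- Rounding down makes every error f lie in (-1, 0], so f i + f j - 2 f (lca i j) stays strictly
between -2 and 2. -/
theorem exists_isGood_two : ∃ x, T.IsGood 2 x := by
  refine ⟨fun i => ⌊T.d i⌋, by simp [T.d_zero], fun i h1 h2 =>
    Int.floor_le_floor (T.d_par_le i h1 h2), fun i j _ _ _ _ _ => ?_⟩
  simp only [dist]
  have a1 := Int.floor_le (T.d i)
  have a2 := Int.lt_floor_add_one (T.d i)
  have b1 := Int.floor_le (T.d j)
  have b2 := Int.lt_floor_add_one (T.d j)
  have c1 := Int.floor_le (T.d (T.lca i j))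
  have c2 := Int.lt_floor_add_one (T.d (T.lca i j))
  rw [abs_le]
  constructor <;> linarith

end ParentTree

/-! ### The dynamic program -/

/-- A tree together with the five candidates `x (5 * v + k)`, `0 ≤ k < 5`, for the rounded distance
of `v` from the root, the corresponding errors `e (5 * v + k)`, and a sorted list `S` of length `N`
that contains all these errors. -/
structure Levels extends ParentTree where
  x : ℤ → ℤ
  e : ℤ → ℝ
  S : ℤ → ℝ
  N : ℤ
  N_pos : 1 ≤ N
  x_eq : ∀ v k, 0 ≤ v → v < n → 0 ≤ k → k < 5 → x (5 * v + k) = ⌊d v⌋ + k - 2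
  e_eq : ∀ v k, 0 ≤ v → v < n → 0 ≤ k → k < 5 → e (5 * v + k) = x (5 * v + k) - d v
  S_mono : ∀ p q, 0 ≤ p → p ≤ q → q < N → S p ≤ S q
  S_zero : S 0 = -100
  S_le : ∀ p, 0 ≤ p → p < N → S p ≤ 2
  exists_S_eq : ∀ v k, 0 ≤ v → v < n → 0 ≤ k → k < 5 →
    ∃ p, 0 ≤ p ∧ p < N ∧ S p = e (5 * v + k)

namespace Levels

variable (I : Levels)

/-- The error is k - 2 minus a fractional part. These bounds keep genuine errors far from the
sentinel -100; the value -50 serves as the dividing line. -/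
theorem e_bounds {v k : ℤ} (hv : 0 ≤ v) (hvn : v < I.n) (hk : 0 ≤ k) (hk5 : k < 5) :
    -3 < I.e (5 * v + k) ∧ I.e (5 * v + k) ≤ 2 := by
  rw [I.e_eq v k hv hvn hk hk5, I.x_eq v k hv hvn hk hk5]
  have a1 := Int.floor_le (I.d v)
  have a2 := Int.lt_floor_add_one (I.d v)
  have h1 : (0 : ℝ) ≤ k := by exact_mod_cast hk
  have h2 : (k : ℝ) ≤ 4 := by exact_mod_cast (by omega : k ≤ 4)
  push_cast
  constructor <;> linarith

/-- The table of a vertex that represents nothing but itself. -/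
noncomputable def initTable (v k p : ℤ) : ℝ :=
  if I.e (5 * v + k) ≤ I.S p then I.e (5 * v + k) else -100

/-- Every table entry is nondecreasing in the upper bound. -/
def Mono (F : ℤ → ℤ → ℤ → ℝ) (m : ℤ) : Prop :=
  ∀ v k p q, 0 ≤ v → v < m → 0 ≤ k → k < 5 → 0 ≤ p → p ≤ q → q < I.N → F v k p ≤ F v k q

/-- The table entries of a vertex in state `a` with upper bound `p₁` and of its child `i` in state
`z` with upper bound `p₂` can be combined, where the error of the vertex is `e`. -/
structure Combines (ε : ℝ) (i : ℤ) (F : ℤ → ℤ → ℤ → ℝ) (a p z p₁ p₂ : ℤ) : Prop where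
  z_nonneg : 0 ≤ z
  z_lt : z < 5
  x_le : I.x (5 * I.par i + a) ≤ I.x (5 * i + z)
  nonneg₁ : 0 ≤ p₁
  nonneg₂ : 0 ≤ p₂
  le₁ : p₁ ≤ p
  le₂ : p₂ ≤ p
  upper : I.S p₁ + I.S p₂ ≤ ε + 2 * I.e (5 * I.par i + a)
  lower : -ε + 2 * I.e (5 * I.par i + a) ≤ F (I.par i) a p₁ + F i z p₂

/-- The table `F'` arises from `F` by merging vertex `i` into its parent; `c₁`, `c₂` and `cz` record
a choice that attains the entry. -/
structure Folds (ε : ℝ) (i : ℤ) (F F' : ℤ → ℤ → ℤ → ℝ) (c₁ c₂ cz : ℤ → ℤ → ℤ) : Prop where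
  eq_of_ne : ∀ u k p, 0 ≤ u → u < i → u ≠ I.par i → 0 ≤ k → k < 5 → 0 ≤ p → p < I.N →
    F' u k p = F u k p
  le : ∀ a p z p₁ p₂, 0 ≤ a → a < 5 → 0 ≤ p → p < I.N → I.Combines ε i F a p z p₁ p₂ →
    min (F (I.par i) a p₁) (F i z p₂) ≤ F' (I.par i) a p
  attained : ∀ a p, 0 ≤ a → a < 5 → 0 ≤ p → p < I.N → -50 < F' (I.par i) a p →
    I.Combines ε i F a p (cz a p) (c₁ a p) (c₂ a p) ∧
      F' (I.par i) a p ≤ F (I.par i) a (c₁ a p) ∧ F' (I.par i) a p ≤ F i (cz a p) (c₂ a p)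
  mono : ∀ a p q, 0 ≤ a → a < 5 → 0 ≤ p → p ≤ q → q < I.N →
    F' (I.par i) a p ≤ F' (I.par i) a q

/-- The choice of the states `K` and of the upper bounds `P` for the first `m` vertices satisfies
all constraints. -/
structure Feasible (ε : ℝ) (m : ℤ) (F : ℤ → ℤ → ℤ → ℝ) (K P : ℤ → ℤ) : Prop where
  K_zero : K 0 = 2
  K_nonneg : ∀ v, 0 ≤ v → v < m → 0 ≤ K v
  K_lt : ∀ v, 0 ≤ v → v < m → K v < 5
  P_nonneg : ∀ v, 0 ≤ v → v < m → 0 ≤ P v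
  P_lt : ∀ v, 0 ≤ v → v < m → P v < I.N
  feas : ∀ v, 0 ≤ v → v < m → -50 < F v (K v) (P v)
  x_le : ∀ i, 1 ≤ i → i < m → I.x (5 * I.par i + K (I.par i)) ≤ I.x (5 * i + K i)
  upper : ∀ u v, 0 ≤ u → u < m → 0 ≤ v → v < m → u ≠ v →
    I.S (P u) + I.S (P v) ≤ ε + 2 * I.e (5 * I.lca u v + K (I.lca u v))
  lower : ∀ u v, 0 ≤ u → u < m → 0 ≤ v → v < m → u ≠ v →
    -ε + 2 * I.e (5 * I.lca u v + K (I.lca u v)) ≤ F u (K u) (P u) + F v (K v) (P v)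

theorem mono_initTable : I.Mono I.initTable I.n := by
  intro v k p q hv hvn hk hk5 hp hpq hq
  have h := I.S_mono p q hp hpq hq
  have := I.e_bounds hv hvn hk hk5
  unfold initTable
  split_ifs <;> linarith

variable {I}

theorem Folds.mono_table {ε : ℝ} {i : ℤ} {F F' : ℤ → ℤ → ℤ → ℝ} {c₁ c₂ cz : ℤ → ℤ → ℤ}
    (h : I.Folds ε i F F' c₁ c₂ cz) (hF : I.Mono F (i + 1)) : I.Mono F' i := by
  intro v k p q hv hvn hk hk5 hp hpq hq
  by_cases hvi : v = I.par i
  · subst hvi; exact h.mono k p q hk hk5 hp hpq hq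
  · rw [h.eq_of_ne v k p hv hvn hvi hk hk5 hp (by omega),
      h.eq_of_ne v k q hv hvn hvi hk hk5 (by omega) hq]
    exact hF v k p q hv (by omega) hk hk5 hp hpq hq

/-- A feasible choice for `i + 1` vertices gives a feasible choice for `i` vertices. -/
theorem Folds.feasible {ε : ℝ} {i : ℤ} {F F' : ℤ → ℤ → ℤ → ℝ} {c₁ c₂ cz : ℤ → ℤ → ℤ}
    (h : I.Folds ε i F F' c₁ c₂ cz) (hi : 1 ≤ i) (hin : i < I.n) {K P : ℤ → ℤ}
    (hF : I.Feasible ε (i + 1) F K P) : ∃ P', I.Feasible ε i F' K P' := by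
  have hv0 := I.par_nonneg i hi hin
  have hvi := I.par_lt i hi hin
  have hlca : I.lca (I.par i) i = I.par i := by
    rw [I.lca_comm _ _ hv0 (by omega) (by omega) hin, I.lca_par i _ hv0 hvi hin,
      I.lca_self _ hv0 (by omega)]
  -- Every other remaining vertex meets i and the parent of i at the same ancestor, so the
  -- constraints of both against u have the same right-hand side.
  have hlca' : ∀ u, 0 ≤ u → u < i → I.lca u i = I.lca u (I.par i) := by
    intro u hu hui
    rw [I.lca_comm u i hu (by omega) (by omega) hin, I.lca_par i u hu hui hin,
      I.lca_comm u _ hu (by omega) hv0 (by omega)]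
  have hPi := hF.P_nonneg i (by omega) (by omega)
  have hPi' := hF.P_lt i (by omega) (by omega)
  have hPv := hF.P_nonneg _ hv0 (by omega)
  have hPv' := hF.P_lt _ hv0 (by omega)
  have hK0 := hF.K_nonneg _ hv0 (by omega)
  have hK5 := hF.K_lt _ hv0 (by omega)
  -- The union of the two parts is bounded by the larger index; its value `I.S M` is one of the two
  -- old bounds, so each upper constraint of the union is an old one.
  obtain ⟨M, hM⟩ : ∃ M, M = max (P (I.par i)) (P i) := ⟨_, rfl⟩
  have hcomb : I.Combines ε i F (K (I.par i)) M (K i) (P (I.par i)) (P i) :=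
    { z_nonneg := hF.K_nonneg i (by omega) (by omega)
      z_lt := hF.K_lt i (by omega) (by omega)
      x_le := hF.x_le i hi (by omega)
      nonneg₁ := hPv
      nonneg₂ := hPi
      le₁ := by omega
      le₂ := by omega
      upper := by
        have := hF.upper (I.par i) i hv0 (by omega) (by omega) (by omega) (by omega)
        rwa [hlca] at this
      lower := by
        have := hF.lower (I.par i) i hv0 (by omega) (by omega) (by omega) (by omega)
        rwa [hlca] at this }
  have hle := h.le _ M _ _ _ hK0 hK5 (by omega) (by omega) hcomb
  have hSM : I.S M = I.S (P (I.par i)) ∨ I.S M = I.S (P i) := by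
    rcases max_choice (P (I.par i)) (P i) with h' | h' <;> rw [hM, h'] <;> simp
  have hup : ∀ u, 0 ≤ u → u < i → u ≠ I.par i →
      I.S (P u) + I.S M ≤ ε + 2 * I.e (5 * I.lca u (I.par i) + K (I.lca u (I.par i))) := by
    intro u hu hui huv
    rcases hSM with h' | h' <;> rw [h']
    · exact hF.upper u _ hu (by omega) hv0 (by omega) huv
    · have := hF.upper u i hu (by omega) (by omega) (by omega) (by omega)
      rwa [hlca' u hu hui] at this
  have hlow : ∀ u, 0 ≤ u → u < i → u ≠ I.par i →
      -ε + 2 * I.e (5 * I.lca u (I.par i) + K (I.lca u (I.par i))) ≤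
        F u (K u) (P u) + F' (I.par i) (K (I.par i)) M := by
    intro u hu hui huv
    have h1 := hF.lower u _ hu (by omega) hv0 (by omega) huv
    have h2 := hF.lower u i hu (by omega) (by omega) (by omega) (by omega)
    rw [hlca' u hu hui] at h2
    -- The merged minimum is at least one of the two old minima, and u satisfies the lower
    -- constraint against both parts.
    rcases min_choice (F (I.par i) (K (I.par i)) (P (I.par i))) (F i (K i) (P i)) with h' | h' <;>
      rw [h'] at hle <;> linarith
  have hne : ∀ u, 0 ≤ u → u < i → u ≠ I.par i → F' u (K u) (P u) = F u (K u) (P u) :=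
    fun u hu hui huv => h.eq_of_ne u _ _ hu hui huv (hF.K_nonneg u hu (by omega))
      (hF.K_lt u hu (by omega)) (hF.P_nonneg u hu (by omega)) (hF.P_lt u hu (by omega))
  refine ⟨Function.update P (I.par i) M, hF.K_zero, fun v hv hv' => hF.K_nonneg v hv (by omega),
    fun v hv hv' => hF.K_lt v hv (by omega), ?_, ?_, ?_,
    fun j hj hj' => hF.x_le j hj (by omega), ?_, ?_⟩
  · intro v hv hv'
    rw [Function.update_apply]
    split_ifs
    · omega
    · exact hF.P_nonneg v hv (by omega)
  · intro v hv hv'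
    rw [Function.update_apply]
    split_ifs
    · omega
    · exact hF.P_lt v hv (by omega)
  · intro v hv hv'
    rw [Function.update_apply]
    split_ifs with hc
    · subst hc
      exact (lt_min (hF.feas _ hv0 (by omega)) (hF.feas i (by omega) (by omega))).trans_le hle
    · rw [hne v hv hv' hc]
      exact hF.feas v hv (by omega)
  · intro u v hu hui hv hvi' huv
    simp only [Function.update_apply]
    split_ifs with h1 h2 h2
    · omega
    · subst h1
      rw [I.lca_comm _ _ hu (by omega) hv (by omega), add_comm]
      exact hup v hv hvi' h2
    · subst h2
      exact hup u hu hui h1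
    · exact hF.upper u v hu (by omega) hv (by omega) huv
  · intro u v hu hui hv hvi' huv
    simp only [Function.update_apply]
    split_ifs with h1 h2 h2
    · omega
    · subst h1
      rw [I.lca_comm _ _ hu (by omega) hv (by omega), hne v hv hvi' h2, add_comm (F' _ _ _)]
      exact hlow v hv hvi' h2
    · subst h2
      rw [hne u hu hui h1]
      exact hlow u hu hui h1
    · rw [hne u hu hui h1, hne v hv hvi' h2]
      exact hF.lower u v hu (by omega) hv (by omega) huv

/-- A feasible choice for `i` vertices extends to `i + 1` vertices by the recorded choices. -/
theorem Folds.feasible_succ {ε : ℝ} {i : ℤ} {F F' : ℤ → ℤ → ℤ → ℝ} {c₁ c₂ cz : ℤ → ℤ → ℤ}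
    (h : I.Folds ε i F F' c₁ c₂ cz) (hi : 1 ≤ i) (hin : i < I.n) {K P : ℤ → ℤ}
    (hF : I.Feasible ε i F' K P) :
    I.Feasible ε (i + 1) F
      (Function.update K i (cz (K (I.par i)) (P (I.par i))))
      (Function.update (Function.update P i (c₂ (K (I.par i)) (P (I.par i)))) (I.par i)
        (c₁ (K (I.par i)) (P (I.par i)))) := by
  have hv0 := I.par_nonneg i hi hin
  have hvi := I.par_lt i hi hin
  have hlca : I.lca (I.par i) i = I.par i := by
    rw [I.lca_comm _ _ hv0 (by omega) (by omega) hin, I.lca_par i _ hv0 hvi hin,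
      I.lca_self _ hv0 (by omega)]
  have hlca' : ∀ u, 0 ≤ u → u < i → I.lca u i = I.lca u (I.par i) := by
    intro u hu hui
    rw [I.lca_comm u i hu (by omega) (by omega) hin, I.lca_par i u hu hui hin,
      I.lca_comm u _ hu (by omega) hv0 (by omega)]
  have hK0 := hF.K_nonneg _ hv0 hvi
  have hK5 := hF.K_lt _ hv0 hvi
  have hP0 := hF.P_nonneg _ hv0 hvi
  have hPN := hF.P_lt _ hv0 hvi
  have hfeas := hF.feas _ hv0 hvi
  obtain ⟨hc, hF1, hF2⟩ := h.attained _ _ hK0 hK5 hP0 hPN hfeas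
  set v := I.par i with hv
  set p₁ := c₁ (K v) (P v)
  set p₂ := c₂ (K v) (P v)
  set z := cz (K v) (P v)
  -- Splitting the part only relaxes the constraints against other vertices: both recorded bounds
  -- are at most `P v`, and both old entries are at least the merged entry. Only the constraint
  -- between v and i is new; it is contained in `hc`.
  have hS1 := I.S_mono p₁ (P v) hc.nonneg₁ hc.le₁ hPN
  have hS2 := I.S_mono p₂ (P v) hc.nonneg₂ hc.le₂ hPN
  have hne : ∀ u, 0 ≤ u → u < i → u ≠ v → F' u (K u) (P u) = F u (K u) (P u) :=
    fun u hu hui huv => h.eq_of_ne u _ _ hu hui huv (hF.K_nonneg u hu (by omega))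
      (hF.K_lt u hu (by omega)) (hF.P_nonneg u hu (by omega)) (hF.P_lt u hu (by omega))
  set K' := Function.update K i z with hK'
  set P' := Function.update (Function.update P i p₂) v p₁ with hP'
  have eK : ∀ u, u < i → K' u = K u := fun u hu => Function.update_of_ne (by omega) _ _
  have eKi : K' i = z := Function.update_self _ _ _
  have eP : ∀ u, u < i → u ≠ v → P' u = P u := fun u hu huv => by
    rw [hP', Function.update_of_ne huv, Function.update_of_ne (by omega)]
  have ePv : P' v = p₁ := Function.update_self _ _ _
  have ePi : P' i = p₂ := by
    rw [hP', Function.update_of_ne (by omega), Function.update_self]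
  have cases3 : ∀ u, u < i + 1 → u = i ∨ u = v ∨ (u < i ∧ u ≠ v) := by intro u hu; omega
  have hlt : ∀ u w, 0 ≤ u → u < I.n → 0 ≤ w → w < I.n → u < i ∨ w < i → K' (I.lca u w) =
      K (I.lca u w) := by
    intro u w hu hun hw hwn h'
    have := I.lca_bounds u w hu hun hw hwn
    exact eK _ (by omega)
  have eKv : K' v = K v := eK v hvi
  refine ⟨?_, ?_, ?_, ?_, ?_, ?_, ?_, ?_, ?_⟩
  · rw [eK 0 (by omega), hF.K_zero]
  · intro u hu hu'
    rcases cases3 u hu' with rfl | rfl | ⟨h1, h2⟩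
    · rw [eKi]; exact hc.z_nonneg
    · rw [eK _ hvi]; exact hK0
    · rw [eK u h1]; exact hF.K_nonneg u hu h1
  · intro u hu hu'
    rcases cases3 u hu' with rfl | rfl | ⟨h1, h2⟩
    · rw [eKi]; exact hc.z_lt
    · rw [eK _ hvi]; exact hK5
    · rw [eK u h1]; exact hF.K_lt u hu h1
  · intro u hu hu'
    rcases cases3 u hu' with rfl | rfl | ⟨h1, h2⟩
    · rw [ePi]; exact hc.nonneg₂
    · rw [ePv]; exact hc.nonneg₁
    · rw [eP u h1 h2]; exact hF.P_nonneg u hu h1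
  · intro u hu hu'
    rcases cases3 u hu' with rfl | rfl | ⟨h1, h2⟩
    · rw [ePi]; exact hc.le₂.trans_lt hPN
    · rw [ePv]; exact hc.le₁.trans_lt hPN
    · rw [eP u h1 h2]; exact hF.P_lt u hu h1
  · intro u hu hu'
    rcases cases3 u hu' with rfl | rfl | ⟨h1, h2⟩
    · rw [ePi, eKi]; linarith
    · rw [ePv, eK _ hvi]; linarith
    · rw [eP u h1 h2, eK u h1, ← hne u hu h1 h2]; exact hF.feas u hu h1
  · intro j hj hj'
    have hj0 := I.par_nonneg j hj (by omega)
    have hjl := I.par_lt j hj (by omega)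
    rw [eK (I.par j) (by omega)]
    rcases eq_or_ne j i with rfl | hji
    · rw [eKi]; exact hc.x_le
    · rw [eK j (by omega)]; exact hF.x_le j hj (by omega)
  · have hvv : ∀ u, 0 ≤ u → u < i → u ≠ v → I.S (P' u) + I.S p₁ ≤
        ε + 2 * I.e (5 * I.lca u v + K (I.lca u v)) ∧ I.S (P' u) + I.S p₂ ≤
        ε + 2 * I.e (5 * I.lca u v + K (I.lca u v)) := by
      intro u hu hui huv
      have := hF.upper u v hu hui hv0 hvi huv
      rw [eP u hui huv]
      constructor <;> linarith
    have hup := hc.upper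
    rw [← hv] at hup
    intro u w hu hu' hw hw' huw
    rcases cases3 u hu' with rfl | rfl | ⟨h1, h2⟩ <;> rcases cases3 w hw' with rfl | rfl | ⟨h3, h4⟩
    · omega
    · rw [I.lca_comm _ _ (by omega) hin hv0 (by omega), hlca, ePi, ePv, eKv]; linarith
    · rw [hlt _ _ (by omega) hin hw (by omega) (Or.inr h3), I.lca_comm _ _ (by omega) hin hw
        (by omega), hlca' w hw h3, ePi, add_comm]
      exact (hvv w hw h3 h4).2
    · rw [hlca, ePi, ePv, eKv]; linarith
    · omega
    · rw [hlt _ _ (by omega) (by omega) hw (by omega) (Or.inr h3), I.lca_comm _ _ hv0 (by omega) hw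
        (by omega), ePv, add_comm]
      exact (hvv w hw h3 h4).1
    · rw [hlt _ _ hu (by omega) (by omega) hin (Or.inl h1), hlca' u hu h1, ePi]
      exact (hvv u hu h1 h2).2
    · rw [hlt _ _ hu (by omega) (by omega) (by omega) (Or.inl h1), ePv]
      exact (hvv u hu h1 h2).1
    · rw [hlt _ _ hu (by omega) hw (by omega) (Or.inl h1), eP u h1 h2, eP w h3 h4]
      exact hF.upper u w hu h1 hw h3 huw
  · have hvv : ∀ u, 0 ≤ u → u < i → u ≠ v → -ε + 2 * I.e (5 * I.lca u v + K (I.lca u v)) ≤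
        F u (K' u) (P' u) + F v (K v) p₁ ∧ -ε + 2 * I.e (5 * I.lca u v + K (I.lca u v)) ≤
        F u (K' u) (P' u) + F i z p₂ := by
      intro u hu hui huv
      have := hF.lower u v hu hui hv0 hvi huv
      rw [eP u hui huv, eK u hui, ← hne u hu hui huv]
      constructor <;> linarith
    have hup := hc.lower
    rw [← hv] at hup
    intro u w hu hu' hw hw' huw
    rcases cases3 u hu' with rfl | rfl | ⟨h1, h2⟩ <;> rcases cases3 w hw' with rfl | rfl | ⟨h3, h4⟩
    · omega
    · rw [I.lca_comm _ _ (by omega) hin hv0 (by omega), hlca, ePi, ePv, eKi, eKv]; linarith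
    · rw [hlt _ _ (by omega) hin hw (by omega) (Or.inr h3), I.lca_comm _ _ (by omega) hin hw
        (by omega), hlca' w hw h3, ePi, eKi, add_comm (F _ _ _)]
      exact (hvv w hw h3 h4).2
    · rw [hlca, ePi, ePv, eKi, eKv]; linarith
    · omega
    · rw [hlt _ _ (by omega) (by omega) hw (by omega) (Or.inr h3), I.lca_comm _ _ hv0 (by omega) hw
        (by omega), ePv, eKv, add_comm (F _ _ _)]
      exact (hvv w hw h3 h4).1
    · rw [hlt _ _ hu (by omega) (by omega) hin (Or.inl h1), hlca' u hu h1, ePi, eKi]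
      exact (hvv u hu h1 h2).2
    · rw [hlt _ _ hu (by omega) (by omega) (by omega) (Or.inl h1), ePv, eKv]
      exact (hvv u hu h1 h2).1
    · rw [hlt _ _ hu (by omega) hw (by omega) (Or.inl h1), eP u h1 h2, eP w h3 h4, eK u h1, eK w h3,
        ← hne u hu h1 h2, ← hne w hw h3 h4]
      exact hF.lower u w hu h1 hw h3 huw

/-- Rounded distances with errors at most `ε ≤ 2` give a feasible choice for the initial table. -/
theorem feasible_of_isGood {ε : ℝ} (hε : ε ≤ 2) {x : ℤ → ℤ} (hx : I.IsGood ε x) :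
    ∃ K P, I.Feasible ε I.n I.initTable K P := by
  obtain ⟨hx0, hxm, hxe⟩ := hx
  have hlca0 : ∀ v, 0 ≤ v → v < I.n → I.lca v 0 = 0 := by
    intro v hv hvn
    have := I.lca_bounds v 0 hv hvn le_rfl (by omega)
    omega
  -- The path from v to the root has error |x v - d v|, so ε ≤ 2 puts x v among the five candidates.
  have herr : ∀ v, 0 ≤ v → v < I.n → |(x v : ℝ) - I.d v| ≤ 2 := by
    intro v hv hvn
    rcases eq_or_ne v 0 with rfl | hv0
    · simp [hx0, I.d_zero]
    · have := hxe v 0 hv hvn le_rfl (by omega) hv0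
      simp only [ParentTree.dist, hlca0 v hv hvn, hx0, I.d_zero] at this
      simp only [Int.cast_zero, sub_zero, add_zero, mul_zero] at this
      exact this.trans hε
  set K : ℤ → ℤ := fun v => x v - ⌊I.d v⌋ + 2 with hK
  have hK0 : ∀ v, 0 ≤ v → v < I.n → 0 ≤ K v ∧ K v < 5 := by
    intro v hv hvn
    have h := abs_le.1 (herr v hv hvn)
    have a1 := Int.floor_le (I.d v)
    have a2 := Int.lt_floor_add_one (I.d v)
    have h1 : (-3 : ℤ) < x v - ⌊I.d v⌋ := by
      have : ((-3 : ℤ) : ℝ) < ((x v - ⌊I.d v⌋ : ℤ) : ℝ) := by push_cast; linarith [h.1]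
      exact_mod_cast this
    have h2 : x v - ⌊I.d v⌋ < 3 := by
      have : ((x v - ⌊I.d v⌋ : ℤ) : ℝ) < ((3 : ℤ) : ℝ) := by push_cast; linarith [h.2]
      exact_mod_cast this
    simp only [hK]
    omega
  have hxK : ∀ v, 0 ≤ v → v < I.n → I.x (5 * v + K v) = x v := by
    intro v hv hvn
    rw [I.x_eq v _ hv hvn (hK0 v hv hvn).1 (hK0 v hv hvn).2]
    simp only [hK]
    ring
  have heK : ∀ v, 0 ≤ v → v < I.n → I.e (5 * v + K v) = x v - I.d v := by
    intro v hv hvn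
    rw [I.e_eq v _ hv hvn (hK0 v hv hvn).1 (hK0 v hv hvn).2, hxK v hv hvn]
  -- A part that consists of a single vertex is bounded by exactly its own error, which occurs in
  -- the list S.
  have hPex : ∀ v, ∃ p, 0 ≤ v → v < I.n → 0 ≤ p ∧ p < I.N ∧ I.S p = I.e (5 * v + K v) := by
    intro v
    by_cases hv : 0 ≤ v ∧ v < I.n
    · obtain ⟨p, hp⟩ := I.exists_S_eq v (K v) hv.1 hv.2 (hK0 v hv.1 hv.2).1 (hK0 v hv.1 hv.2).2
      exact ⟨p, fun _ _ => hp⟩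
    · exact ⟨0, fun h1 h2 => absurd ⟨h1, h2⟩ hv⟩
  choose P hP using hPex
  have hinit : ∀ v, 0 ≤ v → v < I.n → I.initTable v (K v) (P v) = x v - I.d v := by
    intro v hv hvn
    rw [initTable, if_pos (hP v hv hvn).2.2.ge, heK v hv hvn]
  have hpair : ∀ u v, 0 ≤ u → u < I.n → 0 ≤ v → v < I.n → u ≠ v →
      |((x u : ℝ) - I.d u) + ((x v : ℝ) - I.d v) -
        2 * I.e (5 * I.lca u v + K (I.lca u v))| ≤ ε := by
    intro u v hu hun hv hvn huv
    have hb := I.lca_bounds u v hu hun hv hvn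
    rw [heK _ hb.1 (by omega)]
    exact hxe u v hu hun hv hvn huv
  refine ⟨K, P, by simp [hK, hx0, I.d_zero], fun v hv hvn => (hK0 v hv hvn).1,
    fun v hv hvn => (hK0 v hv hvn).2, fun v hv hvn => (hP v hv hvn).1,
    fun v hv hvn => (hP v hv hvn).2.1, ?_, ?_, ?_, ?_⟩
  · intro v hv hvn
    rw [hinit v hv hvn]
    linarith [(abs_le.1 (herr v hv hvn)).1]
  · intro i hi hin
    have := I.par_lt i hi hin
    rw [hxK _ (I.par_nonneg i hi hin) (by omega), hxK i (by omega) hin]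
    exact hxm i hi hin
  · intro u v hu hun hv hvn huv
    rw [(hP u hu hun).2.2, (hP v hv hvn).2.2, heK u hu hun, heK v hv hvn]
    linarith [(abs_le.1 (hpair u v hu hun hv hvn huv)).2]
  · intro u v hu hun hv hvn huv
    rw [hinit u hu hun, hinit v hv hvn]
    linarith [(abs_le.1 (hpair u v hu hun hv hvn huv)).1]

/-- A feasible choice for the initial table gives rounded distances with errors at most `ε`. -/
theorem Feasible.isGood {ε : ℝ} {K P : ℤ → ℤ} (h : I.Feasible ε I.n I.initTable K P) :
    I.IsGood ε (fun v => I.x (5 * v + K v)) := by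
  have hpos := I.n_pos
  have hinit : ∀ v, 0 ≤ v → v < I.n → I.initTable v (K v) (P v) = I.e (5 * v + K v) ∧
      I.e (5 * v + K v) ≤ I.S (P v) := by
    intro v hv hvn
    have := h.feas v hv hvn
    -- An entry above -50 cannot be the default -100, so the error of v respects its upper bound.
    unfold initTable at this ⊢
    split_ifs at this ⊢ with hc
    · exact ⟨rfl, hc⟩
    · linarith
  have heK : ∀ v, 0 ≤ v → v < I.n → I.e (5 * v + K v) = I.x (5 * v + K v) - I.d v :=
    fun v hv hvn => I.e_eq v _ hv hvn (h.K_nonneg v hv hvn) (h.K_lt v hv hvn)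
  refine ⟨?_, h.x_le, ?_⟩
  · have := I.x_eq 0 (K 0) le_rfl (by omega) (h.K_nonneg 0 le_rfl (by omega))
      (h.K_lt 0 le_rfl (by omega))
    simpa [I.d_zero, h.K_zero] using this
  · intro u v hu hun hv hvn huv
    have hb := I.lca_bounds u v hu hun hv hvn
    have h1 := h.upper u v hu hun hv hvn huv
    have h2 := h.lower u v hu hun hv hvn huv
    rw [(hinit u hu hun).1, (hinit v hv hvn).1] at h2
    have h3 := (hinit u hu hun).2
    have h4 := (hinit v hv hvn).2
    rw [heK _ hb.1 (by omega)] at h1 h2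
    rw [heK u hu hun] at h2 h3
    rw [heK v hv hvn] at h2 h4
    simp only [ParentTree.dist]
    rw [abs_le]
    constructor <;> linarith

variable (I) in
/-- A sequence of tables in which every vertex is merged into its parent, the last vertex first. -/
structure Chain (ε : ℝ) (i : ℤ) (F : ℤ → ℤ → ℤ → ℤ → ℝ) (c₁ c₂ cz : ℤ → ℤ → ℤ → ℤ) : Prop where
  init : ∀ v k p, 0 ≤ v → v < I.n → 0 ≤ k → k < 5 → 0 ≤ p → p < I.N →
    F I.n v k p = I.initTable v k p
  fold : ∀ m, i ≤ m → m < I.n → I.Folds ε m (F (m + 1)) (F m) (c₁ m) (c₂ m) (cz m)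

theorem Feasible.congr {ε : ℝ} {m : ℤ} {F F' : ℤ → ℤ → ℤ → ℝ} {K P : ℤ → ℤ}
    (h : I.Feasible ε m F K P) (hF : ∀ v k p, 0 ≤ v → v < m → 0 ≤ k → k < 5 → 0 ≤ p → p < I.N →
      F' v k p = F v k p) : I.Feasible ε m F' K P := by
  have e : ∀ v, 0 ≤ v → v < m → F' v (K v) (P v) = F v (K v) (P v) := fun v h1 h2 =>
    hF v _ _ h1 h2 (h.K_nonneg v h1 h2) (h.K_lt v h1 h2) (h.P_nonneg v h1 h2) (h.P_lt v h1 h2)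
  refine ⟨h.K_zero, h.K_nonneg, h.K_lt, h.P_nonneg, h.P_lt, ?_, h.x_le, h.upper, ?_⟩
  · intro v h1 h2; rw [e v h1 h2]; exact h.feas v h1 h2
  · intro u v h1 h2 h3 h4 h5; rw [e u h1 h2, e v h3 h4]; exact h.lower u v h1 h2 h3 h4 h5

theorem Chain.mono_table {ε : ℝ} {i : ℤ} {F : ℤ → ℤ → ℤ → ℤ → ℝ} {c₁ c₂ cz : ℤ → ℤ → ℤ → ℤ}
    (h : I.Chain ε i F c₁ c₂ cz) (hin : i ≤ I.n) : I.Mono (F i) i := by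
  refine Int.leInductionDown (m := I.n) (motive := fun j _ => i ≤ j → I.Mono (F j) j)
    ?_ ?_ i hin le_rfl
  · intro _ v k p q hv hvn hk hk5 hp hpq hq
    rw [h.init v k p hv hvn hk hk5 hp (by omega), h.init v k q hv hvn hk hk5 (by omega) hq]
    exact I.mono_initTable v k p q hv hvn hk hk5 hp hpq hq
  · intro j hj ih hij
    have hf := h.fold (j - 1) hij (by omega)
    exact hf.mono_table (by simpa using ih (by omega))

/-- The table entry of the root decides whether there are rounded distances with errors at most
`ε`. -/
theorem Chain.of_isGood {ε : ℝ} {F : ℤ → ℤ → ℤ → ℤ → ℝ} {c₁ c₂ cz : ℤ → ℤ → ℤ → ℤ}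
    (h : I.Chain ε 1 F c₁ c₂ cz) (hε : ε ≤ 2) {x : ℤ → ℤ} (hx : I.IsGood ε x) :
    -50 < F 1 0 2 (I.N - 1) := by
  have key : ∀ j, j ≤ I.n → 1 ≤ j → ∃ K P, I.Feasible ε j (F j) K P := by
    intro j hj
    refine Int.leInductionDown (m := I.n)
      (motive := fun j _ => 1 ≤ j → ∃ K P, I.Feasible ε j (F j) K P) ?_ ?_ j hj
    · intro _
      obtain ⟨K, P, hf⟩ := feasible_of_isGood hε hx
      exact ⟨K, P, hf.congr h.init⟩
    · intro j hj ih hij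
      obtain ⟨K, P, hf⟩ := ih (by omega)
      have hf' := h.fold (j - 1) hij (by omega)
      rw [sub_add_cancel] at hf'
      obtain ⟨P', hP⟩ := hf'.feasible hij (by omega) (by simpa using hf)
      exact ⟨K, P', hP⟩
  obtain ⟨K, P, hf⟩ := key 1 I.n_pos le_rfl
  have h1 := hf.feas 0 le_rfl (by omega)
  rw [hf.K_zero] at h1
  have hN := hf.P_lt 0 le_rfl (by omega)
  -- The bound `P 0` is unknown; monotonicity replaces it by the last index, which is the one the
  -- program inspects.
  exact h1.trans_le (h.mono_table I.n_pos 0 2 _ _ le_rfl (by omega) (by omega) (by omega)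
    (hf.P_nonneg 0 le_rfl (by omega)) (by omega) (by omega))

/-- A single part has neither edges nor pairs to be constrained. State 2 at the root stands for the
rounded distance ⌊0⌋ + 2 - 2 = 0. -/
theorem feasible_one {ε : ℝ} {F : ℤ → ℤ → ℤ → ℝ} {K P : ℤ → ℤ} (hK : K 0 = 2)
    (hP : P 0 = I.N - 1) (hF : -50 < F 0 2 (I.N - 1)) : I.Feasible ε 1 F K P := by
  have hN := I.N_pos
  have h0 : ∀ v : ℤ, 0 ≤ v → v < 1 → v = 0 := by intro v; omega
  refine ⟨hK, ?_, ?_, ?_, ?_, ?_, ?_, ?_, ?_⟩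
  · intro v h1 h2; rw [h0 v h1 h2, hK]; norm_num
  · intro v h1 h2; rw [h0 v h1 h2, hK]; norm_num
  · intro v h1 h2; rw [h0 v h1 h2, hP]; omega
  · intro v h1 h2; rw [h0 v h1 h2, hP]; omega
  · intro v h1 h2; rw [h0 v h1 h2, hP, hK]; exact hF
  · intro i h1 h2; omega
  · intro u v h1 h2 h3 h4 h5; omega
  · intro u v h1 h2 h3 h4 h5; omega

end Levels

/-! ### Sorting -/

/-- The consecutive blocks of length `w` of the first `N` cells are sorted. -/
def SortedBlocks (A : ℤ → ℝ) (w N : ℤ) : Prop :=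
  ∀ b, 0 ≤ b → b * w + w ≤ N → ∀ x y, b * w ≤ x → x ≤ y → y < b * w + w → A x ≤ A y

/-- The state of a pass of merge sort with block length `w` that merges the two blocks of `A` from
`b * (w + w)` on into `B`: the next cells are `i` and `j`, and cell `k` is to be written. -/
structure MergeInv (A B : ℤ → ℝ) (w b k i j : ℤ) : Prop where
  b_nonneg : 0 ≤ b
  le_i : b * (w + w) ≤ i
  i_le : i ≤ b * (w + w) + w
  le_j : b * (w + w) + w ≤ j
  j_le : j ≤ b * (w + w) + w + w
  k_eq : k = i + j - (b * (w + w) + w)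
  blocks : SortedBlocks B (w + w) (b * (w + w))
  sorted : ∀ x y, b * (w + w) ≤ x → x ≤ y → y < k → B x ≤ B y
  left : ∀ x, b * (w + w) ≤ x → x < k → i < b * (w + w) + w → B x ≤ A i
  right : ∀ x, b * (w + w) ≤ x → x < k → j < b * (w + w) + w + w → B x ≤ A j
  image : ∀ r, (∃ x, 0 ≤ x ∧ x < k ∧ B x = r) ↔
    ∃ x, (0 ≤ x ∧ x < i ∨ b * (w + w) + w ≤ x ∧ x < j) ∧ A x = r

namespace MergeInv

variable {A B : ℤ → ℝ} {w b k i j N : ℤ}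

theorem init (hw : 0 ≤ w) : MergeInv A B w 0 0 0 w := by
  refine ⟨le_rfl, ?_, ?_, ?_, ?_, ?_, ?_, ?_, ?_, ?_, ?_⟩
  any_goals omega
  · intro c hc hcw
    rcases hw.eq_or_lt with rfl | hw'
    · intro x y; omega
    · nlinarith

/-- Once the pair of blocks is used up, the run just written counts as a finished block of double
length, and the two read positions move to the starts of the next pair. -/
theorem finish (h : MergeInv A B w b k i j) (hw : 0 ≤ w) (hk : k = b * (w + w) + w + w) :
    MergeInv A B w (b + 1) k k (k + w) := by
  have e : (b + 1) * (w + w) = b * (w + w) + w + w := by ring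
  obtain ⟨h0, h1, h2, h3, h4, h5, h6, h7, h8, h9, h10⟩ := h
  have hb : 0 ≤ b * (w + w) := by positivity
  refine ⟨by omega, ?_, ?_, ?_, ?_, ?_, ?_, ?_, ?_, ?_, ?_⟩
  any_goals omega
  · intro c hc hcw x y hx hxy hy
    rcases (show c ≤ b ∨ b + 1 ≤ c by omega) with hcb | hcb
    · rcases hcb.eq_or_lt with rfl | hcb
      · exact h7 x y hx hxy (by omega)
      · exact h6 c hc (by nlinarith) x y hx hxy hy
    · nlinarith
  · intro r
    rw [h10 r]
    constructor
    · rintro ⟨x, hx, hr⟩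
      exact ⟨x, by omega, hr⟩
    · rintro ⟨x, hx, hr⟩
      exact ⟨x, by omega, hr⟩

/-- Here z is the cell read in this step. Only the set of values is tracked and not their
multiplicities, since later arguments ask only whether an error or a threshold occurs in the list.
-/
theorem image_step (hk : 0 ≤ k) {i₀ j₀ z m i₁ j₁ : ℤ}
    (h : ∀ r, (∃ x, 0 ≤ x ∧ x < k ∧ B x = r) ↔
      ∃ x, (0 ≤ x ∧ x < i₀ ∨ m ≤ x ∧ x < j₀) ∧ A x = r)
    (hz : ∀ x, (0 ≤ x ∧ x < i₁ ∨ m ≤ x ∧ x < j₁) ↔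
      ((0 ≤ x ∧ x < i₀ ∨ m ≤ x ∧ x < j₀) ∨ x = z)) (r : ℝ) :
    (∃ x, 0 ≤ x ∧ x < k + 1 ∧ Function.update B k (A z) x = r) ↔
      ∃ x, (0 ≤ x ∧ x < i₁ ∨ m ≤ x ∧ x < j₁) ∧ A x = r := by
  constructor
  · rintro ⟨x, hx0, hx, hr⟩
    rcases eq_or_ne x k with rfl | hxk
    · rw [Function.update_self] at hr
      exact ⟨z, (hz z).2 (Or.inr rfl), hr⟩
    · rw [Function.update_of_ne hxk] at hr
      obtain ⟨y, hy, hr⟩ := (h r).1 ⟨x, hx0, by omega, hr⟩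
      exact ⟨y, (hz y).2 (Or.inl hy), hr⟩
  · rintro ⟨x, hx, hr⟩
    rcases (hz x).1 hx with hx | rfl
    · obtain ⟨y, hy0, hy, hr⟩ := (h r).2 ⟨x, hx, hr⟩
      exact ⟨y, hy0, by omega, by rw [Function.update_of_ne (by omega), hr]⟩
    · exact ⟨k, hk, by omega, by rw [Function.update_self, hr]⟩

theorem step_left (h : MergeInv A B w b k i j) (hw : 0 ≤ w) (hA : SortedBlocks A w N)
    (hN : b * (w + w) + w + w ≤ N) (hi : i < b * (w + w) + w)
    (hij : b * (w + w) + w + w ≤ j ∨ A i ≤ A j) :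
    MergeInv A (Function.update B k (A i)) w b (k + 1) (i + 1) j := by
  obtain ⟨h0, h1, h2, h3, h4, h5, h6, h7, h8, h9, h10⟩ := h
  have e : 2 * b * w = b * (w + w) := by ring
  have hb : 0 ≤ b * (w + w) := by positivity
  have ne : ∀ x, x < k → Function.update B k (A i) x = B x := fun x hx =>
    Function.update_of_ne (by omega) _ _
  refine ⟨h0, ?_, ?_, h3, h4, ?_, ?_, ?_, ?_, ?_, ?_⟩
  any_goals omega
  · intro c hc hcw x y hx hxy hy
    rw [ne x (by omega), ne y (by omega)]
    exact h6 c hc hcw x y hx hxy hy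
  · intro x y hx hxy hy
    rcases eq_or_ne y k with rfl | hyk
    · rw [Function.update_self]
      rcases eq_or_ne x y with rfl | hxk
      · rw [Function.update_self]
      · rw [ne x (by omega)]
        exact h8 x hx (by omega) hi
    · rw [ne x (by omega), ne y (by omega)]
      exact h7 x y hx hxy (by omega)
  · intro x hx hxk hi'
    -- The left block has number 2b among the blocks of length w; sortedness there makes the next
    -- unread cell at least as large as the one just copied.
    have hA' := hA (2 * b) (by omega) (by omega) i (i + 1) (by omega) (by omega) (by omega)
    rcases eq_or_ne x k with rfl | hxk'
    · rwa [Function.update_self]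
    · rw [ne x (by omega)]
      exact (h8 x hx (by omega) hi).trans hA'
  · intro x hx hxk hj'
    rcases eq_or_ne x k with rfl | hxk'
    · rw [Function.update_self]
      exact hij.resolve_left (by omega)
    · rw [ne x (by omega)]
      exact h9 x hx (by omega) hj'
  · exact image_step (by omega) h10 (by intro x; omega)

theorem step_right (h : MergeInv A B w b k i j) (hw : 0 ≤ w) (hA : SortedBlocks A w N)
    (hN : b * (w + w) + w + w ≤ N) (hk : k < b * (w + w) + w + w)
    (hij : ¬ (i < b * (w + w) + w ∧ (b * (w + w) + w + w ≤ j ∨ A i ≤ A j))) :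
    MergeInv A (Function.update B k (A j)) w b (k + 1) i (j + 1) := by
  obtain ⟨h0, h1, h2, h3, h4, h5, h6, h7, h8, h9, h10⟩ := h
  have hj : j < b * (w + w) + w + w := by
    by_contra hj
    exact hij ⟨by omega, Or.inl (by omega)⟩
  have e : (2 * b + 1) * w = b * (w + w) + w := by ring
  have hb : 0 ≤ b * (w + w) := by positivity
  have ne : ∀ x, x < k → Function.update B k (A j) x = B x := fun x hx =>
    Function.update_of_ne (by omega) _ _
  refine ⟨h0, h1, h2, ?_, ?_, ?_, ?_, ?_, ?_, ?_, ?_⟩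
  any_goals omega
  · intro c hc hcw x y hx hxy hy
    rw [ne x (by omega), ne y (by omega)]
    exact h6 c hc hcw x y hx hxy hy
  · intro x y hx hxy hy
    rcases eq_or_ne y k with rfl | hyk
    · rw [Function.update_self]
      rcases eq_or_ne x y with rfl | hxk
      · rw [Function.update_self]
      · rw [ne x (by omega)]
        exact h9 x hx (by omega) hj
    · rw [ne x (by omega), ne y (by omega)]
      exact h7 x y hx hxy (by omega)
  · intro x hx hxk hi'
    rcases eq_or_ne x k with rfl | hxk'
    · rw [Function.update_self]
      by_contra hlt
      exact hij ⟨hi', Or.inr (not_le.1 hlt).le⟩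
    · rw [ne x (by omega)]
      exact h8 x hx (by omega) hi'
  · intro x hx hxk hj'
    have hA' := hA (2 * b + 1) (by omega) (by omega) j (j + 1) (by omega) (by omega) (by omega)
    rcases eq_or_ne x k with rfl | hxk'
    · rwa [Function.update_self]
    · rw [ne x (by omega)]
      exact (h9 x hx (by omega) hj).trans hA'
  · exact image_step (by omega) h10 (by intro x; omega)

end MergeInv

namespace RealRAM

open IExpr BExpr Program

/-- The body of a merging pass: write cell `k`. -/
def mergeStep : Program :=
  .seq
    (.branch (.ile (.var 26) (.var 22))
      (.seq (.setIVar 23 (.var 22)) (.seq (.setIVar 25 (.add (.var 22) (.var 21)))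
        (.seq (.setIVar 24 (.var 25)) (.setIVar 26 (.add (.var 25) (.var 21))))))
      .skip)
    (.branch (.and (.not (.ile (.var 25) (.var 23)))
        (.not (.and (.not (.ile (.var 26) (.var 24)))
          (.not (.rle (.arr 3 (.var 23)) (.arr 3 (.var 24)))))))
      (.seq (.setRArr 4 (.var 22) (.arr 3 (.var 23)))
        (.setIVar 23 (.add (.var 23) (.const 1))))
      (.seq (.setRArr 4 (.var 22) (.arr 3 (.var 24)))
        (.setIVar 24 (.add (.var 24) (.const 1)))))

/-- A merging pass, and copying its result back. -/
def mergePass : Program :=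
  .seq (.setIVar 26 (.const 0))
    (.seq (.forTo 22 (.const 0) (.var 20) mergeStep)
      (.seq (.forTo 22 (.const 0) (.var 20) (.setRArr 3 (.var 22) (.arr 4 (.var 22))))
        (.setIVar 21 (.add (.var 21) (.var 21)))))

/-- Sort the first `ivar 1` cells of the real array `3`, after padding it with the value `rvar 0` to
a length that is a power of two and is stored in `ivar 20`. -/
def sortProgram : Program :=
  .seq (.setIVar 20 (.const 1))
    (.seq (.loop (.not (.ile (.var 1) (.var 20))) (.setIVar 20 (.add (.var 20) (.var 20))))
      (.seq (.forTo 22 (.var 1) (.var 20) (.setRArr 3 (.var 22) (.var 0)))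
        (.seq (.setIVar 21 (.const 1))
          (.loop (.not (.ile (.var 20) (.var 21))) mergePass))))

/-- The state between the steps of a merging pass. -/
def MergeState (A : ℤ → ℝ) (w N : ℤ) (s : Store) : Prop :=
  s.ivar 20 = N ∧ s.ivar 21 = w ∧ s.rarr 3 = A ∧ s.ivar 22 ≤ N ∧ ∃ b,
    (s.ivar 25 = b * (w + w) + w ∧ s.ivar 26 = b * (w + w) + w + w ∧
      b * (w + w) < s.ivar 22 ∧ s.ivar 22 < s.ivar 26 ∧
      MergeInv A (s.rarr 4) w b (s.ivar 22) (s.ivar 23) (s.ivar 24)) ∨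
    (s.ivar 26 ≤ s.ivar 22 ∧ MergeInv A (s.rarr 4) w b (s.ivar 22) (s.ivar 22) (s.ivar 22 + w))

/-- The state in the middle of a step of a merging pass. -/
def MergeStateMid (A : ℤ → ℝ) (w N k : ℤ) (s : Store) : Prop :=
  s.ivar 20 = N ∧ s.ivar 21 = w ∧ s.rarr 3 = A ∧ s.ivar 22 = k ∧ ∃ b,
    s.ivar 25 = b * (w + w) + w ∧ s.ivar 26 = b * (w + w) + w + w ∧ k < s.ivar 26 ∧
      MergeInv A (s.rarr 4) w b k (s.ivar 23) (s.ivar 24)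

/-- The total length is a multiple of w + w, so a pair of blocks that begins before the end fits
completely. -/
theorem block_le {b c w k : ℤ} (hw : 1 ≤ w) (hb : b * (w + w) ≤ k) (hk : k < c * (w + w)) :
    b * (w + w) + w + w ≤ c * (w + w) := by
  have h1 : b < c := lt_of_mul_lt_mul_right (hb.trans_lt hk) (by omega)
  have h2 : (b + 1) * (w + w) ≤ c * (w + w) := mul_le_mul_of_nonneg_right h1 (by omega)
  linarith

theorem mergeStep_ends {A : ℤ → ℝ} {w N c : ℤ} (hw : 1 ≤ w) (hA : SortedBlocks A w N)
    (hc : N = c * (w + w)) {s : Store} (hs : MergeState A w N s) (hk : s.ivar 22 < N) :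
    Ends mergeStep s mergeStep.steps
      (fun s' => MergeState A w N (s'.setI 22 (s.ivar 22 + 1))) := by
  refine Ends.seq_runs (R := MergeStateMid A w N (s.ivar 22)) (Ends.of_exec rfl ?_) ?_
  · obtain ⟨h20, h21, h3, -, b, h⟩ := hs
    -- A new pair of blocks is opened only when the write position has reached the end of the
    -- previous one. The initial value 0 of `ivar 26` opens the first pair.
    by_cases h1 : s.ivar 26 ≤ s.ivar 22
    · obtain ⟨-, h⟩ := h.resolve_left (by omega)
      have hb : b * (w + w) = s.ivar 22 := by have := h.k_eq; omega
      simp only [exec, BExpr.eval, IExpr.eval, h1, if_true]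
      refine ⟨h20, h21, h3, rfl, b, ?_, ?_, ?_, ?_⟩ <;> simp [Store.setI_ivar, h21, hb]
      · omega
      · exact h
    · obtain ⟨h25, h26, -, h22, h⟩ := h.resolve_right (by omega)
      simp only [exec, BExpr.eval, IExpr.eval, h1, if_false]
      exact ⟨h20, h21, h3, rfl, b, h25, h26, h22, h⟩
  · rintro t s' - ⟨h20, h21, h3, h22, b, h25, h26, hlt, h⟩
    have hbN : b * (w + w) + w + w ≤ N := by
      have h1 := h.k_eq
      have h2 := h.le_i
      have h3 := h.le_j
      rw [hc] at hk ⊢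
      exact block_le hw (by omega) hk
    have last : ∀ (s'' : Store) (i j : ℤ), s''.ivar 20 = N → s''.ivar 21 = w → s''.rarr 3 = A →
        s''.ivar 25 = b * (w + w) + w → s''.ivar 26 = b * (w + w) + w + w → s''.ivar 23 = i →
        s''.ivar 24 = j → MergeInv A (s''.rarr 4) w b (s.ivar 22 + 1) i j →
        MergeState A w N (s''.setI 22 (s.ivar 22 + 1)) := by
      rintro s'' i j k20 k21 k3 k25 k26 rfl rfl hinv
      rcases (show s.ivar 22 + 1 = b * (w + w) + w + w ∨ s.ivar 22 + 1 < b * (w + w) + w + w by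
        omega) with hlast | hlast
      · refine ⟨by simp [Store.setI_ivar, k20], by simp [Store.setI_ivar, k21], k3,
          by simp [Store.setI_ivar]; omega, b + 1, Or.inr ⟨?_, ?_⟩⟩
        · simp [Store.setI_ivar]; omega
        · simp only [Store.setI_ivar, if_true]
          exact hinv.finish (by omega) hlast
      · refine ⟨by simp [Store.setI_ivar, k20], by simp [Store.setI_ivar, k21], k3,
          by simp [Store.setI_ivar]; omega, b, Or.inl ⟨?_, ?_, ?_, ?_, ?_⟩⟩
        · simp [Store.setI_ivar, k25]
        · simp [Store.setI_ivar, k26]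
        · have h1 := hinv.k_eq
          have h2 := hinv.le_i
          have h3 := hinv.le_j
          have h4 := h.k_eq
          have h5 := h.le_i
          have h6 := h.le_j
          simp [Store.setI_ivar]; omega
        · simp [Store.setI_ivar]; omega
        · simpa [Store.setI_ivar] using hinv
    refine Ends.branch (fun h1 => Ends.of_exec rfl ?_) (fun h1 => Ends.of_exec rfl ?_)
    · simp only [BExpr.eval, IExpr.eval, RExpr.eval, h3, h25, h26] at h1
      refine last _ (s'.ivar 23 + 1) (s'.ivar 24) ?_ ?_ ?_ ?_ ?_ ?_ ?_ ?_ <;>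
        simp [exec, IExpr.eval, RExpr.eval, Store.setI_ivar, Store.setRA_rarr, *]
      exact h.step_left (by omega) hA hbN (by omega) (by tauto)
    · simp only [BExpr.eval, IExpr.eval, RExpr.eval, h3, h25, h26] at h1
      refine last _ (s'.ivar 23) (s'.ivar 24 + 1) ?_ ?_ ?_ ?_ ?_ ?_ ?_ ?_ <;>
        simp [exec, IExpr.eval, RExpr.eval, Store.setI_ivar, Store.setRA_rarr, *]
      refine h.step_right (by omega) hA hbN (by omega) (fun h' => h1 ?_)
      rw [not_le]
      tauto

/-- The first `N` cells of `A` and of `B` hold the same values. -/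
def SameValues (A B : ℤ → ℝ) (N : ℤ) : Prop :=
  ∀ r, (∃ x, 0 ≤ x ∧ x < N ∧ A x = r) ↔ ∃ x, 0 ≤ x ∧ x < N ∧ B x = r

/-- In this and the following results the constant is quantified before the input: its value is
irrelevant, but it must not depend on the data. -/
theorem mergePass_ends : ∃ K : ℕ, ∀ (w N c : ℤ) (s : Store), 1 ≤ w → N = c * (w + w) → 1 ≤ N →
    s.ivar 20 = N → s.ivar 21 = w → SortedBlocks (s.rarr 3) w N →
    Ends mergePass s (K * N.toNat) (fun s' => s'.ivar 20 = N ∧ s'.ivar 21 = w + w ∧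
      SortedBlocks (s'.rarr 3) (w + w) N ∧ SameValues (s'.rarr 3) (s.rarr 3) N) := by
  refine ⟨2 * mergeStep.steps + 2 * (Program.setRArr 3 (.var 22) (.arr 4 (.var 22))).steps + 100,
    fun w N c s hw hc hN h20 h21 hA => ?_⟩
  refine Ends.mono (Ends.seq (Ends.of_exec rfl (Ends.seq_runs (Ends.forTo (M := N) (z := 0) rfl
    (MergeState (s.rarr 3) w N) rfl ?_ (fun s' h => h.1)
    (fun s' h hk => mergeStep_ends hw hA hc h hk))
    (fun t s₁ hr₁ h₁ => Ends.seq_runs (Ends.forTo (M := N) (z := 0) rfl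
      (fun s' => s'.ivar 20 = N ∧ s'.ivar 22 ≤ N ∧ s'.rarr 4 = s₁.rarr 4 ∧
        ∀ x, 0 ≤ x → x < s'.ivar 22 → s'.rarr 3 x = s₁.rarr 4 x) rfl ?_ (fun s' h => h.1)
      (fun s' h hk => Ends.of_exec rfl ?_))
      (fun t s₂ hr₂ h₂ => Ends.of_exec rfl ?_))))) ?_ (fun _ h => h)
  · refine ⟨by simp [exec, Store.setI_ivar, h20], by simp [exec, Store.setI_ivar, h21], rfl,
      by simp [Store.setI_ivar]; omega, 0, Or.inr ⟨?_, ?_⟩⟩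
    · simp [exec, Store.setI_ivar, IExpr.eval]
    · simpa [exec, Store.setI_ivar] using MergeInv.init (by omega)
  · refine ⟨by simpa [Store.setI_ivar] using h₁.2.1, by simp [Store.setI_ivar]; omega, rfl, ?_⟩
    intro x hx hx'
    simp [Store.setI_ivar] at hx'
    omega
  · obtain ⟨k20, k22, k4, k3⟩ := h
    refine ⟨by simpa [Store.setI_ivar, exec] using k20, by simp [Store.setI_ivar]; omega,
      by simpa [exec, Store.setRA_rarr] using k4, ?_⟩
    intro x hx hx'
    simp only [exec, Store.setI_ivar, Store.setRA_rarr, IExpr.eval, RExpr.eval, if_true,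
      Store.setI_rarr, k4, Function.update_apply] at hx' ⊢
    split_ifs with hxk
    · rw [hxk]
    · exact k3 x hx (by omega)
  · obtain ⟨hN1, -, k21, -, hle, b, hb⟩ := h₁
    obtain ⟨hN2, k20', -, -, k3⟩ := h₂
    have hk : s₁.ivar 22 = N := le_antisymm hle hN1
    -- The other alternative of the invariant would put N strictly inside a pair of blocks, although
    -- N is a multiple of the length of a pair.
    have hinv : MergeInv (s.rarr 3) (s₁.rarr 4) w b N N (N + w) := by
      rcases hb with ⟨h25, h26, h27, h28, h⟩ | ⟨-, h⟩
      · rw [hk, hc] at h27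
        have h1 : b < c := lt_of_mul_lt_mul_right h27 (by omega)
        have h2 : (b + 1) * (w + w) ≤ c * (w + w) := mul_le_mul_of_nonneg_right h1 (by omega)
        rw [hk, h26, hc] at h28
        linarith
      · rwa [hk] at h
    have hbN : b * (w + w) = N := by have := hinv.k_eq; omega
    refine ⟨?_, ?_, ?_, ?_⟩
    · simpa [exec, Store.setI_ivar] using k20'
    · simp [exec, Store.setI_ivar, IExpr.eval, hr₂.ivar_eq (x := 21) rfl, k21]
    · intro b' hb' hbN' x y hx hxy hy
      have : 0 ≤ b' * (w + w) := by positivity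
      simp only [exec, Store.setI_rarr]
      rw [k3 x (by omega) (by omega), k3 y (by omega) (by omega)]
      exact hinv.blocks b' hb' (by omega) x y hx hxy hy
    · intro r
      simp only [exec, Store.setI_rarr]
      have := hinv.image r
      constructor
      · rintro ⟨x, hx, hxN, hr⟩
        rw [k3 x hx (by omega)] at hr
        obtain ⟨y, hy, hyr⟩ := this.1 ⟨x, hx, hxN, hr⟩
        exact ⟨y, by omega, by omega, hyr⟩
      · rintro ⟨x, hx, hxN, hr⟩
        obtain ⟨y, hy, hyN, hyr⟩ := this.2 ⟨x, Or.inl ⟨hx, hxN⟩, hr⟩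
        exact ⟨y, hy, hyN, by rw [k3 y hy (by omega), hyr]⟩
  · obtain ⟨q, hq⟩ : ∃ q : ℕ, N.toNat = q + 1 := ⟨N.toNat - 1, by omega⟩
    simp only [sub_zero, hq, Program.steps, IExpr.cost, RExpr.cost]
    set a := mergeStep.steps
    nlinarith [Nat.zero_le (q * a), Nat.zero_le q, Nat.zero_le a]

end RealRAM

namespace RealRAM
open IExpr BExpr Program

theorem SameValues.trans {A B C : ℤ → ℝ} {N : ℤ} (h : SameValues A B N) (h' : SameValues B C N) :
    SameValues A C N := fun r => (h r).trans (h' r)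

theorem two_pow_toNat (m : ℕ) : ((2 : ℤ) ^ m).toNat = 2 ^ m := by
  rw [← Int.toNat_natCast (2 ^ m)]; push_cast; rfl

/-- With block length 2^q and q + r = m, at most r passes remain. Each pass is linear in 2^m. -/
theorem mergePasses_ends : ∃ K : ℕ, ∀ (m : ℕ) (s : Store), s.ivar 20 = 2 ^ m → s.ivar 21 = 1 →
    Ends (.loop (.not (.ile (.var 20) (.var 21))) mergePass) s (K * (2 ^ m * (m + 1)))
      (fun s' => s'.ivar 20 = 2 ^ m ∧ SortedBlocks (s'.rarr 3) (2 ^ m) (2 ^ m) ∧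
        SameValues (s'.rarr 3) (s.rarr 3) (2 ^ m)) := by
  obtain ⟨K, hK⟩ := mergePass_ends
  refine ⟨K + 5, fun m s h20 h21 => ?_⟩
  refine Ends.mono (Ends.loop_nat (c := K * 2 ^ m) (fun r s' => ∃ q : ℕ, q + r = m ∧
    s'.ivar 20 = 2 ^ m ∧ s'.ivar 21 = 2 ^ q ∧ SortedBlocks (s'.rarr 3) (2 ^ q) (2 ^ m) ∧
      SameValues (s'.rarr 3) (s.rarr 3) (2 ^ m)) ?_ m s ?_) ?_ ?_
  · rintro r s' ⟨q, hq, k20, k21, hs, hv⟩ hb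
    simp only [BExpr.eval, IExpr.eval, k20, k21, not_le] at hb
    have hqm : q < m := (pow_lt_pow_iff_right₀ (by norm_num : (1 : ℤ) < 2)).1 hb
    have := hK (2 ^ q) (2 ^ m) (2 ^ (m - q - 1)) s' (one_le_pow₀ (by norm_num)) ?_
      (one_le_pow₀ (by norm_num)) k20 k21 hs
    · refine this.mono (by rw [two_pow_toNat]) ?_
      rintro s'' ⟨l20, l21, ls, lv⟩
      exact ⟨r - 1, by omega, q + 1, by omega, l20, by rw [l21]; ring,
        by rw [pow_succ, mul_two]; exact ls, lv.trans hv⟩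
    · rw [← two_mul, ← pow_succ', ← pow_add]
      congr 1
      omega
  · refine ⟨0, by simp, h20, by simp [h21], ?_, fun r => Iff.rfl⟩
    intro b hb hbN x y hx hxy hy
    rw [show x = y by simp at *; omega]
  · simp only [BExpr.cost, IExpr.cost]
    have : 1 ≤ 2 ^ m := Nat.one_le_two_pow
    nlinarith [Nat.zero_le m, Nat.zero_le (2 ^ m * m)]
  · rintro s' ⟨hb, r, q, hq, k20, k21, hs, hv⟩
    simp only [BExpr.eval, IExpr.eval, k20, k21, not_not] at hb
    have hqm : m ≤ q := (pow_le_pow_iff_right₀ (by norm_num : (1 : ℤ) < 2)).1 hb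
    obtain rfl : q = m := by omega
    exact ⟨k20, hs, hv⟩

/-- Padding to a power of two spares the passes incomplete blocks, and 2^m ≤ 2c keeps the padded
length linear. The same program sorts the candidate errors, padded with -100, and the candidate
thresholds, padded with 2. -/
theorem sortProgram_ends : ∃ K : ℕ, ∀ (c : ℤ) (s : Store), 1 ≤ c → s.ivar 1 = c →
    ∃ m : ℕ, c ≤ 2 ^ m ∧ (2 : ℤ) ^ m ≤ 2 * c ∧
      Ends sortProgram s (K * (2 ^ m * (m + 1))) (fun s' => s'.ivar 20 = 2 ^ m ∧
        (∀ x y, 0 ≤ x → x ≤ y → y < 2 ^ m → s'.rarr 3 x ≤ s'.rarr 3 y) ∧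
        (∀ x, 0 ≤ x → x < c → ∃ y, 0 ≤ y ∧ y < 2 ^ m ∧ s'.rarr 3 y = s.rarr 3 x) ∧
        ∀ y, 0 ≤ y → y < 2 ^ m →
          (∃ x, 0 ≤ x ∧ x < c ∧ s'.rarr 3 y = s.rarr 3 x) ∨ s'.rarr 3 y = s.rvar 0) := by
  obtain ⟨K, hK⟩ := mergePasses_ends
  refine ⟨K + 100, fun c s hc h1 => ?_⟩
  obtain ⟨m, hm1, hm2, hm3⟩ : ∃ m : ℕ, c ≤ 2 ^ m ∧ (2 : ℤ) ^ m ≤ 2 * c ∧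
      ∀ q : ℕ, c ≤ 2 ^ q → m ≤ q := by
    -- This is the exponent at which the doubling loop stops. By minimality 2^(m - 1) < c for c > 1,
    -- whence 2^m ≤ 2c.
    refine ⟨Nat.clog 2 c.toNat, ?_, ?_, fun q hq => Nat.clog_le_of_le_pow ?_⟩
    · have := Nat.le_pow_clog (b := 2) (by norm_num) c.toNat
      zify at this
      omega
    · rcases hc.eq_or_lt with rfl | hc'
      · simp
      · have := Nat.pow_pred_clog_lt_self (b := 2) (by norm_num) (x := c.toNat) (by omega)
        have h0 : 0 < Nat.clog 2 c.toNat := Nat.clog_pos (by norm_num) (by omega)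
        obtain ⟨l, hl⟩ := Nat.exists_eq_add_of_lt h0
        rw [hl] at this ⊢
        simp only [zero_add, Nat.pred_eq_sub_one, Nat.add_sub_cancel] at this ⊢
        zify at this
        rw [pow_succ]
        omega
    · zify
      omega
  refine ⟨m, hm1, hm2, ?_⟩
  have hpos : (1 : ℤ) ≤ 2 ^ m := one_le_pow₀ (by norm_num)
  refine Ends.mono (Ends.seq (Ends.of_exec rfl (Ends.seq_runs (Ends.loop_nat
    (c := (Program.setIVar 20 (.add (.var 20) (.var 20))).steps)
    (fun r s' => s'.ivar 1 = c ∧ s'.rarr 3 = s.rarr 3 ∧ s'.rvar 0 = s.rvar 0 ∧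
      ∃ q : ℕ, q + r = m ∧ s'.ivar 20 = 2 ^ q) ?_ m _ ?_) (fun t s₁ _ h₁ => Ends.seq_runs
    (Ends.forTo (M := 2 ^ m) (z := c) rfl
      (fun s' => s'.ivar 20 = 2 ^ m ∧ c ≤ s'.ivar 22 ∧ s'.rvar 0 = s.rvar 0 ∧
        (∀ x, x < c → s'.rarr 3 x = s.rarr 3 x) ∧
        ∀ x, c ≤ x → x < s'.ivar 22 → s'.rarr 3 x = s.rvar 0)
        (c := (Program.setRArr 3 (.var 22) (.var 0)).steps) ?_ ?_ (fun s' h => h.1) ?_)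
    (fun t s₂ hr₂ h₂ => Ends.seq (Ends.of_exec rfl (Ends.mono (hK m _ ?_ ?_) le_rfl ?_))))))) ?_
    (fun _ h => h)
  · rintro r s' ⟨k1, k3, k0, q, hq, k20⟩ hb
    simp only [BExpr.eval, IExpr.eval, k20, k1] at hb
    refine Ends.of_exec rfl ⟨r - 1, ?_, by simpa [exec, Store.setI_ivar] using k1, k3, k0, q + 1,
      ?_, ?_⟩
    · have : q ≠ m := by rintro rfl; exact hb hm1
      omega
    · have : q ≠ m := by rintro rfl; exact hb hm1
      omega
    · simp [exec, IExpr.eval, Store.setI_ivar, k20, pow_succ]; ring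
  · exact ⟨by simp [exec, Store.setI_ivar, h1], rfl, rfl, 0, by simp,
      by simp [exec, Store.setI_ivar, IExpr.eval]⟩
  · obtain ⟨hb, r, k1, k3, k0, q, hq, k20⟩ := h₁
    exact k1
  · obtain ⟨hb, r, k1, k3, k0, q, hq, k20⟩ := h₁
    simp only [BExpr.eval, IExpr.eval, k20, k1, not_not] at hb
    obtain rfl : q = m := le_antisymm (by omega) (hm3 q hb)
    refine ⟨by simp [Store.setI_ivar, k20], by simp [Store.setI_ivar], k0, by simp [k3], ?_⟩
    intro x hx hx'
    simp [Store.setI_ivar] at hx'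
    omega
  · rintro s' ⟨k20, k22, k0, k3, k3'⟩ hk
    refine Ends.of_exec rfl ⟨by simpa [exec, Store.setI_ivar] using k20,
      by simp [Store.setI_ivar]; omega, k0, ?_, ?_⟩
    · intro x hx
      simp [exec, IExpr.eval, RExpr.eval, Store.setRA_rarr]
      rw [Function.update_of_ne (by omega), k3 x hx]
    · intro x hx hx'
      simp [exec, IExpr.eval, RExpr.eval, Store.setRA_rarr, Store.setI_ivar,
        Function.update_apply] at hx' ⊢
      split_ifs with hxk
      · exact k0
      · exact k3' x hx (by omega)
  · simpa [exec, Store.setI_ivar] using h₂.2.1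
  · simp [exec, Store.setI_ivar, IExpr.eval]
  · obtain ⟨hN, k20, k22, k0, k3, k3'⟩ := h₂
    rintro s' ⟨l20, ls, lv⟩
    simp only [exec, Store.setI_rarr] at lv
    refine ⟨l20, ?_, ?_, ?_⟩
    · intro x y hx hxy hy
      exact ls 0 le_rfl (by simp) x y (by simpa using hx) hxy (by simpa using hy)
    · intro x hx hxc
      obtain ⟨y, hy, hyN, h⟩ := (lv (s.rarr 3 x)).2 ⟨x, hx, by omega, k3 x hxc⟩
      exact ⟨y, hy, hyN, h⟩
    · intro y hy hyN
      obtain ⟨x, hx, hxN, h⟩ := (lv (s'.rarr 3 y)).1 ⟨y, hy, hyN, rfl⟩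
      rcases lt_or_ge x c with hxc | hxc
      · exact Or.inl ⟨x, hx, hxc, by rw [← h, k3 x hxc]⟩
      · exact Or.inr (by rw [← h, k3' x hxc (by omega)])
  · have h2 : ((2 ^ m - c).toNat) ≤ 2 ^ m := by
      have : (((2 ^ m : ℕ)) : ℤ) = 2 ^ m := by push_cast; rfl
      omega
    set d := (2 ^ m - c).toNat
    have h3 : 1 ≤ 2 ^ m := Nat.one_le_two_pow
    set N := 2 ^ m
    simp only [Program.steps, IExpr.cost, RExpr.cost, BExpr.cost]
    nlinarith [Nat.zero_le m, Nat.zero_le (N * m), Nat.mul_le_mul_right m h3]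

end RealRAM

-- Computing one row of a merged table with two pointers

namespace RealRAM
open IExpr BExpr Program

/-- Five times an integer. -/
def IExpr.five (e : IExpr) : IExpr := .add e (.add e (.add e (.add e e)))

@[simp] theorem IExpr.eval_five (e : IExpr) (s : Store) : e.five.eval s = 5 * e.eval s := by
  simp only [IExpr.five, IExpr.eval]
  ring

/-- Consider combining the table entries `rvar 6` and `rvar 7`, which belong to the upper bounds in
the integer variables `e₁` and `e₂`. -/
def considerPair (e₁ e₂ : ℕ) : Program :=
  .branch (.rle (.var 4) (.add (.var 6) (.var 7)))
    (.seq (.branch (.rle (.var 6) (.var 7)) (.setRVar 8 (.var 6)) (.setRVar 8 (.var 7)))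
      (.branch (.rle (.var 8) (.var 5)) .skip
        (.seq (.setRVar 5 (.var 8)) (.seq (.setIVar 40 (.var e₁))
          (.seq (.setIVar 41 (.var e₂)) (.setIVar 42 (.var 36)))))))
    .skip

/-- Consider the state `ivar 36` of the child. -/
def considerState : Program :=
  .branch (.ile (.var 43) (.arr 6 (.add (five (.var 30)) (.var 36))))
    (.seq
      (.seq (.setIVar 39 (.arr 9 (.add (five (.arr 13 (.var 30))) (.var 36))))
        (.seq (.setRVar 6 (.arr 6 (.add (.var 37) (.var 33))))
          (.setRVar 7 (.arr 6 (.add (.var 39) (.var 35))))))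
      (.seq (considerPair 33 35)
        (.seq
          (.seq (.setRVar 6 (.arr 6 (.add (.var 37) (.var 35))))
            (.setRVar 7 (.arr 6 (.add (.var 39) (.var 33)))))
          (considerPair 35 33))))
    .skip

/-- Compute the table entry for the upper bound `ivar 33`. -/
def computeEntry : Program :=
  .seq (.branch (.ile (.var 34) (.var 33)) (.setIVar 35 (.var 34)) (.setIVar 35 (.var 33)))
    (.seq (.forTo 36 (.const 0) (.const 5) considerState)
      (.seq (.setRArr 6 (.add (.var 38) (.var 33)) (.var 5))
        (.seq (.setIArr 10 (.add (.var 38) (.var 33)) (.var 40))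
          (.seq (.setIArr 11 (.add (.var 38) (.var 33)) (.var 41))
            (.seq (.setIArr 12 (.add (.var 38) (.var 33)) (.var 42))
              (.setIVar 33 (.add (.var 33) (.const 1))))))))

/-- Prepare the computation of the table of vertex `ivar 31` in state `ivar 32`. -/
def prepareRow : Program :=
  .seq (.setIVar 37 (.arr 9 (.add (five (.arr 13 (.var 31))) (.var 32))))
    (.seq (.setIVar 38 (.arr 9 (.add (five (.add (.var 0) (.var 30))) (.var 32))))
      (.seq (.setRVar 2 (.arr 2 (.add (five (.var 31)) (.var 32))))
        (.seq (.setRVar 3 (.add (.var 1) (.add (.var 2) (.var 2))))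
          (.seq (.setRVar 4 (.sub (.add (.var 2) (.var 2)) (.var 1)))
            (.seq (.setIVar 43 (.arr 6 (.add (five (.var 31)) (.var 32))))
              (.seq (.setIVar 33 (.const 0))
                (.seq (.setIVar 34 (.sub (.var 27) (.const 1)))
                  (.setRVar 5 (.ofInt (.const (-100)))))))))))

/-- Compute the table of vertex `ivar 31` in state `ivar 32` after its child `ivar 30` has been
merged into it. -/
def computeRow : Program :=
  .seq prepareRow
    (.loop (.not (.ile (.var 27) (.var 33)))
      (.branch (.rle (.add (.arr 5 (.var 33)) (.arr 5 (.var 34))) (.var 3))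
        computeEntry
        (.setIVar 34 (.sub (.var 34) (.const 1)))))

/-- The best combination found so far is a combination of table entries. -/
def BestInv (I : Levels) (ε : ℝ) (i : ℤ) (F : ℤ → ℤ → ℤ → ℝ) (a p : ℤ) (s : Store) : Prop :=
  s.rvar 5 = -100 ∨ (I.Combines ε i F a p (s.ivar 42) (s.ivar 40) (s.ivar 41) ∧
    s.rvar 5 = min (F (I.par i) a (s.ivar 40)) (F i (s.ivar 42) (s.ivar 41)))

variable {I : Levels} {ε : ℝ} {i : ℤ} {F : ℤ → ℤ → ℤ → ℝ} {a p : ℤ}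

theorem BestInv.congr {s s' : Store} (h : BestInv I ε i F a p s) (h5 : s'.rvar 5 = s.rvar 5)
    (h40 : s'.ivar 40 = s.ivar 40) (h41 : s'.ivar 41 = s.ivar 41) (h42 : s'.ivar 42 = s.ivar 42) :
    BestInv I ε i F a p s' := by
  rw [BestInv, h5, h40, h41, h42]; exact h

/-- The best value never decreases and stays attained by the recorded indices. The hypothesis `he`
is needed because `ivar 40` is overwritten before the variable `e₂` is read. -/
theorem considerPair_ends {e₁ e₂ : ℕ} (he : e₂ ≠ 40) {p₁ p₂ z : ℤ} {s : Store}
    (h1 : s.ivar e₁ = p₁) (h2 : s.ivar e₂ = p₂) (hz : s.ivar 36 = z)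
    (hq1 : s.rvar 6 = F (I.par i) a p₁) (hq2 : s.rvar 7 = F i z p₂)
    (h4 : s.rvar 4 = -ε + 2 * I.e (5 * I.par i + a))
    (hC : s.rvar 4 ≤ s.rvar 6 + s.rvar 7 → I.Combines ε i F a p z p₁ p₂)
    (hb : BestInv I ε i F a p s) :
    Ends (considerPair e₁ e₂) s (considerPair e₁ e₂).steps (fun s' =>
      BestInv I ε i F a p s' ∧ s.rvar 5 ≤ s'.rvar 5 ∧
        (I.Combines ε i F a p z p₁ p₂ → min (F (I.par i) a p₁) (F i z p₂) ≤ s'.rvar 5)) := by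
  refine Ends.branch (fun hlow => ?_) (fun hlow => Ends.of_exec rfl ?_)
  · refine Ends.seq_frame (R := fun s' => s'.rvar 8 = min (F (I.par i) a p₁) (F i z p₂))
      (Ends.of_exec rfl ?_) ?_
    · simp only [exec, BExpr.eval, RExpr.eval, hq1, hq2]
      split_ifs with h
      · simp [Store.setR_rvar, h]
      · simp [Store.setR_rvar, (not_le.1 h).le]
    · intro s' hf h8
      have k5 : s'.rvar 5 = s.rvar 5 := hf.rvar rfl
      refine Ends.branch (fun hle => Ends.of_exec rfl ?_) (fun hle => Ends.of_exec rfl ?_)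
      · simp only [BExpr.eval, RExpr.eval, h8] at hle
        exact ⟨hb.congr k5 (hf.ivar rfl) (hf.ivar rfl) (hf.ivar rfl), k5.ge, fun _ => hle⟩
      · simp only [BExpr.eval, RExpr.eval, h8, not_le] at hle
        have k1 : s'.ivar e₁ = p₁ := by rw [hf.ivar rfl, h1]
        have k2 : s'.ivar e₂ = p₂ := by rw [hf.ivar rfl, h2]
        have k36 : s'.ivar 36 = z := by rw [hf.ivar rfl, hz]
        refine ⟨Or.inr ?_, ?_, fun _ => ?_⟩
        · simp only [exec, IExpr.eval, RExpr.eval, Store.setI_ivar, Store.setR_ivar, Store.setR_rvar,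
            Store.setI_rvar, if_true, h8, he, if_false, k1, k2, k36, 
            Nat.reduceEqDiff]
          exact ⟨hC hlow, trivial⟩
        · simp only [exec, RExpr.eval, Store.setI_rvar, Store.setR_rvar, if_true, h8, ← k5]
          exact hle.le
        · simp [exec, RExpr.eval, Store.setR_rvar, h8]
  · refine ⟨hb, le_rfl, fun h => absurd ?_ hlow⟩
    simp only [BExpr.eval, RExpr.eval, hq1, hq2, h4]
    exact h.lower

/-- The store holds the data of `I`. -/
structure Holds (I : Levels) (s : Store) : Prop where
  n : s.ivar 0 = I.n
  N : s.ivar 27 = I.N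
  par : s.iarr 4 = I.par
  x : s.iarr 6 = I.x
  e : s.rarr 2 = I.e
  S : s.rarr 5 = I.S
  off : ∀ t, 0 ≤ t → t < 10 * I.n → s.iarr 9 t = t * I.N

/-- `P` does not assign to the cells that `Holds` refers to. -/
def Program.keepsLevels (P : Program) : Bool :=
  P.keepsI 0 && P.keepsI 27 && P.keepsIA 4 && P.keepsIA 6 && P.keepsRA 2 && P.keepsRA 5 &&
    P.keepsIA 9

theorem Holds.of_frame {P : Program} {s s' : Store} (h : Holds I s) (hf : Frame P s s')
    (hP : P.keepsLevels = true) : Holds I s' := by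
  simp only [Program.keepsLevels, Bool.and_eq_true] at hP
  obtain ⟨⟨⟨⟨⟨⟨h0, h27⟩, h4⟩, h6⟩, h2⟩, h5⟩, h9⟩ := hP
  refine ⟨?_, ?_, ?_, ?_, ?_, ?_, ?_⟩
  · rw [hf.ivar h0, h.n]
  · rw [hf.ivar h27, h.N]
  · rw [hf.iarr h4, h.par]
  · rw [hf.iarr h6, h.x]
  · rw [hf.rarr h2, h.e]
  · rw [hf.rarr h5, h.S]
  · rw [hf.iarr h9]; exact h.off

/-- The store holds the tables `F` of the first `m` vertices. -/
def HoldsTables (I : Levels) (m : ℤ) (F : ℤ → ℤ → ℤ → ℝ) (s : Store) : Prop :=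
  ∀ u, 0 ≤ u → u < m → 0 ≤ s.iarr 13 u ∧ s.iarr 13 u < 2 * I.n ∧
    (s.iarr 13 u < I.n ∨ I.n + m ≤ s.iarr 13 u) ∧
    ∀ k p, 0 ≤ k → k < 5 → 0 ≤ p → p < I.N →
      s.rarr 6 ((5 * s.iarr 13 u + k) * I.N + p) = F u k p

/-- The store in which an entry of the table of `par i` in state `a` is computed. -/
structure EntryCtx (I : Levels) (ε : ℝ) (i : ℤ) (F : ℤ → ℤ → ℤ → ℝ) (a p h : ℤ) (s : Store) :
    Prop where
  holds : Holds I s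
  tables : HoldsTables I (i + 1) F s
  i_eq : s.ivar 30 = i
  p_eq : s.ivar 33 = p
  h_eq : s.ivar 35 = h
  row : s.ivar 37 = (5 * s.iarr 13 (I.par i) + a) * I.N
  x_eq : s.ivar 43 = I.x (5 * I.par i + a)
  low : s.rvar 4 = -ε + 2 * I.e (5 * I.par i + a)

theorem EntryCtx.of_frame {P : Program} {s s' : Store} {h : ℤ} (hc : EntryCtx I ε i F a p h s)
    (hf : Frame P s s') (hP : P.keepsLevels = true) (h6 : P.keepsRA 6 = true)
    (h13 : P.keepsIA 13 = true) (h30 : P.keepsI 30 = true) (h33 : P.keepsI 33 = true)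
    (h35 : P.keepsI 35 = true) (h37 : P.keepsI 37 = true) (h43 : P.keepsI 43 = true)
    (h4 : P.keepsR 4 = true) : EntryCtx I ε i F a p h s' := by
  refine ⟨hc.holds.of_frame hf hP, ?_, ?_, ?_, ?_, ?_, ?_, ?_⟩
  · unfold HoldsTables; rw [hf.iarr h13, hf.rarr h6]; exact hc.tables
  · rw [hf.ivar h30, hc.i_eq]
  · rw [hf.ivar h33, hc.p_eq]
  · rw [hf.ivar h35, hc.h_eq]
  · rw [hf.ivar h37, hf.iarr h13, hc.row]
  · rw [hf.ivar h43, hc.x_eq]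
  · rw [hf.rvar h4, hc.low]

/-- One of the two parts carries the bound p and the other the bound h. Either part may play either
role, so both assignments are tried. -/
theorem considerState_ends (hi : 1 ≤ i) (hin : i < I.n) (ha : 0 ≤ a) (ha5 : a < 5) (hp : 0 ≤ p)
    (hpN : p < I.N) {h : ℤ} (hh : 0 ≤ h) (hhp : h ≤ p)
    (hup : I.S p + I.S h ≤ ε + 2 * I.e (5 * I.par i + a)) {s : Store}
    (hc : EntryCtx I ε i F a p h s) {z : ℤ} (hz : s.ivar 36 = z) (hz0 : 0 ≤ z) (hz5 : z < 5)
    (hb : BestInv I ε i F a p s) :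
    Ends considerState s considerState.steps (fun s' =>
      BestInv I ε i F a p s' ∧ s.rvar 5 ≤ s'.rvar 5 ∧
        (I.Combines ε i F a p z p h → min (F (I.par i) a p) (F i z h) ≤ s'.rvar 5) ∧
        (I.Combines ε i F a p z h p → min (F (I.par i) a h) (F i z p) ≤ s'.rvar 5)) := by
  have hv0 := I.par_nonneg i hi hin
  have hvi := I.par_lt i hi hin
  refine Ends.branch (fun hx => ?_) (fun hx => Ends.of_exec rfl ?_)
  · simp only [BExpr.eval, IExpr.eval, IExpr.eval_five, hc.x_eq, hc.holds.x, hc.i_eq, hz] at hx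
    have off : s.iarr 9 (5 * s.iarr 13 i + z) = (5 * s.iarr 13 i + z) * I.N := by
      have := hc.tables i (by omega) (by omega)
      exact hc.holds.off _ (by omega) (by omega)
    refine Ends.seq_frame (R := fun s' => s'.ivar 39 = (5 * s.iarr 13 i + z) * I.N ∧
        s'.rvar 6 = F (I.par i) a p ∧ s'.rvar 7 = F i z h)
      (Ends.of_exec rfl ?_) (fun s₁ hf₁ h₁ => Ends.seq_frame
        (considerPair_ends (I := I) (ε := ε) (i := i) (F := F) (a := a) (p := p) (p₁ := p)
          (p₂ := h) (z := z) (by norm_num) ?_ ?_ ?_ h₁.2.1 h₁.2.2 ?_ ?_ ?_)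
        (fun s₂ hf₂ h₂ => Ends.seq_frame
          (R := fun s' => s'.rvar 6 = F (I.par i) a h ∧ s'.rvar 7 = F i z p)
          (Ends.of_exec rfl ?_) (fun s₃ hf₃ h₃ =>
          (considerPair_ends (I := I) (ε := ε) (i := i) (F := F) (a := a) (p := p) (p₁ := h)
          (p₂ := p) (z := z) (by norm_num) ?_ ?_ ?_ h₃.1 h₃.2 ?_ ?_ ?_).mono le_rfl ?_)))
    · simp only [exec, IExpr.eval, RExpr.eval, IExpr.eval_five, Store.setI_ivar, Store.setR_ivar,
        Store.setR_rvar, Store.setI_rvar, Store.setI_rarr, Store.setR_rarr, if_true,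
        Nat.reduceEqDiff, if_false, hc.i_eq, hz, off, hc.row, hc.p_eq,
        hc.h_eq]
      exact ⟨trivial, (hc.tables _ hv0 (by omega)).2.2.2 a p ha ha5 hp hpN,
        (hc.tables _ (by omega) (by omega)).2.2.2 z h hz0 hz5 hh (by omega)⟩
    · rw [hf₁.ivar rfl, hc.p_eq]
    · rw [hf₁.ivar rfl, hc.h_eq]
    · rw [hf₁.ivar rfl, hz]
    · rw [hf₁.rvar rfl, hc.low]
    · intro hl
      rw [hf₁.rvar rfl, hc.low, h₁.2.1, h₁.2.2] at hl
      exact ⟨hz0, hz5, hx, hp, hh, le_rfl, hhp, hup, hl⟩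
    · exact hb.congr (hf₁.rvar rfl) (hf₁.ivar rfl) (hf₁.ivar rfl) (hf₁.ivar rfl)
    · have c₁ : EntryCtx I ε i F a p h s₁ := hc.of_frame hf₁ rfl rfl rfl rfl rfl rfl rfl rfl rfl
      have c₂ : EntryCtx I ε i F a p h s₂ := c₁.of_frame hf₂ rfl rfl rfl rfl rfl rfl rfl rfl rfl
      have k39 : s₂.ivar 39 = (5 * s₂.iarr 13 i + z) * I.N := by
        rw [hf₂.ivar rfl, h₁.1, hf₂.iarr rfl, hf₁.iarr rfl]
      simp only [exec, IExpr.eval, RExpr.eval, Store.setR_ivar, Store.setR_rvar, Store.setR_rarr,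
        if_true, Nat.reduceEqDiff, if_false, c₂.row, c₂.p_eq, c₂.h_eq, k39]
      exact ⟨(c₂.tables _ hv0 (by omega)).2.2.2 a h ha ha5 hh (by omega),
        (c₂.tables _ (by omega) (by omega)).2.2.2 z p hz0 hz5 hp hpN⟩
    · rw [hf₃.ivar rfl, hf₂.ivar rfl, hf₁.ivar rfl, hc.h_eq]
    · rw [hf₃.ivar rfl, hf₂.ivar rfl, hf₁.ivar rfl, hc.p_eq]
    · rw [hf₃.ivar rfl, hf₂.ivar rfl, hf₁.ivar rfl, hz]
    · rw [hf₃.rvar rfl, hf₂.rvar rfl, hf₁.rvar rfl, hc.low]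
    · intro hl
      rw [hf₃.rvar rfl, hf₂.rvar rfl, hf₁.rvar rfl, hc.low, h₃.1, h₃.2] at hl
      exact ⟨hz0, hz5, hx, hh, hp, hhp, le_rfl, by linarith, hl⟩
    · exact h₂.1.congr (hf₃.rvar rfl) (hf₃.ivar rfl) (hf₃.ivar rfl) (hf₃.ivar rfl)
    · rintro s₄ ⟨hb', hle, hC⟩
      have k1 : s₁.rvar 5 = s.rvar 5 := hf₁.rvar rfl
      have k3 : s₃.rvar 5 = s₂.rvar 5 := hf₃.rvar rfl
      refine ⟨hb', by linarith [h₂.2.1], fun hcb => ?_, hC⟩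
      linarith [h₂.2.2 hcb]
  · simp only [BExpr.eval, IExpr.eval, IExpr.eval_five, hc.x_eq, hc.holds.x, hc.i_eq, hz] at hx
    exact ⟨hb, le_rfl, fun h => absurd h.x_le hx, fun h => absurd h.x_le hx⟩

end RealRAM

namespace RealRAM
open IExpr BExpr Program

variable {I : Levels} {ε : ℝ} {i : ℤ} {F : ℤ → ℤ → ℤ → ℝ} {a p : ℤ}

theorem _root_.Levels.Combines.mono {z p₁ p₂ q : ℤ} (h : I.Combines ε i F a p z p₁ p₂)
    (hpq : p ≤ q) : I.Combines ε i F a q z p₁ p₂ :=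
  { h with le₁ := h.le₁.trans hpq, le₂ := h.le₂.trans hpq }

theorem BestInv.mono {s : Store} {q : ℤ} (h : BestInv I ε i F a p s) (hpq : p ≤ q) :
    BestInv I ε i F a q s :=
  h.imp id fun h => ⟨h.1.mono hpq, h.2⟩

/-- The loop over the states of the child. -/
def considerStates : Program := .forTo 36 (.const 0) (.const 5) considerState

theorem considerStates_ends : ∃ K : ℕ, ∀ (I : Levels) (ε : ℝ) (i : ℤ) (F : ℤ → ℤ → ℤ → ℝ)
    (a p h : ℤ) (s : Store), 1 ≤ i → i < I.n → 0 ≤ a → a < 5 → 0 ≤ p → p < I.N → 0 ≤ h → h ≤ p →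
    I.S p + I.S h ≤ ε + 2 * I.e (5 * I.par i + a) → EntryCtx I ε i F a p h s →
    BestInv I ε i F a p s →
    Ends considerStates s K (fun s' =>
      BestInv I ε i F a p s' ∧ s.rvar 5 ≤ s'.rvar 5 ∧ ∀ z,
        (I.Combines ε i F a p z p h → min (F (I.par i) a p) (F i z h) ≤ s'.rvar 5) ∧
        (I.Combines ε i F a p z h p → min (F (I.par i) a h) (F i z p) ≤ s'.rvar 5)) := by
  refine ⟨6 * (considerState.steps + 11), fun I ε i F a p h s hi hin ha ha5 hp hpN hh hhp hup hc hb => ?_⟩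
  refine Ends.mono (Ends.forTo_frame (M := 5) (z := 0) (c := considerState.steps) rfl
    (fun s' => 0 ≤ s'.ivar 36 ∧ BestInv I ε i F a p s' ∧ s.rvar 5 ≤ s'.rvar 5 ∧ ∀ z,
      z < s'.ivar 36 →
        (I.Combines ε i F a p z p h → min (F (I.par i) a p) (F i z h) ≤ s'.rvar 5) ∧
        (I.Combines ε i F a p z h p → min (F (I.par i) a h) (F i z p) ≤ s'.rvar 5))
    rfl ?_ (fun s' _ _ => rfl) ?_) (by simp [IExpr.cost]) ?_
  · refine ⟨by simp [Store.setI_ivar], hb, le_rfl, fun z hz => ?_⟩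
    simp only [Store.setI_ivar, if_true] at hz
    exact ⟨fun hC => absurd hC.z_nonneg (by omega), fun hC => absurd hC.z_nonneg (by omega)⟩
  · rintro s' hf ⟨h0, hb', hle, hC⟩ h5
    refine (considerState_ends hi hin ha ha5 hp hpN hh hhp hup
      (hc.of_frame hf rfl rfl rfl rfl rfl rfl rfl rfl rfl) rfl h0 h5 hb').mono le_rfl ?_
    rintro s'' ⟨hb'', hle', hC1, hC2⟩ -
    refine ⟨by simp [Store.setI_ivar]; omega, hb'', hle.trans hle', fun z hz => ?_⟩
    simp only [Store.setI_ivar, if_true] at hz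
    rcases (show z = s'.ivar 36 ∨ z < s'.ivar 36 by omega) with rfl | hz
    · exact ⟨hC1, hC2⟩
    · exact ⟨fun h => ((hC z hz).1 h).trans hle', fun h => ((hC z hz).2 h).trans hle'⟩
  · rintro s' ⟨h5, h0, hb', hle, hC⟩
    refine ⟨hb', hle, fun z => ?_⟩
    by_cases hz : z < 5
    · exact hC z (by omega)
    · exact ⟨fun h => absurd h.z_lt hz, fun h => absurd h.z_lt hz⟩

/-- A combination with both bounds below p is covered by the running best. Otherwise one bound
equals p, and the other is at most p and at most r, the largest index whose value fits together with
`I.S p`. As the tables are nondecreasing, raising the other bound to `min r p` keeps both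
constraints and does not lower the minimum. Hence two trials per state of the child suffice. -/
theorem computeEntry_ends : ∃ K : ℕ, ∀ (I : Levels) (ε : ℝ) (i : ℤ) (F : ℤ → ℤ → ℤ → ℝ)
    (a p h r : ℤ) (s : Store), 1 ≤ i → i < I.n → 0 ≤ a → a < 5 → 0 ≤ p → p < I.N →
    I.Mono F (i + 1) → s.ivar 34 = r → 0 ≤ r → r < I.N →
    I.S p + I.S r ≤ ε + 2 * I.e (5 * I.par i + a) →
    (∀ t, r < t → t < I.N → ε + 2 * I.e (5 * I.par i + a) < I.S p + I.S t) →
    EntryCtx I ε i F a p h s → BestInv I ε i F a (p - 1) s →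
    (∀ z p₁ p₂, I.Combines ε i F a (p - 1) z p₁ p₂ →
      min (F (I.par i) a p₁) (F i z p₂) ≤ s.rvar 5) →
    Ends computeEntry s K (fun s' => s'.ivar 33 = p + 1 ∧
      BestInv I ε i F a p s' ∧ s.rvar 5 ≤ s'.rvar 5 ∧
      (∀ z p₁ p₂, I.Combines ε i F a p z p₁ p₂ →
        min (F (I.par i) a p₁) (F i z p₂) ≤ s'.rvar 5) ∧
      s'.rarr 6 = Function.update (s.rarr 6) (s.ivar 38 + p) (s'.rvar 5) ∧
      s'.iarr 10 = Function.update (s.iarr 10) (s.ivar 38 + p) (s'.ivar 40) ∧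
      s'.iarr 11 = Function.update (s.iarr 11) (s.ivar 38 + p) (s'.ivar 41) ∧
      s'.iarr 12 = Function.update (s.iarr 12) (s.ivar 38 + p) (s'.ivar 42)) := by
  obtain ⟨K, hK⟩ := considerStates_ends
  refine ⟨K + 100, fun I ε i F a p h r s hi hin ha ha5 hp hpN hF hr hr0 hrN hup hup' hc hb hC => ?_⟩
  have hv0 := I.par_nonneg i hi hin
  have hvi := I.par_lt i hi hin
  have hmin : I.S p + I.S (min r p) ≤ ε + 2 * I.e (5 * I.par i + a) := by
    have := I.S_mono (min r p) r (by omega) (by omega) hrN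
    linarith
  refine Ends.mono (Ends.seq_frame (R := fun s' => s'.ivar 35 = min r p) (Ends.of_exec rfl ?_)
    (fun s₁ hf₁ h₁ => Ends.seq_frame (hK I ε i F a p (min r p) s₁ hi hin ha ha5 hp hpN (by omega)
      (by omega) hmin ?_ ?_) (fun s₂ hf₂ h₂ => Ends.of_exec rfl ?_))) ?_ (fun _ h => h)
  · simp only [exec, BExpr.eval, IExpr.eval, hr, hc.p_eq]
    split_ifs with hle
    · simp [Store.setI_ivar, hle]
    · simp [Store.setI_ivar, (not_le.1 hle).le]
  · have c₁ := hc.holds.of_frame hf₁ rfl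
    refine ⟨c₁, ?_, ?_, ?_, h₁, ?_, ?_, ?_⟩
    · unfold HoldsTables; rw [hf₁.iarr rfl, hf₁.rarr rfl]; exact hc.tables
    · rw [hf₁.ivar rfl, hc.i_eq]
    · rw [hf₁.ivar rfl, hc.p_eq]
    · rw [hf₁.ivar rfl, hf₁.iarr rfl, hc.row]
    · rw [hf₁.ivar rfl, hc.x_eq]
    · rw [hf₁.rvar rfl, hc.low]
  · exact (hb.mono (by omega)).congr (hf₁.rvar rfl) (hf₁.ivar rfl) (hf₁.ivar rfl) (hf₁.ivar rfl)
  · obtain ⟨hb₂, hle, hC₂⟩ := h₂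
    have k5 : s₁.rvar 5 = s.rvar 5 := hf₁.rvar rfl
    have k33 : s₂.ivar 33 = p := by rw [hf₂.ivar rfl, hf₁.ivar rfl, hc.p_eq]
    have k38 : s₂.ivar 38 = s.ivar 38 := by rw [hf₂.ivar rfl, hf₁.ivar rfl]
    have k6 : s₂.rarr 6 = s.rarr 6 := by rw [hf₂.rarr rfl, hf₁.rarr rfl]
    have k10 : s₂.iarr 10 = s.iarr 10 := by rw [hf₂.iarr rfl, hf₁.iarr rfl]
    have k11 : s₂.iarr 11 = s.iarr 11 := by rw [hf₂.iarr rfl, hf₁.iarr rfl]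
    have k12 : s₂.iarr 12 = s.iarr 12 := by rw [hf₂.iarr rfl, hf₁.iarr rfl]
    have hall : ∀ z p₁ p₂, I.Combines ε i F a p z p₁ p₂ →
        min (F (I.par i) a p₁) (F i z p₂) ≤ s₂.rvar 5 := by
      intro z p₁ p₂ hcb
      by_cases hlt : p₁ < p ∧ p₂ < p
      · have := hC z p₁ p₂ { hcb with le₁ := by omega, le₂ := by omega }
        linarith
      · have h1 := hcb.le₁
        have h2 := hcb.le₂
        have h1' := hcb.nonneg₁
        have h2' := hcb.nonneg₂
        have hz := hcb.z_nonneg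
        have hz' := hcb.z_lt
        have hu := hcb.upper
        have hl := hcb.lower
        rcases (show p₁ = p ∨ p₂ = p by omega) with rfl | rfl
        · have hr2 : p₂ ≤ r := by
            by_contra hlt'
            linarith [hup' p₂ (by omega) (by omega)]
          have hm := hF i z p₂ (min r p₁) (by omega) (by omega) hz hz' h2' (by omega) (by omega)
          refine le_trans (min_le_min_left _ hm) ((hC₂ z).1 ⟨hz, hz', hcb.x_le, h1', by omega,
            le_rfl, by omega, hmin, by linarith⟩)
        · have hr2 : p₁ ≤ r := by
            by_contra hlt'
            linarith [hup' p₁ (by omega) (by omega)]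
          have hm := hF (I.par i) a p₁ (min r p₂) hv0 (by omega) ha ha5 h1' (by omega) (by omega)
          refine le_trans (min_le_min_right _ hm) ((hC₂ z).2 ⟨hz, hz', hcb.x_le, by omega, h2',
            by omega, le_rfl, by linarith, by linarith⟩)
    simp only [exec, IExpr.eval, RExpr.eval, Store.setI_ivar, Store.setIA_iarr, Store.setRA_rarr,
      if_true, Nat.reduceEqDiff, if_false, Store.setI_iarr, Store.setI_rarr, Store.setIA_rarr,
      Store.setIA_ivar, Store.setRA_ivar, Store.setRA_iarr, Store.setI_rvar, Store.setIA_rvar,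
      Store.setRA_rvar, k33, k38, k6, k10, k11, k12]
    exact ⟨trivial, hb₂, by linarith, hall, trivial, trivial, trivial, trivial⟩
  · simp only [Program.steps, IExpr.cost, RExpr.cost, BExpr.cost]
    omega

/-- The first `m` entries of a table row are correct. -/
structure RowOK (I : Levels) (ε : ℝ) (i : ℤ) (F : ℤ → ℤ → ℤ → ℝ) (a m : ℤ) (R : ℤ → ℝ)
    (c₁ c₂ cz : ℤ → ℤ) : Prop where
  le : ∀ x z p₁ p₂, 0 ≤ x → x < m → I.Combines ε i F a x z p₁ p₂ →
    min (F (I.par i) a p₁) (F i z p₂) ≤ R x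
  attained : ∀ x, 0 ≤ x → x < m → -50 < R x →
    I.Combines ε i F a x (cz x) (c₁ x) (c₂ x) ∧
      R x ≤ F (I.par i) a (c₁ x) ∧ R x ≤ F i (cz x) (c₂ x)
  mono : ∀ x y, 0 ≤ x → x ≤ y → y < m → R x ≤ R y

/-- The row of the tables with number `r` and the corresponding choices, as read from the store, are
the only difference between the stores. -/
def SameOutside (N W : ℤ) (s s' : Store) : Prop :=
  ∀ y, y < W ∨ W + N ≤ y → s'.rarr 6 y = s.rarr 6 y ∧ s'.iarr 10 y = s.iarr 10 y ∧
    s'.iarr 11 y = s.iarr 11 y ∧ s'.iarr 12 y = s.iarr 12 y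

theorem row_disjoint {t t' N x : ℤ} (hN : 1 ≤ N) (h : t ≠ t') (hx : 0 ≤ x) (hxN : x < N) :
    t * N + x < t' * N ∨ t' * N + N ≤ t * N + x := by
  rcases lt_or_gt_of_ne h with h | h
  · left; nlinarith
  · right; nlinarith

/-- No current table lives in slot b, so writing one of the rows of that slot does no harm. -/
theorem HoldsTables.of_sameOutside {s s' : Store} {m : ℤ} (h : HoldsTables I m F s)
    (ha : 0 ≤ a) (ha5 : a < 5) {b : ℤ} (hb : ∀ u, 0 ≤ u → u < m → s.iarr 13 u ≠ b)
    (h13 : s'.iarr 13 = s.iarr 13) (ho : SameOutside I.N ((5 * b + a) * I.N) s s') :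
    HoldsTables I m F s' := by
  intro u hu hum
  rw [h13]
  obtain ⟨h1, h2, h3, h4⟩ := h u hu hum
  refine ⟨h1, h2, h3, fun k p hk hk5 hp hpN => ?_⟩
  rw [← h4 k p hk hk5 hp hpN]
  have := hb u hu hum
  exact (ho _ (row_disjoint I.N_pos (by omega) hp hpN)).1

end RealRAM

namespace RealRAM
open IExpr BExpr Program

variable {I : Levels} {ε : ℝ} {i : ℤ} {F : ℤ → ℤ → ℤ → ℝ} {a p : ℤ}

/-- The part of the tables and of the recorded choices that starts at cell `W` is correct. -/
def RowAt (I : Levels) (ε : ℝ) (i : ℤ) (F : ℤ → ℤ → ℤ → ℝ) (a m W : ℤ) (s : Store) : Prop :=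
  RowOK I ε i F a m (fun x => s.rarr 6 (W + x)) (fun x => s.iarr 10 (W + x))
    (fun x => s.iarr 11 (W + x)) (fun x => s.iarr 12 (W + x))

/-- The invariant of the loop that computes a row of the tables. -/
structure RowInv (I : Levels) (ε : ℝ) (i : ℤ) (F : ℤ → ℤ → ℤ → ℝ) (a : ℤ) (s₀ s : Store) :
    Prop where
  p_nonneg : 0 ≤ s.ivar 33
  p_le : s.ivar 33 ≤ I.N
  r_nonneg : 0 ≤ s.ivar 34
  r_lt : s.ivar 34 < I.N
  upper : s.ivar 33 < I.N → ∀ t, s.ivar 34 < t → t < I.N →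
    ε + 2 * I.e (5 * I.par i + a) < I.S (s.ivar 33) + I.S t
  best : BestInv I ε i F a (s.ivar 33 - 1) s
  prior : ∀ z p₁ p₂, I.Combines ε i F a (s.ivar 33 - 1) z p₁ p₂ →
      min (F (I.par i) a p₁) (F i z p₂) ≤ s.rvar 5
  le_best : ∀ x, 0 ≤ x → x < s.ivar 33 → s.rarr 6 ((5 * (I.n + i) + a) * I.N + x) ≤ s.rvar 5
  row : RowAt I ε i F a (s.ivar 33) ((5 * (I.n + i) + a) * I.N) s
  outside : SameOutside I.N ((5 * (I.n + i) + a) * I.N) s₀ s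

/-- Because the best value is carried along, the new row is nondecreasing. Because `I.S` is
nondecreasing, an index too large for p remains too large for p + 1, so the right pointer never has
to move back. -/
theorem RowInv.setEntry {s₀ s s' : Store} (h : RowInv I ε i F a s₀ s) (hp : s.ivar 33 < I.N)
    (hε : ∀ t, s.ivar 34 < t → t < I.N →
      ε + 2 * I.e (5 * I.par i + a) < I.S (s.ivar 33) + I.S t)
    (h34 : s'.ivar 34 = s.ivar 34) (h33 : s'.ivar 33 = s.ivar 33 + 1)
    (hb : BestInv I ε i F a (s.ivar 33) s') (hle : s.rvar 5 ≤ s'.rvar 5)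
    (hC : ∀ z p₁ p₂, I.Combines ε i F a (s.ivar 33) z p₁ p₂ →
        min (F (I.par i) a p₁) (F i z p₂) ≤ s'.rvar 5)
    (h6 : s'.rarr 6 = Function.update (s.rarr 6) ((5 * (I.n + i) + a) * I.N + s.ivar 33) (s'.rvar 5))
    (h10 : s'.iarr 10 =
      Function.update (s.iarr 10) ((5 * (I.n + i) + a) * I.N + s.ivar 33) (s'.ivar 40))
    (h11 : s'.iarr 11 =
      Function.update (s.iarr 11) ((5 * (I.n + i) + a) * I.N + s.ivar 33) (s'.ivar 41))
    (h12 : s'.iarr 12 =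
      Function.update (s.iarr 12) ((5 * (I.n + i) + a) * I.N + s.ivar 33) (s'.ivar 42)) :
    RowInv I ε i F a s₀ s' := by
  obtain ⟨a1, a2, a3, a4, -, -, -, a8, a9, a10⟩ := h
  set W := (5 * (I.n + i) + a) * I.N
  set p := s.ivar 33
  have e6 : ∀ x, x < p → s'.rarr 6 (W + x) = s.rarr 6 (W + x) := fun x hx => by
    rw [h6, Function.update_of_ne (by omega)]
  have e6p : s'.rarr 6 (W + p) = s'.rvar 5 := by rw [h6, Function.update_self]
  refine ⟨by omega, by omega, by omega, by omega, ?_, ?_, ?_, ?_, ⟨?_, ?_, ?_⟩, ?_⟩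
  · rw [h33, h34]
    intro hp' t ht htN
    have := I.S_mono p (p + 1) (by omega) (by omega) hp'
    linarith [hε t ht htN]
  · rw [h33, add_sub_cancel_right]; exact hb
  · rw [h33, add_sub_cancel_right]; exact hC
  · intro x hx hxp
    rcases (show x = p ∨ x < p by omega) with rfl | hx'
    · rw [e6p]
    · rw [e6 x hx']; exact (a8 x hx hx').trans hle
  · intro x z p₁ p₂ hx hxp hcb
    rcases (show x = p ∨ x < p by omega) with rfl | hx'
    · rw [e6p]; exact hC z p₁ p₂ hcb
    · rw [e6 x hx']; exact a9.le x z p₁ p₂ hx hx' hcb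
  · intro x hx hxp
    rcases (show x = p ∨ x < p by omega) with rfl | hx'
    · rw [e6p, h10, h11, h12, Function.update_self, Function.update_self, Function.update_self]
      intro hlt
      rcases hb with hb | ⟨hb, hb'⟩
      · linarith
      · exact ⟨hb, hb'.le.trans (min_le_left _ _), hb'.le.trans (min_le_right _ _)⟩
    · rw [e6 x hx', h10, h11, h12, Function.update_of_ne (by omega),
        Function.update_of_ne (by omega), Function.update_of_ne (by omega)]
      exact a9.attained x hx hx'
  · intro x y hx hxy hy
    rcases (show y = p ∨ y < p by omega) with rfl | hy'
    · rw [e6p]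
      rcases (show x = p ∨ x < p by omega) with rfl | hx'
      · rw [e6p]
      · rw [e6 x hx']; exact (a8 x hx hx').trans hle
    · rw [e6 x (by omega), e6 y hy']; exact a9.mono x y hx hxy hy'
  · intro y hy
    rw [h6, h10, h11, h12, Function.update_of_ne (by omega), Function.update_of_ne (by omega),
      Function.update_of_ne (by omega), Function.update_of_ne (by omega)]
    exact a10 y hy

/-- Each iteration either advances the left pointer or lowers the right one. The sum of their
remaining distances starts at N + (N - 1), which makes the work linear in N. -/
theorem computeRow_ends : ∃ K : ℕ, ∀ (I : Levels) (ε : ℝ) (i : ℤ) (F : ℤ → ℤ → ℤ → ℝ)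
    (a : ℤ) (s : Store), 0 ≤ ε → 1 ≤ i → i < I.n → 0 ≤ a → a < 5 → I.Mono F (i + 1) →
    Holds I s → HoldsTables I (i + 1) F s → s.rvar 1 = ε → s.ivar 30 = i → s.ivar 31 = I.par i →
    s.ivar 32 = a →
    Ends computeRow s (K * I.N.toNat) (fun s' =>
      SameOutside I.N ((5 * (I.n + i) + a) * I.N) s s' ∧
        RowAt I ε i F a I.N ((5 * (I.n + i) + a) * I.N) s') := by
  obtain ⟨K, hK⟩ := computeEntry_ends
  refine ⟨2 * (K + 100) + prepareRow.steps, fun I ε i F a s hε hi hin ha ha5 hF hh ht h1 h30 h31 h32 => ?_⟩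
  have hv0 := I.par_nonneg i hi hin
  have hvi := I.par_lt i hi hin
  have hN := I.N_pos
  have hcur := ht (I.par i) hv0 (by omega)
  have o1 : s.iarr 9 (5 * s.iarr 13 (I.par i) + a) = (5 * s.iarr 13 (I.par i) + a) * I.N :=
    hh.off _ (by omega) (by omega)
  have o2 : s.iarr 9 (5 * (I.n + i) + a) = (5 * (I.n + i) + a) * I.N :=
    hh.off _ (by omega) (by omega)
  refine Ends.mono (Ends.seq_frame (c' := 2 * I.N.toNat * (K + 100)) (R := fun s' =>
    s'.ivar 37 = (5 * s.iarr 13 (I.par i) + a) * I.N ∧ s'.ivar 38 = (5 * (I.n + i) + a) * I.N ∧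
    s'.rvar 3 = ε + 2 * I.e (5 * I.par i + a) ∧ s'.rvar 4 = -ε + 2 * I.e (5 * I.par i + a) ∧
    s'.ivar 43 = I.x (5 * I.par i + a) ∧ s'.ivar 33 = 0 ∧ s'.ivar 34 = I.N - 1 ∧ s'.rvar 5 = -100)
    (Ends.of_exec rfl ?_) (fun s₁ hf₁ h₁ => (Ends.loop_frame (c := K + 50) (RowInv I ε i F a s)
      (fun s' => (I.N - s'.ivar 33).toNat + (s'.ivar 34).toNat) ?_ ?_).frame.mono ?_ ?_)) ?_
      (fun _ h => h)
  · simp only [prepareRow, exec, IExpr.eval, RExpr.eval, Store.setI_ivar, Store.setR_rvar, if_true,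
      Nat.reduceEqDiff, if_false, Store.setI_iarr, Store.setI_rarr, Store.setR_ivar,
      Store.setR_iarr, Store.setI_rvar, IExpr.eval_five, h30, h31, h32, hh.n, o1,
      o2, hh.N, hh.e, hh.x, h1, OfNat.zero_ne_ofNat]
    exact ⟨trivial, trivial, by ring, by ring, trivial, trivial, trivial, by norm_num⟩
  · obtain ⟨k37, k38, k3, k4, k43, k33, k34, k5⟩ := h₁
    refine ⟨by omega, by omega, by omega, by omega, ?_, Or.inl k5, ?_, ?_, ⟨?_, ?_, ?_⟩, ?_⟩
    · intro _ t; omega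
    · intro z p₁ p₂ hC
      have := hC.le₁
      have := hC.nonneg₁
      omega
    · intro x; omega
    · intro x; omega
    · intro x; omega
    · intro x; omega
    · intro y _
      rw [hf₁.rarr rfl, hf₁.iarr rfl, hf₁.iarr rfl, hf₁.iarr rfl]
      exact ⟨rfl, rfl, rfl, rfl⟩
  · intro s₂ hf₂ hinv hb
    obtain ⟨k37, k38, k3, k4, k43, -, -, -⟩ := h₁
    have hh₁ : Holds I s₁ := hh.of_frame hf₁ rfl
    have hh₂ : Holds I s₂ := hh₁.of_frame hf₂ rfl
    have k13 : s₂.iarr 13 = s.iarr 13 := by rw [hf₂.iarr rfl, hf₁.iarr rfl]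
    simp only [BExpr.eval, IExpr.eval, hh₂.N, not_le] at hb
    have hct : EntryCtx I ε i F a (s₂.ivar 33) (s₂.ivar 35) s₂ := by
      refine ⟨hh₂, ht.of_sameOutside ha ha5 ?_ k13 hinv.outside, ?_, rfl, rfl, ?_, ?_, ?_⟩
      · intro u hu hui
        have := (ht u hu hui).2.2.1
        omega
      · rw [hf₂.ivar rfl, hf₁.ivar rfl, h30]
      · rw [hf₂.ivar rfl, k37, k13]
      · rw [hf₂.ivar rfl, k43]
      · rw [hf₂.rvar rfl, k4]
    have l38 : s₂.ivar 38 = (5 * (I.n + i) + a) * I.N := by rw [hf₂.ivar rfl, k38]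
    have l3 : s₂.rvar 3 = ε + 2 * I.e (5 * I.par i + a) := by rw [hf₂.rvar rfl, k3]
    have hp0 := hinv.p_nonneg
    have hr0 := hinv.r_nonneg
    refine Ends.mono (Ends.branch (c := K) (fun hc => ?_) (fun hc => Ends.of_exec rfl ?_))
      (by simp [Program.steps, BExpr.cost, IExpr.cost, RExpr.cost]; omega) (fun _ h => h)
    · simp only [BExpr.eval, IExpr.eval, RExpr.eval, hh₂.S, l3] at hc
      refine (hK I ε i F a _ _ _ s₂ hi hin ha ha5 hp0 hb hF rfl hr0 hinv.r_lt hc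
        (hinv.upper hb) hct hinv.best hinv.prior).frame.mono le_rfl ?_
      rintro s₃ ⟨hf₃, m33, mb, mle, mC, m6, m10, m11, m12⟩
      rw [l38] at m6 m10 m11 m12
      have m34 : s₃.ivar 34 = s₂.ivar 34 := hf₃.ivar rfl
      exact ⟨hinv.setEntry hb (hinv.upper hb) m34 m33 mb mle mC m6 m10 m11 m12, by omega⟩
    · simp only [BExpr.eval, IExpr.eval, RExpr.eval, hh₂.S, l3, not_le] at hc
      have hr1 : 0 < s₂.ivar 34 := by
        -- At index 0 the sentinel makes the sum at most 2 - 100, while ε + 2e > -6. The pair is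
        -- then admissible, so the pointer is never lowered below 0.
        refine lt_of_le_of_ne hr0 fun h0 => ?_
        rw [← h0, I.S_zero] at hc
        have := I.S_le _ hp0 hb
        have := (I.e_bounds hv0 (by omega) ha ha5).1
        linarith
      have hrN := hinv.r_lt
      refine ⟨⟨?_, ?_, ?_, ?_, ?_, ?_, ?_, ?_, ?_, ?_⟩, ?_⟩
      · simpa [exec, Store.setI_ivar] using hp0
      · simpa [exec, Store.setI_ivar] using hinv.p_le
      · simp [exec, Store.setI_ivar, IExpr.eval]; omega
      · simp [exec, Store.setI_ivar, IExpr.eval]; omega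
      · simp only [exec, Store.setI_ivar, IExpr.eval, if_true, Nat.reduceEqDiff, if_false]
        intro hp t ht htN
        rcases (show t = s₂.ivar 34 ∨ s₂.ivar 34 < t by omega) with rfl | ht'
        · exact hc
        · exact hinv.upper hb t ht' htN
      · exact hinv.best
      · exact hinv.prior
      · exact hinv.le_best
      · exact hinv.row
      · exact hinv.outside
      · simp [exec, Store.setI_ivar, IExpr.eval]; omega
  · obtain ⟨-, -, -, -, -, k33, k34, -⟩ := h₁
    rw [k33, k34]
    have : (I.N - 0).toNat + (I.N - 1).toNat + 1 = 2 * I.N.toNat := by omega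
    rw [this]
    refine Nat.mul_le_mul_left _ ?_
    simp [BExpr.cost, IExpr.cost]
  · rintro s₂ ⟨hf₂, hb, hinv⟩
    have hN₂ : s₂.ivar 33 = I.N := by
      have hh₂ : Holds I s₂ := (hh.of_frame hf₁ rfl).of_frame hf₂ rfl
      simp only [BExpr.eval, IExpr.eval, hh₂.N, not_not] at hb
      exact le_antisymm hinv.p_le hb
    have := hinv.row
    rw [hN₂] at this
    exact ⟨hinv.outside, this⟩
  · have : 1 ≤ I.N.toNat := by omega
    nlinarith

end RealRAM

namespace Levels
variable {I : Levels}

/-- Only the choices inside the range of the table matter; this lets recorded choices survive later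
writes elsewhere in the arrays. -/
theorem Folds.congr_choice {ε : ℝ} {i : ℤ} {F F' : ℤ → ℤ → ℤ → ℝ} {c₁ c₂ cz d₁ d₂ dz : ℤ → ℤ → ℤ}
    (h : I.Folds ε i F F' c₁ c₂ cz) (hd : ∀ a p, 0 ≤ a → a < 5 → 0 ≤ p → p < I.N →
      d₁ a p = c₁ a p ∧ d₂ a p = c₂ a p ∧ dz a p = cz a p) : I.Folds ε i F F' d₁ d₂ dz := by
  refine ⟨h.eq_of_ne, h.le, fun a p ha ha5 hp hpN hF => ?_, h.mono⟩
  obtain ⟨e1, e2, e3⟩ := hd a p ha ha5 hp hpN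
  rw [e1, e2, e3]
  exact h.attained a p ha ha5 hp hpN hF

end Levels

-- The initial tables

namespace RealRAM
open IExpr BExpr Program

variable {I : Levels} {ε : ℝ} {i : ℤ} {F : ℤ → ℤ → ℤ → ℝ} {a p : ℤ}

/-- Store the tables of the single vertices. -/
def initRow : Program :=
  .forTo 33 (.const 0) (.var 27)
    (.branch (.rle (.var 2) (.arr 5 (.var 33)))
      (.setRArr 6 (.add (.var 38) (.var 33)) (.var 2))
      (.setRArr 6 (.add (.var 38) (.var 33)) (.ofInt (.const (-100)))))

/-- Store the tables of the single vertices. -/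
def initTables : Program :=
  .forTo 30 (.const 0) (.var 0)
    (.seq (.setIArr 13 (.var 30) (.var 30))
      (.forTo 32 (.const 0) (.const 5)
        (.seq
          (.seq (.setIVar 38 (.arr 9 (.add (five (.var 30)) (.var 32))))
            (.setRVar 2 (.arr 2 (.add (five (.var 30)) (.var 32)))))
          initRow)))

/-- The table of a single vertex, indexed by the number of vertex and state. -/
noncomputable def initEntry (I : Levels) (t p : ℤ) : ℝ :=
  if I.e t ≤ I.S p then I.e t else -100

/-- Rows are filled in increasing order, so it is enough to know that the cells below the row are
preserved. -/
theorem initRow_ends : ∃ K : ℕ, ∀ (I : Levels) (t : ℤ) (s : Store), Holds I s → 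
    s.ivar 38 = t * I.N → s.rvar 2 = I.e t →
    Ends initRow s (K * I.N.toNat) (fun s' =>
      (∀ p, 0 ≤ p → p < I.N → s'.rarr 6 (t * I.N + p) = initEntry I t p) ∧
      ∀ y, y < t * I.N → s'.rarr 6 y = s.rarr 6 y) := by
  refine ⟨100, fun I t s hh h38 h2 => ?_⟩
  have hN := I.N_pos
  refine Ends.mono (Ends.forTo_frame (M := I.N) (z := 0) (c := 20) rfl
    (fun s' => 0 ≤ s'.ivar 33 ∧
      (∀ p, 0 ≤ p → p < s'.ivar 33 → s'.rarr 6 (t * I.N + p) = initEntry I t p) ∧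
      ∀ y, y < t * I.N → s'.rarr 6 y = s.rarr 6 y) rfl ?_
      (fun s' hf _ => (hh.of_frame hf rfl).N) ?_) ?_ ?_
  · refine ⟨by simp [Store.setI_ivar], fun p hp hp' => ?_, fun y hy => rfl⟩
    simp [Store.setI_ivar] at hp'
    omega
  · rintro s' hf ⟨h0, hrow, hout⟩ hlt
    have k38 : s'.ivar 38 = t * I.N := by rw [hf.ivar rfl, h38]
    have k2 : s'.rvar 2 = I.e t := by rw [hf.rvar rfl, h2]
    have hh' := hh.of_frame hf rfl
    have key : ∀ s'' : Store, s''.rarr 6 = Function.update (s'.rarr 6) (t * I.N + s'.ivar 33)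
        (initEntry I t (s'.ivar 33)) →
        0 ≤ s'.ivar 33 + 1 ∧ (∀ p, 0 ≤ p → p < s'.ivar 33 + 1 →
          s''.rarr 6 (t * I.N + p) = initEntry I t p) ∧
        ∀ y, y < t * I.N → s''.rarr 6 y = s.rarr 6 y := by
      intro s'' h6
      refine ⟨by omega, fun p hp hp' => ?_, fun y hy => ?_⟩
      · rw [h6]
        rcases (show p = s'.ivar 33 ∨ p < s'.ivar 33 by omega) with rfl | hp''
        · rw [Function.update_self]
        · rw [Function.update_of_ne (by omega), hrow p hp hp'']
      · rw [h6, Function.update_of_ne (by omega), hout y hy]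
    refine (Ends.branch (fun hb => Ends.of_exec rfl ?_) (fun hb => Ends.of_exec rfl ?_)).mono
      (by simp [Program.steps, BExpr.cost, IExpr.cost, RExpr.cost]) (fun _ h => h)
    · intro _
      simp only [BExpr.eval, RExpr.eval, IExpr.eval, k2, hh'.S] at hb
      simp only [Store.setI_ivar, if_true, Store.setI_rarr]
      refine key _ ?_
      simp [exec, Store.setRA_rarr, IExpr.eval, RExpr.eval, k38, k2, initEntry, hb]
    · intro _
      simp only [BExpr.eval, RExpr.eval, IExpr.eval, k2, hh'.S] at hb
      simp only [Store.setI_ivar, if_true, Store.setI_rarr]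
      refine key _ ?_
      simp [exec, Store.setRA_rarr, IExpr.eval, RExpr.eval, k38, initEntry, hb]
  · simp only [IExpr.cost]
    omega
  · rintro s' ⟨hN', -, hrow, hout⟩
    exact ⟨fun p hp hpN => hrow p hp (by omega), hout⟩

theorem initTables_ends : ∃ K : ℕ, ∀ (I : Levels) (s : Store), Holds I s →
    Ends initTables s (K * (I.n.toNat * I.N.toNat))
      (fun s' => HoldsTables I I.n I.initTable s') := by
  obtain ⟨K, hK⟩ := initRow_ends
  refine ⟨12 * (K + 100), fun I s hh => ?_⟩
  have hN := I.N_pos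
  have hn := I.n_pos
  refine Ends.mono (Ends.forTo_frame (M := I.n) (z := 0)
    (c := 6 * (K * I.N.toNat + 60)) rfl
    (fun s' => 0 ≤ s'.ivar 30 ∧ (∀ u, 0 ≤ u → u < s'.ivar 30 → s'.iarr 13 u = u) ∧
      ∀ t p, 0 ≤ t → t < 5 * s'.ivar 30 → 0 ≤ p → p < I.N →
        s'.rarr 6 (t * I.N + p) = initEntry I t p) rfl ?_
      (fun s' hf _ => (hh.of_frame hf rfl).n) ?_) ?_ ?_
  · refine ⟨by simp [Store.setI_ivar], fun u hu hu' => ?_, fun t p ht ht' => ?_⟩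
    · simp [Store.setI_ivar] at hu'; omega
    · simp [Store.setI_ivar] at ht'; omega
  · rintro s₁ hf₁ ⟨h0, hcur, htab⟩ hlt
    have hh₁ := hh.of_frame hf₁ rfl
    refine Ends.of_le (Ends.seq_frame (R := fun s' => s'.iarr 13 =
      Function.update (s₁.iarr 13) (s₁.ivar 30) (s₁.ivar 30)) (Ends.of_exec rfl ?_)
      (fun s₂ hf₂ h₂ => (Ends.forTo_frame (M := 5) (z := 0) (c := K * I.N.toNat + 40) rfl
        (fun s' => 0 ≤ s'.ivar 32 ∧
      ∀ t p, 0 ≤ t → t < 5 * s₁.ivar 30 + s'.ivar 32 → 0 ≤ p → p < I.N →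
        s'.rarr 6 (t * I.N + p) = initEntry I t p) rfl ?_ (fun s' _ _ => rfl) ?_).frame.mono le_rfl ?_)) ?_
    · simp [exec, Store.setIA_iarr, IExpr.eval]
    · refine ⟨by simp [Store.setI_ivar], fun t p ht ht' hp hpN => ?_⟩
      simp [Store.setI_ivar] at ht'
      simp only [Store.setI_rarr]
      rw [hf₂.rarr rfl]
      exact htab t p ht ht' hp hpN
    · rintro s₃ hf₃ ⟨k0, ktab⟩ k5
      have hh₃ := (hh₁.of_frame hf₂ rfl).of_frame hf₃ rfl
      have k30 : s₃.ivar 30 = s₁.ivar 30 := by rw [hf₃.ivar rfl, hf₂.ivar rfl]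
      refine Ends.of_le (Ends.seq_frame
        (R := fun s' => s'.ivar 38 = (5 * s₁.ivar 30 + s₃.ivar 32) * I.N ∧
          s'.rvar 2 = I.e (5 * s₁.ivar 30 + s₃.ivar 32)) (Ends.of_exec rfl ?_)
        (fun s₄ hf₄ h₄ => (hK I _ s₄ (hh₃.of_frame hf₄ rfl) h₄.1 h₄.2).mono le_rfl ?_)) ?_
      · simp only [exec, IExpr.eval, RExpr.eval, Store.setI_ivar, Store.setR_rvar, if_true,
          Nat.reduceEqDiff, if_false, Store.setI_rarr, Store.setR_ivar, IExpr.eval_five, k30, hh₃.e]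
        exact ⟨hh₃.off _ (by omega) (by omega), trivial⟩
      · rintro s₅ ⟨hrow, hout⟩ -
        refine ⟨by simp [Store.setI_ivar]; omega, fun t p ht ht' hp hpN => ?_⟩
        simp only [Store.setI_ivar, if_true, Store.setI_rarr] at ht' ⊢
        rcases (show t = 5 * s₁.ivar 30 + s₃.ivar 32 ∨ t < 5 * s₁.ivar 30 + s₃.ivar 32 by omega)
          with rfl | ht''
        · exact hrow p hp hpN
        · rw [hout _ (by nlinarith), hf₄.rarr rfl]
          exact ktab t p ht ht'' hp hpN
      · simp only [Program.steps, IExpr.cost, RExpr.cost, IExpr.five]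
        omega
    · rintro s₃ ⟨hf₃, k5, k0, ktab⟩ -
      have k30 : s₃.ivar 30 = s₁.ivar 30 := by rw [hf₃.ivar rfl, hf₂.ivar rfl]
      have k13 : s₃.iarr 13 = Function.update (s₁.iarr 13) (s₁.ivar 30) (s₁.ivar 30) := by
        rw [hf₃.iarr rfl, h₂]
      simp only [Store.setI_ivar, if_true, Store.setI_rarr, Store.setI_iarr, k13]
      refine ⟨by omega, fun u hu hu' => ?_, fun t p ht ht' hp hpN => ktab t p ht (by omega) hp hpN⟩
      rcases (show u = s₁.ivar 30 ∨ u < s₁.ivar 30 by omega) with rfl | hu''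
      · rw [Function.update_self]
      · rw [Function.update_of_ne (by omega), hcur u hu hu'']
    · simp only [Program.steps, IExpr.cost, Int.reduceSub, Int.reduceToNat]
      omega
  · simp only [IExpr.cost]
    obtain ⟨q, hq⟩ : ∃ q : ℕ, I.N.toNat = q + 1 := ⟨I.N.toNat - 1, by omega⟩
    obtain ⟨l, hl⟩ : ∃ l : ℕ, I.n.toNat = l + 1 := ⟨I.n.toNat - 1, by omega⟩
    rw [sub_zero, hq, hl]
    nlinarith [Nat.zero_le (K * q), Nat.zero_le (l * q), Nat.zero_le (K * q * l),
      Nat.zero_le (K * l)]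
  · rintro s' ⟨hn', h0, hcur, htab⟩ u hu hun
    have := hcur u hu (by omega)
    refine ⟨by omega, by omega, by omega, fun k p hk hk5 hp hpN => ?_⟩
    rw [this, htab _ p (by omega) (by omega) hp hpN]
    rfl

end RealRAM

-- Merging all vertices and deciding a threshold

namespace RealRAM
open IExpr BExpr Program

variable {I : Levels} {ε : ℝ} {i : ℤ} {F : ℤ → ℤ → ℤ → ℝ} {a p : ℤ}

/-- Compute the tables of vertex `ivar 31` for all its states. -/
def computeRows : Program := .forTo 32 (.const 0) (.const 5) computeRow

/-- Merge vertex `n - ivar 44` into its parent. -/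
def foldVertex : Program :=
  .seq
    (.seq (.setIVar 30 (.sub (.var 0) (.var 44))) (.setIVar 31 (.arr 4 (.var 30))))
    (.seq computeRows (.setIArr 13 (.var 31) (.add (.var 0) (.var 30))))

/-- Decide whether there are rounded distances with errors at most `rvar 1`. -/
def decideProgram : Program :=
  .seq initTables
    (.seq (.forTo 44 (.const 1) (.var 0) foldVertex)
      (.setRVar 9 (.arr 6 (.add (.arr 9 (.add (five (.arr 13 (.const 0))) (.const 2)))
        (.sub (.var 27) (.const 1))))))

theorem RowAt.congr {m W : ℤ} {s s' : Store} (h : RowAt I ε i F a m W s)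
    (hs : ∀ x, 0 ≤ x → x < m → s'.rarr 6 (W + x) = s.rarr 6 (W + x) ∧
      s'.iarr 10 (W + x) = s.iarr 10 (W + x) ∧ s'.iarr 11 (W + x) = s.iarr 11 (W + x) ∧
      s'.iarr 12 (W + x) = s.iarr 12 (W + x)) : RowAt I ε i F a m W s' := by
  refine ⟨fun x z p₁ p₂ hx hxm hC => ?_, fun x hx hxm => ?_, fun x y hx hxy hy => ?_⟩
  · rw [(hs x hx hxm).1]; exact h.le x z p₁ p₂ hx hxm hC
  · rw [(hs x hx hxm).1, (hs x hx hxm).2.1, (hs x hx hxm).2.2.1, (hs x hx hxm).2.2.2]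
    exact h.attained x hx hxm
  · rw [(hs x hx (by omega)).1, (hs y (by omega) hy).1]; exact h.mono x y hx hxy hy

theorem computeRows_ends : ∃ K : ℕ, ∀ (I : Levels) (ε : ℝ) (i : ℤ) (F : ℤ → ℤ → ℤ → ℝ)
    (s : Store), 0 ≤ ε → 1 ≤ i → i < I.n → I.Mono F (i + 1) →
    Holds I s → HoldsTables I (i + 1) F s → s.rvar 1 = ε → s.ivar 30 = i → s.ivar 31 = I.par i →
    Ends computeRows s (K * I.N.toNat) (fun s' =>
      SameOutside (5 * I.N) (5 * (I.n + i) * I.N) s s' ∧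
        ∀ a, 0 ≤ a → a < 5 → RowAt I ε i F a I.N ((5 * (I.n + i) + a) * I.N) s') := by
  obtain ⟨K, hK⟩ := computeRow_ends
  refine ⟨6 * (K + 20), fun I ε i F s hε hi hin hF hh ht h1 h30 h31 => ?_⟩
  have hN := I.N_pos
  have hexp : ∀ a, (5 * (I.n + i) + a) * I.N = 5 * (I.n + i) * I.N + a * I.N := fun a => by ring
  refine Ends.mono (Ends.forTo_frame (M := 5) (z := 0) (c := K * I.N.toNat) rfl
    (fun s' => 0 ≤ s'.ivar 32 ∧ SameOutside (5 * I.N) (5 * (I.n + i) * I.N) s s' ∧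
        ∀ a, 0 ≤ a → a < s'.ivar 32 → RowAt I ε i F a I.N ((5 * (I.n + i) + a) * I.N) s')
      rfl ?_ (fun s' hf _ => rfl) ?_) ?_ ?_
  · refine ⟨by simp [Store.setI_ivar], fun y _ => ⟨rfl, rfl, rfl, rfl⟩, fun a ha ha' => ?_⟩
    simp [Store.setI_ivar] at ha'
    omega
  · rintro s₁ hf₁ ⟨h0, hout, hrow⟩ h5
    have ht₁ : HoldsTables I (i + 1) F s₁ := by
      intro u hu hui
      rw [hf₁.iarr rfl]
      obtain ⟨k1, k2, k3, k4⟩ := ht u hu hui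
      refine ⟨k1, k2, k3, fun k p hk hk5 hp hpN => ?_⟩
      rw [← k4 k p hk hk5 hp hpN]
      refine (hout _ ?_).1
      -- Slot n + i is still free: a current table sits either in an initial slot below n or in a
      -- slot n + m with m > i.
      rcases (show s.iarr 13 u < I.n + i ∨ I.n + i < s.iarr 13 u by omega) with hlt | hlt
      · left; nlinarith
      · right; nlinarith
    refine (hK I ε i F (s₁.ivar 32) s₁ hε hi hin h0 h5 hF (hh.of_frame hf₁ rfl) ht₁
      (by rw [hf₁.rvar rfl, h1]) (by rw [hf₁.ivar rfl, h30]) (by rw [hf₁.ivar rfl, h31])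
      rfl).mono le_rfl ?_
    rintro s₂ ⟨hout₂, hrow₂⟩ -
    simp only [Store.setI_ivar, if_true]
    refine ⟨by omega, fun y hy => ?_, fun a ha ha' => ?_⟩
    · have h2 := hout₂ y (by
        rw [hexp]
        rcases hy with hy | hy
        · left; nlinarith
        · right; nlinarith)
      have h1 := hout y hy
      simp only [Store.setI_rarr, Store.setI_iarr]
      rw [h2.1, h2.2.1, h2.2.2.1, h2.2.2.2]
      exact h1
    · rcases (show a = s₁.ivar 32 ∨ a < s₁.ivar 32 by omega) with rfl | ha''
      · exact hrow₂
      · exact (hrow a ha ha'').congr fun x hx hxN =>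
          hout₂ _ (row_disjoint hN (by omega) hx hxN)
  · simp only [IExpr.cost, sub_zero, Int.reduceToNat]
    have : 1 ≤ I.N.toNat := by omega
    nlinarith
  · rintro s' ⟨h5, h0, hout, hrow⟩
    exact ⟨hout, fun a ha ha5 => hrow a ha (by omega)⟩

/-- The choices recorded in the integer array `A`. -/
def choice (I : Levels) (A : ℕ) (s : Store) (j a p : ℤ) : ℤ :=
  s.iarr A ((5 * (I.n + j) + a) * I.N + p)

/-- The new table of the parent is put into the fresh slot n + i. The old table stays readable while
the new one is written, and every merge keeps its own record of choices. The counter `ivar 44`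
increases, so the merged vertex n - `ivar 44` decreases. -/
theorem foldVertex_ends : ∃ K : ℕ, ∀ (I : Levels) (ε : ℝ) (F : ℤ → ℤ → ℤ → ℤ → ℝ)
    (s : Store), 0 ≤ ε → 1 ≤ s.ivar 44 → s.ivar 44 < I.n → Holds I s → s.rvar 1 = ε →
    I.Chain ε (I.n - s.ivar 44 + 1) F (choice I 10 s) (choice I 11 s) (choice I 12 s) →
    HoldsTables I (I.n - s.ivar 44 + 1) (F (I.n - s.ivar 44 + 1)) s →
    Ends foldVertex s (K * I.N.toNat) (fun s' => ∃ F' : ℤ → ℤ → ℤ → ℤ → ℝ,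
      I.Chain ε (I.n - s.ivar 44) F' (choice I 10 s') (choice I 11 s') (choice I 12 s') ∧
      HoldsTables I (I.n - s.ivar 44) (F' (I.n - s.ivar 44)) s') := by
  obtain ⟨K, hK⟩ := computeRows_ends
  refine ⟨K + 100, fun I ε F s hε h44 h44n hh h1 hch ht => ?_⟩
  have hN := I.N_pos
  obtain ⟨i, hi⟩ : ∃ i, i = I.n - s.ivar 44 := ⟨_, rfl⟩
  rw [← hi] at hch ht ⊢
  have hi1 : 1 ≤ i := by omega
  have hin : i < I.n := by omega
  have hv0 := I.par_nonneg i hi1 hin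
  have hvi := I.par_lt i hi1 hin
  refine Ends.of_le (Ends.seq_frame (R := fun s' => s'.ivar 30 = i ∧ s'.ivar 31 = I.par i)
    (Ends.of_exec rfl ?_) (fun s₁ hf₁ h₁ => Ends.seq_frame
      (hK I ε i (F (i + 1)) s₁ hε hi1 hin (hch.mono_table (by omega)) (hh.of_frame hf₁ rfl) ?_
      (by rw [hf₁.rvar rfl, h1]) h₁.1 h₁.2) (fun s₂ hf₂ h₂ => Ends.of_exec rfl ?_))) ?_
  · simp [exec, IExpr.eval, Store.setI_ivar, hh.n, hh.par, hi]
  · unfold HoldsTables; rw [hf₁.iarr rfl, hf₁.rarr rfl]; exact ht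
  · obtain ⟨hout, hrow⟩ := h₂
    have k30 : s₂.ivar 30 = i := by rw [hf₂.ivar rfl, h₁.1]
    have k31 : s₂.ivar 31 = I.par i := by rw [hf₂.ivar rfl, h₁.2]
    have k0 : s₂.ivar 0 = I.n := by rw [hf₂.ivar rfl, hf₁.ivar rfl, hh.n]
    have k13 : s₂.iarr 13 = s.iarr 13 := by rw [hf₂.iarr rfl, hf₁.iarr rfl]
    have l6 : s₁.rarr 6 = s.rarr 6 := hf₁.rarr rfl
    have l10 : s₁.iarr 10 = s.iarr 10 := hf₁.iarr rfl
    have l11 : s₁.iarr 11 = s.iarr 11 := hf₁.iarr rfl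
    have l12 : s₁.iarr 12 = s.iarr 12 := hf₁.iarr rfl
    simp only [SameOutside, l6, l10, l11, l12] at hout
    obtain ⟨s₃, hs₃⟩ : ∃ s₃, s₃ = (setIArr 13 (var 31) ((var 0).add (var 30))).exec s₂ := ⟨_, rfl⟩
    rw [← hs₃]
    have m6 : s₃.rarr 6 = s₂.rarr 6 := by rw [hs₃]; rfl
    have m10 : s₃.iarr 10 = s₂.iarr 10 := by rw [hs₃]; simp [exec, Store.setIA_iarr]
    have m11 : s₃.iarr 11 = s₂.iarr 11 := by rw [hs₃]; simp [exec, Store.setIA_iarr]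
    have m12 : s₃.iarr 12 = s₂.iarr 12 := by rw [hs₃]; simp [exec, Store.setIA_iarr]
    have m13 : s₃.iarr 13 = Function.update (s.iarr 13) (I.par i) (I.n + i) := by
      rw [hs₃]; simp [exec, Store.setIA_iarr, IExpr.eval, k30, k31, k0, k13]
    have hother : ∀ b k p, b ≠ I.n + i → 0 ≤ k → k < 5 → 0 ≤ p → p < I.N →
        s₃.rarr 6 ((5 * b + k) * I.N + p) = s.rarr 6 ((5 * b + k) * I.N + p) ∧
        s₃.iarr 10 ((5 * b + k) * I.N + p) = s.iarr 10 ((5 * b + k) * I.N + p) ∧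
        s₃.iarr 11 ((5 * b + k) * I.N + p) = s.iarr 11 ((5 * b + k) * I.N + p) ∧
        s₃.iarr 12 ((5 * b + k) * I.N + p) = s.iarr 12 ((5 * b + k) * I.N + p) := by
      intro b k p hb hk hk5 hp hpN
      rw [m6, m10, m11, m12]
      refine hout _ ?_
      rcases lt_or_gt_of_ne hb with hlt | hlt
      · left; nlinarith
      · right; nlinarith
    let G : ℤ → ℤ → ℤ → ℝ := fun v a p =>
      if v = I.par i then s₃.rarr 6 ((5 * (I.n + i) + a) * I.N + p) else F (i + 1) v a p
    have hG : ∀ a p, G (I.par i) a p = s₃.rarr 6 ((5 * (I.n + i) + a) * I.N + p) :=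
      fun a p => if_pos rfl
    have hfold : I.Folds ε i (F (i + 1)) G (choice I 10 s₃ i) (choice I 11 s₃ i)
        (choice I 12 s₃ i) := by
      refine ⟨fun u k p _ _ hu _ _ _ _ => if_neg hu, ?_, ?_, ?_⟩
      · intro a p z p₁ p₂ ha ha5 hp hpN hC
        rw [hG, m6]
        exact (hrow a ha ha5).le p z p₁ p₂ hp hpN hC
      · intro a p ha ha5 hp hpN
        simp only [hG, m6, choice, m10, m11, m12]
        exact (hrow a ha ha5).attained p hp hpN
      · intro a p q ha ha5 hp hpq hq
        simp only [hG, m6]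
        exact (hrow a ha ha5).mono p q hp hpq hq
    refine ⟨Function.update F i G, ⟨?_, ?_⟩, ?_⟩
    · intro v k p
      rw [Function.update_of_ne (by omega)]
      exact hch.init v k p
    · intro m him hmn
      rcases him.eq_or_lt with rfl | hlt
      · rw [Function.update_self, Function.update_of_ne (by omega)]
        exact hfold
      · rw [Function.update_of_ne (by omega), Function.update_of_ne (by omega)]
        -- The choices for an earlier merge of a vertex m > i are in slot n + m, which this merge
        -- does not touch.
        refine (hch.fold m (by omega) hmn).congr_choice fun a p ha ha5 hp hpN => ?_
        exact (hother (I.n + m) a p (by omega) ha ha5 hp hpN).2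
    · rw [Function.update_self]
      intro u hu hui
      rw [m13]
      by_cases hup : u = I.par i
      · rw [hup, Function.update_self]
        exact ⟨by omega, by omega, by omega, fun k p _ _ _ _ => (hG k p).symm⟩
      · rw [Function.update_of_ne hup]
        obtain ⟨h1, h2, h3, h4⟩ := ht u hu (by omega)
        refine ⟨h1, h2, by omega, fun k p hk hk5 hp hpN => ?_⟩
        rw [(hother _ k p (by omega) hk hk5 hp hpN).1, h4 k p hk hk5 hp hpN]
        exact (if_neg hup).symm
  · simp only [Program.steps, IExpr.cost]
    have : 1 ≤ I.N.toNat := by omega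
    nlinarith

/-- The store holds the result of the dynamic program for the threshold `ε`. -/
def Decided (I : Levels) (ε : ℝ) (s : Store) : Prop :=
  ∃ F : ℤ → ℤ → ℤ → ℤ → ℝ, I.Chain ε 1 F (choice I 10 s) (choice I 11 s) (choice I 12 s) ∧
    s.rvar 9 = F 1 0 2 (I.N - 1)

/-- The initial tables cost O(nN), and each of the n - 1 merges costs O(N). -/
theorem decideProgram_ends : ∃ K : ℕ, ∀ (I : Levels) (ε : ℝ) (s : Store), 0 ≤ ε → Holds I s →
    s.rvar 1 = ε →
    Ends decideProgram s (K * (I.n.toNat * I.N.toNat)) (fun s' => Decided I ε s') := by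
  obtain ⟨K₁, hK₁⟩ := initTables_ends
  obtain ⟨K₂, hK₂⟩ := foldVertex_ends
  refine ⟨K₁ + K₂ + 100, fun I ε s hε hh h1 => ?_⟩
  have hN := I.N_pos
  have hn := I.n_pos
  refine Ends.of_le (Ends.seq_frame (hK₁ I s hh) (fun s₁ hf₁ h₁ => Ends.seq_frame
    (Ends.forTo_frame (M := I.n) (z := 1) (c := K₂ * I.N.toNat) rfl
    (fun s' => 1 ≤ s'.ivar 44 ∧ s'.ivar 44 ≤ I.n ∧ ∃ F : ℤ → ℤ → ℤ → ℤ → ℝ,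
      I.Chain ε (I.n - s'.ivar 44 + 1) F (choice I 10 s') (choice I 11 s') (choice I 12 s') ∧
      HoldsTables I (I.n - s'.ivar 44 + 1) (F (I.n - s'.ivar 44 + 1)) s') rfl ?_
      (fun s' hf _ => ((hh.of_frame hf₁ rfl).of_frame hf rfl).n) ?_)
    (fun s₂ hf₂ h₂ => Ends.of_exec rfl ?_))) ?_
  · simp only [Store.setI_ivar, if_true]
    refine ⟨le_rfl, hn, fun _ => I.initTable, ⟨fun _ _ _ _ _ _ _ _ _ => rfl, fun m _ _ => ?_⟩, ?_⟩
    · omega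
    · rw [sub_add_cancel]
      exact h₁
  · rintro s' hf ⟨h44, -, F, hch, ht⟩ hlt
    have hh' : Holds I s' := (hh.of_frame hf₁ rfl).of_frame hf rfl
    refine (hK₂ I ε F s' hε h44 hlt hh' (by rw [hf.rvar rfl, hf₁.rvar rfl, h1]) hch ht).mono
      le_rfl ?_
    rintro s'' ⟨F', hch', ht'⟩ -
    simp only [Store.setI_ivar, if_true]
    refine ⟨by omega, by omega, F', ?_⟩
    rw [show I.n - (s'.ivar 44 + 1) + 1 = I.n - s'.ivar 44 by ring]
    exact ⟨hch', ht'⟩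
  · obtain ⟨h3, h4, h5, F, hch, ht⟩ := h₂
    have hh₂ : Holds I s₂ := (hh.of_frame hf₁ rfl).of_frame hf₂ rfl
    rw [show s₂.ivar 44 = I.n by omega, sub_self, zero_add] at hch ht
    obtain ⟨k1, k2, -, k4⟩ := ht 0 le_rfl (by norm_num)
    refine ⟨F, hch, ?_⟩
    simp only [exec, Store.setR_rvar, if_true, RExpr.eval, IExpr.eval, IExpr.eval_five, hh₂.N]
    rw [hh₂.off _ (by omega) (by omega)]
    exact k4 2 _ (by norm_num) (by norm_num) (by omega) (by omega)
  · simp only [Program.steps, IExpr.cost, RExpr.cost, IExpr.five]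
    rw [show (I.n - 1).toNat + 1 = I.n.toNat by omega]
    have h1 : 1 ≤ I.N.toNat := by omega
    have h2 : 1 ≤ I.n.toNat := by omega
    have h3 : I.n.toNat ≤ I.n.toNat * I.N.toNat := Nat.le_mul_of_pos_right _ h1
    nlinarith

end RealRAM

-- Backtracking, and the search for the optimal threshold

namespace Levels
variable {I : Levels}

/-- An admissible entry at the root is unfolded from the root downwards: each recorded choice splits
off one more vertex until every part is a single vertex. -/
theorem Chain.feasible {ε : ℝ} {F : ℤ → ℤ → ℤ → ℤ → ℝ} {c₁ c₂ cz : ℤ → ℤ → ℤ → ℤ}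
    (h : I.Chain ε 1 F c₁ c₂ cz) (hF : -50 < F 1 0 2 (I.N - 1)) :
    ∃ K P, I.Feasible ε I.n I.initTable K P := by
  have key : ∀ j, 1 ≤ j → j ≤ I.n → ∃ K P, I.Feasible ε j (F j) K P := by
    intro j hj
    induction j, hj using Int.leInduction with
    | base => exact fun _ => ⟨fun _ => 2, fun _ => I.N - 1, feasible_one rfl rfl hF⟩
    | succ j hj ih =>
      intro hjn
      obtain ⟨K, P, hf⟩ := ih (by omega)
      exact ⟨_, _, (h.fold j hj (by omega)).feasible_succ hj (by omega) hf⟩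
  obtain ⟨K, P, hf⟩ := key I.n I.n_pos le_rfl
  exact ⟨K, P, hf.congr fun v k p h1 h2 h3 h4 h5 h6 => (h.init v k p h1 h2 h3 h4 h5 h6).symm⟩

end Levels

namespace RealRAM
open IExpr BExpr Program

/-- The bound ε ≤ 2 is used only from right to left, where a given rounding has to lie among the
five candidates of each vertex. -/
theorem Decided.iff {I : Levels} {ε : ℝ} {s : Store} (h : Decided I ε s) (hε : ε ≤ 2) :
    -50 < s.rvar 9 ↔ ∃ x, I.IsGood ε x := by
  obtain ⟨F, hch, h9⟩ := h
  rw [h9]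
  constructor
  · intro hF
    obtain ⟨K, P, hf⟩ := hch.feasible hF
    exact ⟨_, hf.isGood⟩
  · rintro ⟨x, hx⟩
    exact hch.of_isGood hε hx

/-- Binary search for the least threshold in the sorted real array `3`, of length `ivar 20`, for
which there are rounded distances. -/
def searchProgram : Program :=
  .seq (.seq (.setIVar 50 (.const 0)) (.setIVar 51 (.sub (.var 20) (.const 1))))
    (.seq
      (.loop (.not (.ile (.var 51) (.var 50)))
        (.seq
          (.seq (.setIVar 52 (.half (.add (.var 50) (.var 51)))) (.setRVar 1 (.arr 3 (.var 52))))
          (.seq decideProgram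
            (.branch (.rle (.var 9) (.ofInt (.const (-50))))
              (.setIVar 50 (.add (.var 52) (.const 1)))
              (.setIVar 51 (.var 52))))))
      (.seq (.setRVar 1 (.arr 3 (.var 51))) decideProgram))

/-- The invariant of the binary search. -/
structure SearchInv (I : Levels) (A : ℤ → ℝ) (m r : ℕ) (s : Store) : Prop where
  holds : Holds I s
  A_eq : s.rarr 3 = A
  lo_nonneg : 0 ≤ s.ivar 50
  hi_lt : s.ivar 51 < 2 ^ m
  length : s.ivar 51 - s.ivar 50 + 1 = 2 ^ r
  good : ∃ x, I.IsGood (A (s.ivar 51)) x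
  bad : ∀ y, 0 ≤ y → y < s.ivar 50 → ¬ ∃ x, I.IsGood (A y) x

/-- Feasibility is monotone in the threshold. Since the length of the array is a power of two, the
interval is halved exactly, and its length 2^r leaves r rounds. The decision is repeated at the end
because the last run of the search may have recorded choices for a different threshold. -/
theorem searchProgram_ends : ∃ K : ℕ, ∀ (I : Levels) (A : ℤ → ℝ) (m : ℕ) (s : Store),
    Holds I s → s.rarr 3 = A → s.ivar 20 = 2 ^ m →
    (∀ x y, 0 ≤ x → x ≤ y → y < 2 ^ m → A x ≤ A y) →
    (∀ x, 0 ≤ x → x < 2 ^ m → 0 ≤ A x ∧ A x ≤ 2) → (∃ x, 0 ≤ x ∧ x < 2 ^ m ∧ A x = 2) →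
    Ends searchProgram s (K * (I.n.toNat * I.N.toNat * (m + 1))) (fun s' => ∃ ε,
      Decided I ε s' ∧ -50 < s'.rvar 9 ∧
        ∀ x, 0 ≤ x → x < 2 ^ m → (∃ y, I.IsGood (A x) y) → ε ≤ A x) := by
  obtain ⟨K, hK⟩ := decideProgram_ends
  refine ⟨2 * K + 100, fun I A m s hh h3 h20 hmono hbd htwo => ?_⟩
  have hN := I.N_pos
  have hn := I.n_pos
  refine Ends.of_le (Ends.seq (Ends.of_exec rfl (Ends.seq_frame
    (Ends.loop_nat (SearchInv I A m) (c := K * (I.n.toNat * I.N.toNat) + 40) ?_ m _ ?_)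
    (c' := K * (I.n.toNat * I.N.toNat) + 40)
    (fun s₁ hf₁ h₁ => Ends.of_le (Ends.seq_frame (R := fun s' => Holds I s' ∧
      s'.rvar 1 = A (s₁.ivar 51)) (Ends.of_exec rfl ?_) (fun s₂ hf₂ h₂ =>
      (hK I (A (s₁.ivar 51)) s₂ ?_ h₂.1 h₂.2).mono le_rfl ?_)) ?_)))) ?_
  · intro r s₁ hinv hb
    simp only [BExpr.eval, IExpr.eval, not_le] at hb
    obtain ⟨hh₁, hA, h0, hlt, hlen, hgood, hbad⟩ := hinv
    obtain ⟨q, rfl⟩ : ∃ q, r = q + 1 := by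
      refine ⟨r - 1, ?_⟩
      have : r ≠ 0 := by rintro rfl; simp at hlen; omega
      omega
    have hq : (1 : ℤ) ≤ 2 ^ q := one_le_pow₀ (by norm_num)
    rw [pow_succ] at hlen
    -- The endpoints add up to twice the lower one plus 2 * 2^q - 1; halving rounds down to the last
    -- index of the lower half.
    have hmid : (s₁.ivar 50 + s₁.ivar 51) / 2 = s₁.ivar 50 + 2 ^ q - 1 := by omega
    obtain ⟨d, hd⟩ : ∃ d, d = s₁.ivar 50 + 2 ^ q - 1 := ⟨_, rfl⟩
    rw [← hd] at hmid
    have hd0 := hbd d (by omega) (by omega)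
    refine Ends.of_le (Ends.seq_frame (R := fun s' => s'.ivar 52 = d ∧ s'.rvar 1 = A d)
      (Ends.of_exec rfl ?_) (fun s₂ hf₂ h₂ => Ends.seq_frame
        (hK I (A d) s₂ hd0.1 (hh₁.of_frame hf₂ rfl) h₂.2)
        (fun s₃ hf₃ h₃ => Ends.branch (fun hc => Ends.of_exec rfl ?_)
          (fun hc => Ends.of_exec rfl ?_)))) ?_
    · simp [exec, Store.setI_ivar, Store.setR_rvar, IExpr.eval, RExpr.eval, hmid, hA]
    · have hh₃ := (hh₁.of_frame hf₂ rfl).of_frame hf₃ rfl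
      have k50 : s₃.ivar 50 = s₁.ivar 50 := by rw [hf₃.ivar rfl, hf₂.ivar rfl]
      have k51 : s₃.ivar 51 = s₁.ivar 51 := by rw [hf₃.ivar rfl, hf₂.ivar rfl]
      have k52 : s₃.ivar 52 = d := by rw [hf₃.ivar rfl, h₂.1]
      have k3 : s₃.rarr 3 = A := by rw [hf₃.rarr rfl, hf₂.rarr rfl, hA]
      have hnot : ¬ ∃ x, I.IsGood (A d) x := by
        rw [← h₃.iff hd0.2, not_lt]
        simpa [BExpr.eval, RExpr.eval, IExpr.eval] using hc
      refine ⟨q, by omega, ?_, k3, ?_, ?_, ?_, ?_, ?_⟩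
      · exact ⟨hh₃.n, hh₃.N, hh₃.par, hh₃.x, hh₃.e, hh₃.S, hh₃.off⟩
      · simp [exec, Store.setI_ivar, IExpr.eval, k52]; omega
      · simp [exec, Store.setI_ivar, k51]; omega
      · simp [exec, Store.setI_ivar, IExpr.eval, k51, k52]; omega
      · simpa [exec, Store.setI_ivar, k51] using hgood
      · intro y hy hyd
        simp [exec, Store.setI_ivar, IExpr.eval, k52] at hyd
        rintro ⟨x, hx⟩
        exact hnot ⟨x, hx.mono _ (hmono y d hy (by omega) (by omega))⟩
    · have hh₃ := (hh₁.of_frame hf₂ rfl).of_frame hf₃ rfl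
      have k50 : s₃.ivar 50 = s₁.ivar 50 := by rw [hf₃.ivar rfl, hf₂.ivar rfl]
      have k52 : s₃.ivar 52 = d := by rw [hf₃.ivar rfl, h₂.1]
      have k3 : s₃.rarr 3 = A := by rw [hf₃.rarr rfl, hf₂.rarr rfl, hA]
      have hyes : ∃ x, I.IsGood (A d) x := by
        rw [← h₃.iff hd0.2]
        simpa [BExpr.eval, RExpr.eval, IExpr.eval] using hc
      refine ⟨q, by omega, ?_, k3, ?_, ?_, ?_, ?_, ?_⟩
      · exact ⟨hh₃.n, hh₃.N, hh₃.par, hh₃.x, hh₃.e, hh₃.S, hh₃.off⟩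
      · simp [exec, Store.setI_ivar, k50]; omega
      · simp [exec, Store.setI_ivar, IExpr.eval, k52]; omega
      · simp [exec, Store.setI_ivar, IExpr.eval, k50, k52]; omega
      · simpa [exec, Store.setI_ivar, IExpr.eval, k52] using hyes
      · simpa [exec, Store.setI_ivar, k50] using hbad
    · simp only [Program.steps, IExpr.cost, RExpr.cost, BExpr.cost]
      omega
  · obtain ⟨x₂, hx0, hxm, hx2⟩ := htwo
    -- The largest threshold is 2, which can always be met, so the search starts with a good upper
    -- end.
    have hlast : A (2 ^ m - 1) = 2 :=
      le_antisymm (hbd _ (by omega) (by omega)).2 (by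
        rw [← hx2]; exact hmono _ _ hx0 (by omega) (by omega))
    refine ⟨?_, h3, ?_, ?_, ?_, ?_, ?_⟩
    · exact ⟨hh.n, hh.N, hh.par, hh.x, hh.e, hh.S, hh.off⟩
    · simp [exec, Store.setI_ivar, IExpr.eval]
    · simp [exec, Store.setI_ivar, IExpr.eval, h20]
    · simp [exec, Store.setI_ivar, IExpr.eval, h20]
    · simp only [exec, Store.setI_ivar, IExpr.eval, h20, if_true, Nat.reduceEqDiff, if_false]
      rw [hlast]
      exact I.exists_isGood_two
    · intro y hy hy'
      simp [exec, Store.setI_ivar, IExpr.eval] at hy'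
      omega
  · obtain ⟨-, r, hinv⟩ := h₁
    refine ⟨hinv.holds.of_frame (P := setRVar 1 (RExpr.arr 3 (var 51)))
      (Runs.frame (.setRVar 1 _ s₁)) rfl, ?_⟩
    simp [exec, Store.setR_rvar, RExpr.eval, IExpr.eval, hinv.A_eq]
  · obtain ⟨-, r, hinv⟩ := h₁
    have hq : (1 : ℤ) ≤ 2 ^ r := one_le_pow₀ (by norm_num)
    have := hinv.lo_nonneg
    have := hinv.length
    exact (hbd _ (by omega) hinv.hi_lt).1
  · intro s₃ h₃
    obtain ⟨hb, r, hinv⟩ := h₁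
    have hq : (1 : ℤ) ≤ 2 ^ r := one_le_pow₀ (by norm_num)
    have h0 := hinv.lo_nonneg
    have hlen := hinv.length
    simp only [BExpr.eval, IExpr.eval, not_not] at hb
    refine ⟨_, h₃, (h₃.iff (hbd _ (by omega) hinv.hi_lt).2).2 hinv.good, fun x hx hxm hgood => ?_⟩
    refine hmono _ _ (by omega) ?_ hxm
    by_contra hlt
    exact hinv.bad x hx (by omega) hgood
  · simp only [Program.steps, IExpr.cost, RExpr.cost]
    omega
  · simp only [Program.steps, IExpr.cost, BExpr.cost]
    have h1 : 1 ≤ I.N.toNat := by omega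
    have h2 : 1 ≤ I.n.toNat := by omega
    have h3 : 1 ≤ I.n.toNat * I.N.toNat := Nat.mul_pos h2 h1
    set X := I.n.toNat * I.N.toNat
    nlinarith [Nat.zero_le (X * m), Nat.zero_le (K * X * m), Nat.mul_le_mul_right m h3]

/-- Reconstruct the rounding from the recorded choices and output it. -/
def outputProgram : Program :=
  .seq
    (.seq (.setIArr 14 (.const 0) (.const 2))
      (.setIArr 15 (.const 0) (.sub (.var 27) (.const 1))))
    (.forTo 53 (.const 1) (.var 0)
      (.seq (.setIVar 54 (.arr 4 (.var 53)))
        (.seq (.setIVar 55 (.add (.arr 9 (.add (five (.add (.var 0) (.var 53)))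
            (.arr 14 (.var 54)))) (.arr 15 (.var 54))))
          (.seq (.setIArr 14 (.var 53) (.arr 12 (.var 55)))
            (.seq (.setIArr 15 (.var 53) (.arr 11 (.var 55)))
              (.seq (.setIArr 15 (.var 54) (.arr 10 (.var 55)))
                (.setIArr 2 (.arr 5 (.var 53))
                  (.sub (.arr 6 (.add (five (.var 53)) (.arr 14 (.var 53))))
                    (.arr 6 (.add (five (.var 54)) (.arr 14 (.var 54))))))))))))

/-- The loop replays `Folds.feasible_succ` on the arrays 14 (states) and 15 (bounds). The state of a
vertex is final once set, so the differences already written remain correct; `hinj` prevents the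
weight of one edge from overwriting that of another. -/
theorem outputProgram_ends : ∃ K : ℕ, ∀ (I : Levels) (ε : ℝ) (s : Store), Holds I s →
    Decided I ε s → -50 < s.rvar 9 →
    (∀ i j, 1 ≤ i → i < I.n → 1 ≤ j → j < I.n → s.iarr 5 i = s.iarr 5 j → i = j) →
    Ends outputProgram s (K * I.n.toNat) (fun s' => ∃ y, I.IsGood ε y ∧
      ∀ i, 1 ≤ i → i < I.n → s'.iarr 2 (s.iarr 5 i) = y i - y (I.par i)) := by
  refine ⟨200, fun I ε s hh ⟨F, hch, h9⟩ hF hinj => ?_⟩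
  have hN := I.N_pos
  have hn := I.n_pos
  rw [h9] at hF
  refine Ends.of_le (Ends.seq_frame (R := fun s' => s'.iarr 14 0 = 2 ∧ s'.iarr 15 0 = I.N - 1)
    (Ends.of_exec rfl ?_) (fun s₁ hf₁ h₁ => (Ends.forTo_frame (M := I.n) (z := 1) (c := 100) rfl
      (fun s' => 1 ≤ s'.ivar 53 ∧ s'.ivar 53 ≤ I.n ∧
        I.Feasible ε (s'.ivar 53) (F (s'.ivar 53)) (s'.iarr 14) (s'.iarr 15) ∧
        ∀ i, 1 ≤ i → i < s'.ivar 53 → s'.iarr 2 (s.iarr 5 i) =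
          I.x (5 * i + s'.iarr 14 i) - I.x (5 * I.par i + s'.iarr 14 (I.par i))) rfl ?_
      (fun s' hf _ => ?_) ?_).mono le_rfl ?_)) ?_
  · simp [exec, Store.setIA_iarr, IExpr.eval, hh.N]
  · simp only [Store.setI_ivar, if_true, Store.setI_iarr]
    exact ⟨le_rfl, hn, Levels.feasible_one h₁.1 h₁.2 hF, fun i h1 h2 => by omega⟩
  · exact ((hh.of_frame hf₁ rfl).of_frame hf rfl).n
  · rintro s₂ hf₂ ⟨h53, -, hfeas, hout⟩ hlt
    have hh₂ := (hh.of_frame hf₁ rfl).of_frame hf₂ rfl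
    obtain ⟨i, hi⟩ : ∃ i, i = s₂.ivar 53 := ⟨_, rfl⟩
    rw [← hi] at hfeas hout h53 hlt ⊢
    have hv0 := I.par_nonneg i h53 hlt
    have hvi := I.par_lt i h53 hlt
    have k5 : s₂.iarr 5 = s.iarr 5 := by rw [hf₂.iarr rfl, hf₁.iarr rfl]
    have k10 : s₂.iarr 10 = s.iarr 10 := by rw [hf₂.iarr rfl, hf₁.iarr rfl]
    have k11 : s₂.iarr 11 = s.iarr 11 := by rw [hf₂.iarr rfl, hf₁.iarr rfl]
    have k12 : s₂.iarr 12 = s.iarr 12 := by rw [hf₂.iarr rfl, hf₁.iarr rfl]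
    have hnext := (hch.fold i h53 hlt).feasible_succ h53 hlt hfeas
    have K0 := hfeas.K_nonneg _ hv0 hvi
    have K5 := hfeas.K_lt _ hv0 hvi
    have off : s₂.iarr 9 (5 * (I.n + i) + s₂.iarr 14 (I.par i)) =
        (5 * (I.n + i) + s₂.iarr 14 (I.par i)) * I.N := hh₂.off _ (by omega) (by omega)
    have hne : I.par i ≠ i := by omega
    refine Ends.of_le (Ends.of_exec rfl ?_) (c := _) ?_
    · intro _
      simp only [exec, IExpr.eval, IExpr.eval_five, Store.setI_ivar, Store.setIA_iarr, if_true,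
        Nat.reduceEqDiff, if_false, Store.setI_iarr, Store.setIA_ivar, ← hi, hh₂.par, hh₂.n, off,
        k5, k10, k11, k12, hh₂.x, Function.update_self]
      refine ⟨by omega, by omega, ?_, ?_⟩
      · exact hnext
      · intro j hj hji
        rcases (show j = i ∨ j < i by omega) with rfl | hji'
        · simp
        · have hjp := I.par_lt j hj (by omega)
          have : s.iarr 5 j ≠ s.iarr 5 i := fun h =>
            absurd (hinj j i hj (by omega) h53 hlt h) (by omega)
          rw [Function.update_of_ne this, Function.update_of_ne (by omega),
            Function.update_of_ne (by omega)]
          exact hout j hj hji'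
    · simp only [Program.steps, IExpr.cost, IExpr.five]
      omega
  · rintro s₂ ⟨h1, h2, h3, hfeas, hout⟩
    rw [show s₂.ivar 53 = I.n by omega] at hfeas hout
    exact ⟨_, (hfeas.congr fun v k p h1 h2 h3 h4 h5 h6 =>
      (hch.init v k p h1 h2 h3 h4 h5 h6).symm).isGood, hout⟩
  · simp only [Program.steps, IExpr.cost]
    omega

end RealRAM

/-! ### Numbering the vertices -/

/-- The first `c` vertices in the order of a traversal of the graph with vertices `0, …, n - 1` and
edges `A j, B j`, `0 ≤ j < n - 1`: `pos` gives the positions of the vertices (`-1` if they have not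
been reached), `par` the positions of the parents and `idx` the edges to the parents. -/
structure Traversal (n : ℤ) (A B : ℤ → ℤ) (c : ℤ) (pos par idx : ℤ → ℤ) : Prop where
  c_pos : 1 ≤ c
  pos_lt : ∀ v, 0 ≤ v → v < n → pos v = -1 ∨ 0 ≤ pos v ∧ pos v < c
  inj : ∀ u v, 0 ≤ u → u < n → 0 ≤ v → v < n → pos u = pos v → 0 ≤ pos u → u = v
  surj : ∀ i, 0 ≤ i → i < c → ∃ v, 0 ≤ v ∧ v < n ∧ pos v = i
  par_nonneg : ∀ i, 1 ≤ i → i < c → 0 ≤ par i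
  par_lt : ∀ i, 1 ≤ i → i < c → par i < i
  idx_nonneg : ∀ i, 1 ≤ i → i < c → 0 ≤ idx i
  idx_lt : ∀ i, 1 ≤ i → i < c → idx i < n - 1
  edge : ∀ i, 1 ≤ i → i < c → pos (A (idx i)) = i ∧ pos (B (idx i)) = par i ∨
    pos (A (idx i)) = par i ∧ pos (B (idx i)) = i

/-- The graph on `0, …, n - 1` with edges `A j, B j`, `0 ≤ j < n - 1`, is connected. -/
structure ConnectedList (n : ℤ) (A B : ℤ → ℤ) : Prop where
  n_pos : 1 ≤ n
  left_mem : ∀ j, 0 ≤ j → j < n - 1 → 0 ≤ A j ∧ A j < n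
  right_mem : ∀ j, 0 ≤ j → j < n - 1 → 0 ≤ B j ∧ B j < n
  connected : ∀ P : ℤ → Prop, (∀ j, 0 ≤ j → j < n - 1 → (P (A j) ↔ P (B j))) →
    ∀ u v, 0 ≤ u → u < n → 0 ≤ v → v < n → P u → P v

namespace Traversal

variable {n c : ℤ} {A B pos par idx : ℤ → ℤ}

theorem le (h : Traversal n A B c pos par idx) : c ≤ n := by
  have hex : ∀ i, ∃ v, 0 ≤ i → i < c → 0 ≤ v ∧ v < n ∧ pos v = i := by
    intro i
    by_cases hi : 0 ≤ i ∧ i < c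
    · obtain ⟨v, hv⟩ := h.surj i hi.1 hi.2
      exact ⟨v, fun _ _ => hv⟩
    · exact ⟨0, fun h1 h2 => absurd ⟨h1, h2⟩ hi⟩
  choose f hf using hex
  have := Finset.card_le_card_of_injOn (s := Finset.Ico 0 c) (t := Finset.Ico 0 n) f
    (fun i hi => by
      rw [Finset.mem_coe, Finset.mem_Ico] at hi ⊢
      have := hf i hi.1 hi.2
      omega)
    (fun i hi j hj hij => by
      rw [Finset.mem_coe, Finset.mem_Ico] at hi hj
      rw [← (hf i hi.1 hi.2).2.2, ← (hf j hj.1 hj.2).2.2, hij])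
  simp only [Int.card_Ico, sub_zero] at this
  have := h.c_pos
  omega

theorem le_of_forall (h : Traversal n A B c pos par idx)
    (hall : ∀ v, 0 ≤ v → v < n → pos v ≠ -1) : n ≤ c := by
  have hp : ∀ v, 0 ≤ v → v < n → 0 ≤ pos v ∧ pos v < c := fun v h1 h2 =>
    (h.pos_lt v h1 h2).resolve_left (hall v h1 h2)
  have := Finset.card_le_card_of_injOn (s := Finset.Ico 0 n) (t := Finset.Ico 0 c) pos
    (fun i hi => by
      rw [Finset.mem_coe, Finset.mem_Ico] at hi ⊢
      exact hp i hi.1 hi.2)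
    (fun i hi j hj hij => by
      rw [Finset.mem_coe, Finset.mem_Ico] at hi hj
      exact h.inj i j hi.1 hi.2 hj.1 hj.2 hij (hp i hi.1 hi.2).1)
  simp only [Int.card_Ico, sub_zero] at this
  have := h.c_pos
  omega

/-- If no edge joins a reached vertex to an unreached one, being reached is constant along edges.
Connectedness then spreads it from the vertex at position 0 to all vertices. -/
theorem eq_of_forall (h : Traversal n A B c pos par idx) (hG : ConnectedList n A B)
    (hall : ∀ j, 0 ≤ j → j < n - 1 → (0 ≤ pos (A j) ↔ 0 ≤ pos (B j))) : c = n := by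
  refine le_antisymm h.le (h.le_of_forall fun v hv hvn => ?_)
  obtain ⟨u, hu, hun, hu0⟩ := h.surj 0 le_rfl (by have := h.c_pos; omega)
  have := hG.connected (fun v => 0 ≤ pos v) hall u v hu hun hv hvn (by omega)
  omega

/-- If v were unreached, the n positions would inject into the n - 1 other vertices. -/
theorem pos_bounds (h : Traversal n A B n pos par idx) {v : ℤ} (hv : 0 ≤ v) (hvn : v < n) :
    0 ≤ pos v ∧ pos v < n := by
  refine (h.pos_lt v hv hvn).resolve_left fun hv1 => ?_
  have hex : ∀ i, ∃ u, 0 ≤ i → i < n → 0 ≤ u ∧ u < n ∧ pos u = i := by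
    intro i
    by_cases hi : 0 ≤ i ∧ i < n
    · obtain ⟨v, hv⟩ := h.surj i hi.1 hi.2
      exact ⟨v, fun _ _ => hv⟩
    · exact ⟨0, fun h1 h2 => absurd ⟨h1, h2⟩ hi⟩
  choose f hf using hex
  have := Finset.card_le_card_of_injOn (s := Finset.Ico 0 n) (t := (Finset.Ico 0 n).erase v) f
    (fun i hi => by
      rw [Finset.mem_coe, Finset.mem_Ico] at hi
      have := hf i hi.1 hi.2
      rw [Finset.mem_coe, Finset.mem_erase, Finset.mem_Ico]
      refine ⟨?_, by omega, by omega⟩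
      intro hfv
      rw [hfv] at this
      omega)
    (fun i hi j hj hij => by
      rw [Finset.mem_coe, Finset.mem_Ico] at hi hj
      rw [← (hf i hi.1 hi.2).2.2, ← (hf j hj.1 hj.2).2.2, hij])
  rw [Finset.card_erase_of_mem (by rw [Finset.mem_Ico]; exact ⟨hv, hvn⟩)] at this
  simp only [Int.card_Ico, sub_zero] at this
  omega

/-- The endpoints of the edge `idx i` have positions i and `par i` < i, so the edge determines i as
the larger of the two. -/
theorem idx_inj (h : Traversal n A B c pos par idx) {i j : ℤ} (hi : 1 ≤ i) (hic : i < c)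
    (hj : 1 ≤ j) (hjc : j < c) (hij : idx i = idx j) : i = j := by
  have h1 := h.edge i hi hic
  have h2 := h.edge j hj hjc
  have h3 := h.par_lt i hi hic
  have h4 := h.par_lt j hj hjc
  rw [hij] at h1
  omega

/-- Append the endpoint `y` of the edge `e` whose other endpoint `x` has already been reached. -/
theorem append (h : Traversal n A B c pos par idx) {e x y : ℤ} (he : 0 ≤ e) (hen : e < n - 1)
    (hx : 0 ≤ x) (hxn : x < n) (hy : 0 ≤ y) (hyn : y < n)
    (hxy : A e = x ∧ B e = y ∨ A e = y ∧ B e = x) (hpx : 0 ≤ pos x) (hpy : ¬ 0 ≤ pos y) :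
    Traversal n A B (c + 1) (Function.update pos y c) (Function.update par c (pos x))
      (Function.update idx c e) := by
  have hpxc : pos x < c := by have := h.pos_lt x hx hxn; omega
  have hne : x ≠ y := by rintro rfl; exact hpy hpx
  have c1 := h.c_pos
  have old : ∀ v, 0 ≤ pos v → Function.update pos y c v = pos v := by
    intro v hv
    rw [Function.update_of_ne]
    rintro rfl
    exact hpy hv
  refine ⟨by omega, ?_, ?_, ?_, ?_, ?_, ?_, ?_, ?_⟩
  · intro v hv hvn
    rw [Function.update_apply]
    split_ifs
    · omega
    · have := h.pos_lt v hv hvn; omega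
  · intro u v hu hun hv hvn
    have h1 := h.pos_lt u hu hun
    have h2 := h.pos_lt v hv hvn
    rw [Function.update_apply, Function.update_apply]
    split_ifs with h3 h4 h4
    · intro _ _; rw [h3, h4]
    · omega
    · omega
    · exact h.inj u v hu hun hv hvn
  · intro i hi hic
    rcases (show i = c ∨ i < c by omega) with rfl | hic'
    · exact ⟨y, hy, hyn, Function.update_self _ _ _⟩
    · obtain ⟨v, hv, hvn, hvi⟩ := h.surj i hi hic'
      exact ⟨v, hv, hvn, by rw [old v (by omega), hvi]⟩
  all_goals
    intro i hi hic
    rcases (show i = c ∨ i < c by omega) with rfl | hic'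
  · rw [Function.update_self]; exact hpx
  · rw [Function.update_of_ne (by omega)]; exact h.par_nonneg i hi hic'
  · rw [Function.update_self]; exact hpxc
  · rw [Function.update_of_ne (by omega)]; exact h.par_lt i hi hic'
  · rw [Function.update_self]; exact he
  · rw [Function.update_of_ne (by omega)]; exact h.idx_nonneg i hi hic'
  · rw [Function.update_self]; exact hen
  · rw [Function.update_of_ne (by omega)]; exact h.idx_lt i hi hic'
  · rw [Function.update_self, Function.update_self]
    rcases hxy with ⟨h1, h2⟩ | ⟨h1, h2⟩
    · right; rw [h1, h2, Function.update_self, old x hpx]; exact ⟨rfl, rfl⟩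
    · left; rw [h1, h2, Function.update_self, old x hpx]; exact ⟨rfl, rfl⟩
  · rw [Function.update_of_ne (show i ≠ c by omega) e idx,
      Function.update_of_ne (show i ≠ c by omega) (pos x) par]
    have h1 := h.edge i hi hic'
    have h2 := h.par_nonneg i hi hic'
    rw [old _ (by omega), old _ (by omega)]
    exact h1

end Traversal

-- Programs that number the vertices

namespace RealRAM
open IExpr BExpr Program

/-- Append the endpoint of edge `ivar 63` in array `a`; the integer variable `x` holds the position
of its parent. -/
def appendVertex (a x : ℕ) : Program :=
  .seq (.setIArr 4 (.var 61) (.var x))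
    (.seq (.setIArr 5 (.var 61) (.var 63))
      (.seq (.setIArr 3 (.arr a (.var 63)) (.var 61))
        (.setIVar 61 (.add (.var 61) (.const 1)))))

/-- Append an endpoint of edge `ivar 63` if exactly the other one has been reached. -/
def scanEdge : Program :=
  .seq
    (.seq (.setIVar 64 (.arr 3 (.arr 0 (.var 63)))) (.setIVar 65 (.arr 3 (.arr 1 (.var 63)))))
    (.branch (.and (.ile (.const 0) (.var 64)) (.not (.ile (.const 0) (.var 65))))
      (appendVertex 1 64)
      (.branch (.and (.ile (.const 0) (.var 65)) (.not (.ile (.const 0) (.var 64))))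
        (appendVertex 0 65)
        .skip))

/-- Number the vertices such that every vertex but the first is adjacent to an earlier one. -/
def orderProgram : Program :=
  .seq (.forTo 60 (.const 0) (.var 0) (.setIArr 3 (.var 60) (.const (-1))))
    (.seq (.seq (.setIArr 3 (.const 0) (.const 0)) (.setIVar 61 (.const 1)))
      (.forTo 62 (.const 0) (.var 0)
        (.forTo 63 (.const 0) (.sub (.var 0) (.const 1)) scanEdge)))

theorem scanEdge_ends {n c : ℤ} {A B pos par idx : ℤ → ℤ} {s : Store}
    (hG : ConnectedList n A B) (h0 : s.iarr 0 = A) (h1 : s.iarr 1 = B) (h61 : s.ivar 61 = c)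
    (h3 : s.iarr 3 = pos) (h4 : s.iarr 4 = par) (h5 : s.iarr 5 = idx) {e : ℤ} (h63 : s.ivar 63 = e)
    (he : 0 ≤ e) (hen : e < n - 1)
    (h : Traversal n A B c pos par idx) :
    Ends scanEdge s scanEdge.steps (fun s' =>
      Traversal n A B (s'.ivar 61) (s'.iarr 3) (s'.iarr 4) (s'.iarr 5) ∧
        (s'.ivar 61 = c + 1 ∨ s'.ivar 61 = c ∧ s'.iarr 3 = pos ∧
          (0 ≤ pos (A e) ↔ 0 ≤ pos (B e)))) := by
  have hA := hG.left_mem e he hen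
  have hB := hG.right_mem e he hen
  refine Ends.seq_frame (R := fun s' => s'.ivar 64 = pos (A e) ∧ s'.ivar 65 = pos (B e))
    (Ends.of_exec rfl ?_) (fun s₁ hf₁ h₁ => ?_)
  · simp [exec, IExpr.eval, Store.setI_ivar, h3, h0, h1, h63]
  · have k0 : s₁.iarr 0 = A := by rw [hf₁.iarr rfl, h0]
    have k1 : s₁.iarr 1 = B := by rw [hf₁.iarr rfl, h1]
    have k3 : s₁.iarr 3 = pos := by rw [hf₁.iarr rfl, h3]
    have k4 : s₁.iarr 4 = par := by rw [hf₁.iarr rfl, h4]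
    have k5 : s₁.iarr 5 = idx := by rw [hf₁.iarr rfl, h5]
    have k61 : s₁.ivar 61 = c := by rw [hf₁.ivar rfl, h61]
    have k63 : s₁.ivar 63 = e := by rw [hf₁.ivar rfl, h63]
    refine Ends.branch (fun hb => Ends.of_exec rfl ?_) (fun hb => Ends.branch
      (fun hb' => Ends.of_exec rfl ?_) (fun hb' => Ends.of_exec rfl ?_))
    · simp only [BExpr.eval, IExpr.eval, h₁.1, h₁.2] at hb
      simp only [appendVertex, exec, IExpr.eval, Store.setI_ivar, Store.setIA_iarr, if_true,
        Nat.reduceEqDiff, if_false, Store.setI_iarr, Store.setIA_ivar, k1, k3, k4, k5, k61, k63,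
        h₁.1, OfNat.one_ne_ofNat]
      exact ⟨h.append he hen hA.1 hA.2 hB.1 hB.2 (Or.inl ⟨rfl, rfl⟩) hb.1 hb.2, Or.inl trivial⟩
    · simp only [BExpr.eval, IExpr.eval, h₁.1, h₁.2] at hb'
      simp only [appendVertex, exec, IExpr.eval, Store.setI_ivar, Store.setIA_iarr, if_true,
        Nat.reduceEqDiff, if_false, Store.setI_iarr, Store.setIA_ivar, k0, k3, k4, k5, k61, k63,
        h₁.2, OfNat.zero_ne_ofNat]
      exact ⟨h.append he hen hB.1 hB.2 hA.1 hA.2 (Or.inr ⟨rfl, rfl⟩) hb'.1 hb'.2,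
        Or.inl trivial⟩
    · simp only [BExpr.eval, IExpr.eval, h₁.1, h₁.2] at hb hb'
      simp only [exec, k3, k4, k5, k61]
      exact ⟨h, Or.inr ⟨trivial, trivial, by tauto⟩⟩

/-- A complete scan of the edges reaches a new vertex unless all have been reached. After t scans at
least t + 1 vertices are numbered or all n are, so n scans of n - 1 edges suffice; the quadratic
cost is affordable. -/
theorem orderProgram_ends : ∃ K : ℕ, ∀ (n : ℤ) (s : Store), s.ivar 0 = n →
    ConnectedList n (s.iarr 0) (s.iarr 1) →
    Ends orderProgram s (K * (n.toNat * n.toNat)) (fun s' =>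
      Traversal n (s.iarr 0) (s.iarr 1) n (s'.iarr 3) (s'.iarr 4) (s'.iarr 5)) := by
  refine ⟨2 * scanEdge.steps + 200, fun n s h0 hG => ?_⟩
  have hn := hG.n_pos
  refine Ends.of_le (Ends.seq_frame (Ends.forTo_frame (M := n) (z := 0) (c := 10) rfl
    (fun s' => 0 ≤ s'.ivar 60 ∧ ∀ v, 0 ≤ v → v < s'.ivar 60 → s'.iarr 3 v = -1) rfl ?_
    (fun s' hf _ => ?_) ?_) (fun s₁ hf₁ h₁ => Ends.seq_frame
    (R := fun s' => s'.ivar 61 = 1 ∧ s'.iarr 3 = Function.update (s₁.iarr 3) 0 0)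
    (Ends.of_exec rfl ?_) (fun s₂ hf₂ h₂ => (Ends.forTo_frame (M := n) (z := 0)
      (c := n.toNat * (scanEdge.steps + 20)) rfl (fun s' => 0 ≤ s'.ivar 62 ∧
        Traversal n (s.iarr 0) (s.iarr 1) (s'.ivar 61) (s'.iarr 3) (s'.iarr 4) (s'.iarr 5) ∧
        (s'.ivar 61 = n ∨ s'.ivar 62 + 1 ≤ s'.ivar 61)) rfl ?_
    (fun s' hf _ => ?_) ?_).mono le_rfl ?_))) ?_
  · refine ⟨by simp [Store.setI_ivar], fun v hv hv' => ?_⟩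
    simp [Store.setI_ivar] at hv'
    omega
  · exact (hf.ivar rfl).trans h0
  · rintro s₁ - ⟨k0, kv⟩ hlt
    refine (Ends.of_exec rfl ?_).of_le (by simp [Program.steps, IExpr.cost])
    intro _
    simp only [exec, Store.setI_ivar, if_true, Store.setIA_iarr, Store.setI_iarr, IExpr.eval]
    refine ⟨by omega, fun v hv hv' => ?_⟩
    rw [Function.update_apply]
    split_ifs with hc
    · rfl
    · exact kv v hv (by omega)
  · simp [exec, Store.setI_ivar, Store.setIA_iarr, IExpr.eval]
  · simp only [Store.setI_ivar, if_true, Nat.reduceEqDiff, if_false, Store.setI_iarr, h₂.1, h₂.2]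
    refine ⟨le_rfl, ⟨le_rfl, ?_, ?_, ?_, ?_, ?_, ?_, ?_, ?_⟩, Or.inr le_rfl⟩
    · intro v hv hvn
      rw [Function.update_apply]
      split_ifs
      · omega
      · exact Or.inl (h₁.2.2 v hv (by omega))
    · intro u v hu hun hv hvn
      have e1 := h₁.2.2 u hu (by omega)
      have e2 := h₁.2.2 v hv (by omega)
      rw [Function.update_apply, Function.update_apply]
      split_ifs <;> omega
    · intro i hi hi1
      exact ⟨0, le_rfl, by omega, by rw [Function.update_self]; omega⟩
    all_goals
      intro i hi hi1
      omega
  · exact ((hf.ivar rfl).trans ((hf₂.ivar rfl).trans (hf₁.ivar rfl))).trans h0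
  · rintro s₃ hf₃ ⟨k62, htr, hprog⟩ hlt
    have l0 : s₃.iarr 0 = s.iarr 0 := by rw [hf₃.iarr rfl, hf₂.iarr rfl, hf₁.iarr rfl]
    have l1 : s₃.iarr 1 = s.iarr 1 := by rw [hf₃.iarr rfl, hf₂.iarr rfl, hf₁.iarr rfl]
    have ln : s₃.ivar 0 = n := by rw [hf₃.ivar rfl, hf₂.ivar rfl, hf₁.ivar rfl, h0]
    refine Ends.mono (Ends.forTo_frame (M := n - 1) (z := 0) (c := scanEdge.steps) rfl
      (fun s' => 0 ≤ s'.ivar 63 ∧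
        Traversal n (s.iarr 0) (s.iarr 1) (s'.ivar 61) (s'.iarr 3) (s'.iarr 4) (s'.iarr 5) ∧
        (s₃.ivar 61 < s'.ivar 61 ∨ s₃.ivar 61 = s'.ivar 61 ∧ ∀ j, 0 ≤ j → j < s'.ivar 63 →
          (0 ≤ s'.iarr 3 (s.iarr 0 j) ↔ 0 ≤ s'.iarr 3 (s.iarr 1 j)))) rfl ?_
      (fun s' hf _ => ?_) ?_) ?_ ?_
    · refine ⟨by simp [Store.setI_ivar], htr, Or.inr ⟨rfl, fun j hj hj' => ?_⟩⟩
      simp [Store.setI_ivar] at hj'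
      omega
    · simp only [IExpr.eval, hf.ivar (x := 0) rfl, ln]
    · rintro s₄ hf₄ ⟨m63, mtr, mpr⟩ mlt
      refine (scanEdge_ends hG (by rw [hf₄.iarr rfl, l0]) (by rw [hf₄.iarr rfl, l1]) rfl rfl rfl rfl
        rfl m63 mlt mtr).mono le_rfl ?_
      rintro s₅ ⟨ntr, ncase⟩ -
      simp only [Store.setI_ivar, if_true, Nat.reduceEqDiff, if_false, Store.setI_iarr]
      refine ⟨by omega, ntr, ?_⟩
      rcases ncase with hc | ⟨hc, hpos, hiff⟩
      · left
        rcases mpr with h | h <;> omega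
      · rcases mpr with h | ⟨h, hj⟩
        · left; omega
        · right
          refine ⟨by omega, fun j hj0 hj' => ?_⟩
          rw [hpos]
          rcases (show j = s₄.ivar 63 ∨ j < s₄.ivar 63 by omega) with rfl | hj''
          · exact hiff
          · exact hj j hj0 hj''
    · simp only [IExpr.cost]
      rw [show (n - 1 - 0).toNat + 1 = n.toNat by omega]
      exact Nat.mul_le_mul_left _ (by omega)
    · rintro s₄ ⟨hN, m63, mtr, mpr⟩ -
      simp only [Store.setI_ivar, if_true, Nat.reduceEqDiff, if_false, Store.setI_iarr]
      refine ⟨by omega, mtr, ?_⟩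
      have hle := mtr.le
      rcases mpr with h | ⟨h, hj⟩
      · rcases hprog with hp | hp <;> omega
      · left
        -- A scan without progress has seen every edge with the same set of reached vertices and
        -- found no edge that leaves it.
        exact mtr.eq_of_forall hG fun j hj0 hj' => hj j hj0 (by omega)
  · rintro s₃ ⟨hN, k62, htr, hprog⟩
    have hle := htr.le
    rwa [show s₃.ivar 61 = n by omega] at htr
  · simp only [Program.steps, IExpr.cost, sub_zero]
    have h1 : 1 ≤ n.toNat := by omega
    set N := n.toNat
    set K := scanEdge.steps
    obtain ⟨q, hq⟩ : ∃ q, N = q + 1 := ⟨N - 1, by omega⟩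
    rw [hq]
    nlinarith [Nat.zero_le (K * q), Nat.zero_le (q * q), Nat.zero_le (K * (q * q))]

end RealRAM

-- Distances, candidate values and row offsets

namespace RealRAM
open IExpr BExpr Program

/-- Compute the distances from the root. -/
def distProgram : Program :=
  .seq (.setRArr 1 (.const 0) (.ofInt (.const 0)))
    (.forTo 70 (.const 1) (.var 0)
      (.setRArr 1 (.var 70) (.add (.arr 1 (.arr 4 (.var 70))) (.arr 0 (.arr 5 (.var 70))))))

theorem distProgram_ends : ∃ K : ℕ, ∀ (n : ℤ) (par : ℤ → ℤ) (s : Store), 1 ≤ n → s.ivar 0 = n →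
    s.iarr 4 = par → (∀ i, 1 ≤ i → i < n → 0 ≤ par i ∧ par i < i) →
    Ends distProgram s (K * n.toNat) (fun s' => s'.rarr 1 0 = 0 ∧
      ∀ i, 1 ≤ i → i < n → s'.rarr 1 i = s'.rarr 1 (par i) + s.rarr 0 (s.iarr 5 i)) := by
  refine ⟨100, fun n par s hn h0 h4 hpar => ?_⟩
  refine Ends.of_le (Ends.seq_frame (R := fun s' => s'.rarr 1 0 = 0) (Ends.of_exec rfl ?_)
    (fun s₁ hf₁ h₁ => (Ends.forTo_frame (M := n) (z := 1) (c := 20) rfl (fun s' => 1 ≤ s'.ivar 70 ∧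
      s'.rarr 1 0 = 0 ∧ ∀ i, 1 ≤ i → i < s'.ivar 70 →
        s'.rarr 1 i = s'.rarr 1 (par i) + s.rarr 0 (s.iarr 5 i)) rfl ?_
      (fun s' hf _ => ?_) ?_).mono le_rfl ?_)) ?_
  · simp [exec, Store.setRA_rarr, IExpr.eval, RExpr.eval]
  · refine ⟨by simp [Store.setI_ivar], h₁, fun i hi hi' => ?_⟩
    simp [Store.setI_ivar] at hi'
    omega
  · exact (hf.ivar rfl).trans ((hf₁.ivar rfl).trans h0)
  · rintro s₂ hf ⟨k70, k0, kd⟩ hlt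
    have l4 : s₂.iarr 4 = par := by rw [hf.iarr rfl, hf₁.iarr rfl, h4]
    have l5 : s₂.iarr 5 = s.iarr 5 := by rw [hf.iarr rfl, hf₁.iarr rfl]
    have l0 : s₂.rarr 0 = s.rarr 0 := by rw [hf.rarr rfl, hf₁.rarr rfl]
    refine (Ends.of_exec rfl ?_).of_le (by simp [Program.steps, IExpr.cost, RExpr.cost])
    intro _
    simp only [exec, Store.setI_ivar, if_true, Store.setI_rarr, Store.setRA_rarr, IExpr.eval,
      RExpr.eval, l4, l5, l0]
    have hp := hpar _ k70 hlt
    refine ⟨by omega, by rw [Function.update_of_ne (by omega), k0], fun i hi hi' => ?_⟩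
    rcases (show i = s₂.ivar 70 ∨ i < s₂.ivar 70 by omega) with rfl | hi''
    · rw [Function.update_self, Function.update_of_ne (by omega)]
    · have := hpar i hi (by omega)
      rw [Function.update_of_ne (by omega), Function.update_of_ne (by omega), kd i hi hi'']
  · rintro s₂ ⟨hN, -, k0, kd⟩
    exact ⟨k0, fun i hi hin => kd i hi (by omega)⟩
  · simp only [Program.steps, IExpr.cost, RExpr.cost]
    omega

/-- Compute the candidates for the rounded distances and the list of their errors. -/
def candidateProgram : Program :=
  .seq
    (.seq (.setIVar 71 (.const 0)) (.setRArr 3 (.const 0) (.ofInt (.const (-100)))))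
    (.seq
      (.forTo 70 (.const 0) (.var 0)
        (.forTo 72 (.const 0) (.const 5)
          (.seq (.setIArr 6 (.var 71)
              (.add (.floor (.arr 1 (.var 70))) (.sub (.var 72) (.const 2))))
            (.seq (.setRArr 2 (.var 71) (.sub (.ofInt (.arr 6 (.var 71))) (.arr 1 (.var 70))))
              (.seq (.setRArr 3 (.add (.var 71) (.const 1)) (.arr 2 (.var 71)))
                (.setIVar 71 (.add (.var 71) (.const 1))))))))
      (.seq (.setIVar 1 (.add (.var 71) (.const 1))) (.setRVar 0 (.ofInt (.const (-100))))))

/-- The first `t` candidates for the rounded distances and their errors have been computed. -/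
def CandidatesOK (d : ℤ → ℝ) (t : ℤ) (s : Store) : Prop :=
  s.rarr 3 0 = -100 ∧ ∀ v k, 0 ≤ v → 0 ≤ k → k < 5 → 5 * v + k < t →
    s.iarr 6 (5 * v + k) = ⌊d v⌋ + k - 2 ∧
    s.rarr 2 (5 * v + k) = s.iarr 6 (5 * v + k) - d v ∧
    s.rarr 3 (5 * v + k + 1) = s.rarr 2 (5 * v + k)

/-- Cell 0 of the list is reserved for the sentinel -100, which shifts the 5n errors by one. The
padding value for the subsequent sort is -100 as well, so padding introduces nothing smaller than
the sentinel. -/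
theorem candidateProgram_ends : ∃ K : ℕ, ∀ (n : ℤ) (s : Store), 1 ≤ n → s.ivar 0 = n →
    Ends candidateProgram s (K * n.toNat) (fun s' => s'.ivar 1 = 5 * n + 1 ∧ s'.rvar 0 = -100 ∧
      CandidatesOK (s.rarr 1) (5 * n) s') := by
  refine ⟨1000, fun n s hn h0 => ?_⟩
  refine Ends.of_le (Ends.seq_frame (R := fun s' => s'.ivar 71 = 0 ∧ s'.rarr 3 0 = -100)
    (Ends.of_exec rfl ?_) (fun s₁ hf₁ h₁ => Ends.seq_frame (Ends.forTo_frame (M := n) (z := 0)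
      (c := 400) rfl (fun s' => 0 ≤ s'.ivar 70 ∧ s'.ivar 70 ≤ n ∧ s'.ivar 71 = 5 * s'.ivar 70 ∧
        CandidatesOK (s.rarr 1) (5 * s'.ivar 70) s') rfl ?_ (fun s' hf _ => ?_) ?_)
      (fun s₂ hf₂ h₂ => Ends.of_exec rfl ?_))) ?_
  · simp [exec, Store.setI_ivar, Store.setRA_rarr, IExpr.eval, RExpr.eval]
  · simp only [Store.setI_ivar, if_true, Nat.reduceEqDiff, if_false]
    exact ⟨le_rfl, by omega, h₁.1, h₁.2, fun v k _ _ _ _ => by omega⟩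
  · exact (hf.ivar rfl).trans ((hf₁.ivar rfl).trans h0)
  · rintro s₂ hf ⟨k70, -, k71, kc⟩ hlt
    have l1 : s₂.rarr 1 = s.rarr 1 := by rw [hf.rarr rfl, hf₁.rarr rfl]
    refine (Ends.forTo_frame (M := 5) (z := 0) (c := 40) rfl (fun s' => 0 ≤ s'.ivar 72 ∧
      s'.ivar 72 ≤ 5 ∧ s'.ivar 71 = 5 * s₂.ivar 70 + s'.ivar 72 ∧
      CandidatesOK (s.rarr 1) (5 * s₂.ivar 70 + s'.ivar 72) s') rfl ?_ (fun s' hf _ => rfl)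
        ?_).mono (by simp [IExpr.cost]) ?_
    · simp only [Store.setI_ivar, if_true, Nat.reduceEqDiff, if_false, add_zero]
      exact ⟨le_rfl, by norm_num, k71, kc⟩
    · rintro s₃ hf₃ ⟨m72, -, m71, m3, mc⟩ mlt
      have l1' : s₃.rarr 1 = s.rarr 1 := by rw [hf₃.rarr rfl, l1]
      have l70 : s₃.ivar 70 = s₂.ivar 70 := hf₃.ivar rfl
      refine (Ends.of_exec rfl ?_).of_le (by simp [Program.steps, IExpr.cost, RExpr.cost])
      intro _
      simp only [CandidatesOK, exec, Store.setI_ivar, if_true, Store.setI_rarr, Store.setRA_rarr,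
        IExpr.eval, RExpr.eval, Nat.reduceEqDiff, if_false, Store.setI_iarr, Store.setIA_iarr,
        Store.setRA_iarr, Store.setRA_ivar, Store.setIA_ivar, Store.setIA_rarr, l1', l70, m71,
        Function.update_self]
      refine ⟨by omega, by omega, by omega, ?_, fun v k hv hk hk5 hvk => ?_⟩
      · rw [Function.update_of_ne (by omega), m3]
      · rcases (show (v = s₂.ivar 70 ∧ k = s₃.ivar 72) ∨
          5 * v + k < 5 * s₂.ivar 70 + s₃.ivar 72 by omega) with ⟨rfl, rfl⟩ | hlt'
        · simp only [Function.update_self]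
          exact ⟨by ring, trivial, trivial⟩
        · rw [Function.update_of_ne (by omega), Function.update_of_ne (by omega),
            Function.update_of_ne (by omega)]
          exact mc v k hv hk hk5 hlt'
    · rintro s₃ ⟨m5, m72, m72', m71, mc⟩ -
      have e : 5 * s₂.ivar 70 + s₃.ivar 72 = 5 * (s₂.ivar 70 + 1) := by omega
      rw [e] at m71 mc
      simp only [Store.setI_ivar, if_true, Nat.reduceEqDiff, if_false]
      exact ⟨by omega, by omega, m71, mc⟩
  · obtain ⟨hN, k70, k70', k71, kc⟩ := h₂
    rw [show s₂.ivar 70 = n by omega] at k71 kc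
    refine ⟨?_, ?_, kc⟩
    · simp [exec, Store.setI_ivar, IExpr.eval, k71]
    · simp [exec, Store.setR_rvar, IExpr.eval, RExpr.eval]
  · simp only [Program.steps, IExpr.cost, RExpr.cost]
    omega

/-- Copy the sorted list of errors. -/
def copyProgram : Program :=
  .seq (.setIVar 27 (.var 20))
    (.forTo 73 (.const 0) (.var 27) (.setRArr 5 (.var 73) (.arr 3 (.var 73))))

theorem copyProgram_ends : ∃ K : ℕ, ∀ (N : ℤ) (s : Store), 1 ≤ N → s.ivar 20 = N →
    Ends copyProgram s (K * N.toNat) (fun s' => s'.ivar 27 = N ∧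
      ∀ p, 0 ≤ p → p < N → s'.rarr 5 p = s.rarr 3 p) := by
  refine ⟨100, fun N s hN h20 => ?_⟩
  refine Ends.of_le (Ends.seq_frame (R := fun s' => s'.ivar 27 = N) (Ends.of_exec rfl ?_)
    (fun s₁ hf₁ h₁ => (Ends.forTo_frame (M := N) (z := 0) (c := 20) rfl (fun s' => 0 ≤ s'.ivar 73 ∧
      ∀ p, 0 ≤ p → p < s'.ivar 73 → s'.rarr 5 p = s.rarr 3 p) rfl ?_
      (fun s' hf _ => ?_) ?_).frame.mono le_rfl ?_)) ?_
  · simp [exec, Store.setI_ivar, IExpr.eval, h20]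
  · refine ⟨by simp [Store.setI_ivar], fun i hi hi' => ?_⟩
    simp [Store.setI_ivar] at hi'
    omega
  · exact (hf.ivar rfl).trans h₁
  · rintro s₂ hf ⟨k0, kp⟩ hlt
    have l3 : s₂.rarr 3 = s.rarr 3 := by rw [hf.rarr rfl, hf₁.rarr rfl]
    refine (Ends.of_exec rfl ?_).of_le (by simp [Program.steps, IExpr.cost, RExpr.cost])
    intro _
    simp only [exec, Store.setI_ivar, if_true, Store.setI_rarr, Store.setRA_rarr, IExpr.eval,
      RExpr.eval, l3]
    refine ⟨by omega, fun p hp hp' => ?_⟩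
    rcases (show p = s₂.ivar 73 ∨ p < s₂.ivar 73 by omega) with rfl | hi''
    · rw [Function.update_self]
    · rw [Function.update_of_ne (by omega), kp p hp hi'']
  · rintro s₂ ⟨hf₂, hN, -, kd⟩
    exact ⟨by rw [hf₂.ivar rfl, h₁], fun i hi hin => kd i hi (by omega)⟩
  · simp only [Program.steps, IExpr.cost]
    omega

/-- Compute the multiples of the length of a table row. -/
def offsetProgram : Program :=
  .seq (.setIVar 74 (.const 0))
    (.forTo 75 (.const 0) (five (.add (.var 0) (.var 0)))
      (.seq (.setIArr 9 (.var 75) (.var 74)) (.setIVar 74 (.add (.var 74) (.var 27)))))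

/-- There are 10n rows: five states in each of the 2n slots. Their offsets are obtained by repeated
addition. -/
theorem offsetProgram_ends : ∃ K : ℕ, ∀ (n N : ℤ) (s : Store), 1 ≤ n → s.ivar 0 = n →
    s.ivar 27 = N → Ends offsetProgram s (K * n.toNat) (fun s' =>
      ∀ t, 0 ≤ t → t < 10 * n → s'.iarr 9 t = t * N) := by
  refine ⟨1000, fun n N s hn h0 h27 => ?_⟩
  refine Ends.of_le (Ends.seq_frame (R := fun s' => s'.ivar 74 = 0) (Ends.of_exec rfl ?_)
    (fun s₁ hf₁ h₁ => (Ends.forTo_frame (M := 10 * n) (z := 0) (c := 20) rfl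
      (fun s' => 0 ≤ s'.ivar 75 ∧ s'.ivar 74 = s'.ivar 75 * N ∧
      ∀ p, 0 ≤ p → p < s'.ivar 75 → s'.iarr 9 p = p * N) rfl ?_
      (fun s' hf _ => ?_) ?_).mono le_rfl ?_)) ?_
  · simp [exec, Store.setI_ivar, IExpr.eval]
  · refine ⟨by simp [Store.setI_ivar], by simp [Store.setI_ivar, h₁], fun i hi hi' => ?_⟩
    simp [Store.setI_ivar] at hi'
    omega
  · have : s'.ivar 0 = n := (hf.ivar rfl).trans ((hf₁.ivar rfl).trans h0)
    simp only [IExpr.eval_five, IExpr.eval, this]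
    ring
  · rintro s₂ hf ⟨k0, k74, kp⟩ hlt
    have l27 : s₂.ivar 27 = N := by rw [hf.ivar rfl, hf₁.ivar rfl, h27]
    refine (Ends.of_exec rfl ?_).of_le (by simp [Program.steps, IExpr.cost])
    intro _
    simp only [exec, Store.setI_ivar, if_true, Store.setI_iarr, Store.setIA_iarr, IExpr.eval,
      Nat.reduceEqDiff, if_false, Store.setIA_ivar, l27, k74]
    refine ⟨by omega, by ring, fun p hp hp' => ?_⟩
    rcases (show p = s₂.ivar 75 ∨ p < s₂.ivar 75 by omega) with rfl | hi''
    · rw [Function.update_self]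
    · rw [Function.update_of_ne (by omega), kp p hp hi'']
  · rintro s₂ ⟨hN, -, -, kd⟩ t ht ht'
    exact kd t ht (by omega)
  · simp only [Program.steps, IExpr.cost, IExpr.five]
    omega

end RealRAM

/-! ### Lowest common ancestors and the candidates for the optimal error -/

theorem mul_add_ne {n u v u' v' : ℤ} (hv : 0 ≤ v) (hvn : v < n) (hv' : 0 ≤ v') (hvn' : v' < n)
    (h : u ≠ u' ∨ v ≠ v') : u * n + v ≠ u' * n + v' := by
  rcases eq_or_ne u u' with rfl | hu
  · omega
  · have := RealRAM.row_disjoint (by omega) hu hv hvn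
    omega

/-- The pair `(u, v)` with `v ≤ u` precedes the pair `(i, j)`. -/
structure PairBefore (i j u v : ℤ) : Prop where
  nonneg : 0 ≤ v
  le : v ≤ u
  before : u < i ∨ u = i ∧ v < j

/-- The rows of `L`, of length `n`, hold the lowest common ancestors of all pairs that precede
`(i, j)`. -/
structure LcaTable (n : ℤ) (par : ℤ → ℤ) (i j : ℤ) (L : ℤ → ℤ) : Prop where
  self : ∀ u, PairBefore i j u u → L (u * n + u) = u
  comm : ∀ u v, PairBefore i j u v → L (u * n + v) = L (v * n + u)
  par : ∀ u v, PairBefore i j u v → v < u → L (u * n + v) = L (par u * n + v)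

/-- The first `c` cells of `A` hold numbers in `[0, 2]`, among them all those that arise as errors
on paths between the endpoints of pairs that precede `(i, j)`. -/
structure ErrorList (n : ℤ) (d : ℤ → ℝ) (i j : ℤ) (L : ℤ → ℤ) (A : ℤ → ℝ) (c : ℤ) : Prop where
  nonneg : 0 ≤ c
  le : c ≤ 4 * (i * n + j)
  mem : ∀ x, 0 ≤ x → x < c → 0 ≤ A x ∧ A x ≤ 2
  exists_eq : ∀ u v, PairBefore i j u v → ∀ k : ℤ, |(k : ℝ) - (d u + d v - 2 * d (L (u * n + v)))| ≤ 2 →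
    ∃ x, 0 ≤ x ∧ x < c ∧ A x = |(k : ℝ) - (d u + d v - 2 * d (L (u * n + v)))|

theorem PairBefore.of_succ {i j u v : ℤ} (h : PairBefore i (j + 1) u v) :
    PairBefore i j u v ∨ u = i ∧ v = j := by
  obtain ⟨h1, h2, h3⟩ := h
  by_cases hc : u = i ∧ v = j
  · exact .inr hc
  · exact .inl ⟨h1, h2, by omega⟩

theorem PairBefore.of_row {i u v : ℤ} (h : PairBefore (i + 1) 0 u v) :
    PairBefore i (i + 1) u v :=
  ⟨h.1, h.2, by have := h.1; have := h.2; have := h.3; omega⟩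

/-- The table `L` after the entry of the pair `i, j` has been added. -/
def lcaUpdate (n : ℤ) (par : ℤ → ℤ) (i j : ℤ) (L : ℤ → ℤ) : ℤ → ℤ :=
  let z := if i ≤ j then i else L (par i * n + j)
  Function.update (Function.update L (i * n + j) z) (j * n + i) z

section
variable {n : ℤ} {par : ℤ → ℤ} {d : ℤ → ℝ} {i j : ℤ} {L : ℤ → ℤ}

theorem lcaUpdate_of_ne (hj : 0 ≤ j) (hji : j ≤ i) (hi : i < n) {u v : ℤ} (hv : 0 ≤ v)
    (hvn : v < n) (h1 : u ≠ i ∨ v ≠ j) (h2 : u ≠ j ∨ v ≠ i) :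
    lcaUpdate n par i j L (u * n + v) = L (u * n + v) := by
  rw [lcaUpdate, Function.update_of_ne (mul_add_ne hv hvn (by omega) hi h2),
    Function.update_of_ne (mul_add_ne hv hvn hj (by omega) h1)]

theorem lcaUpdate_right : lcaUpdate n par i j L (j * n + i) =
    if i ≤ j then i else L (par i * n + j) := by
  rw [lcaUpdate, Function.update_self]

theorem lcaUpdate_left (hj : 0 ≤ j) (hji : j ≤ i) (hi : i < n) :
    lcaUpdate n par i j L (i * n + j) = if i ≤ j then i else L (par i * n + j) := by
  rcases eq_or_ne i j with rfl | hij
  · exact lcaUpdate_right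
  · rw [lcaUpdate, Function.update_of_ne (mul_add_ne hj (by omega) (by omega) hi (.inl hij)),
      Function.update_self]

theorem lcaUpdate_before (hj : 0 ≤ j) (hji : j ≤ i) (hi : i < n) {u v : ℤ}
    (h : PairBefore i j u v) : lcaUpdate n par i j L (u * n + v) = L (u * n + v) := by
  obtain ⟨h1, h2, h3⟩ := h
  exact lcaUpdate_of_ne hj hji hi h1 (by omega) (by omega) (by omega)

/-- The cell (`par u`, v) with v < u ≤ i is neither (i, j) nor (j, i), so the recurrence reads an
entry that is already correct and is not overwritten. -/
theorem LcaTable.succ (h : LcaTable n par i j L) (hj : 0 ≤ j) (hji : j ≤ i) (hi : i < n)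
    (hpar : ∀ i, 1 ≤ i → i < n → 0 ≤ par i ∧ par i < i) :
    LcaTable n par i (j + 1) (lcaUpdate n par i j L) := by
  refine ⟨fun u hu => ?_, fun u v hu => ?_, fun u v hu hvu => ?_⟩
  · rcases hu.of_succ with hb | ⟨rfl, h'⟩
    · rw [lcaUpdate_before hj hji hi hb, h.self u hb]
    · subst h'
      rw [lcaUpdate_right, if_pos le_rfl]
  · rcases hu.of_succ with hb | ⟨rfl, rfl⟩
    · have h1 := hb.1
      have h2 := hb.2
      have h3 := hb.3
      rw [lcaUpdate_before hj hji hi hb, h.comm u v hb,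
        lcaUpdate_of_ne hj hji hi (by omega) (by omega) (by omega) (by omega)]
    · rw [lcaUpdate_left hj hji hi, lcaUpdate_right]
  · have hp := hpar u (by have := hu.1; omega) (by have := hu.3; omega)
    have h1 := hu.1
    have h3 := hu.3
    rw [lcaUpdate_of_ne hj hji hi (u := par u) hu.1 (by omega) (by omega) (by omega)]
    rcases hu.of_succ with hb | ⟨rfl, rfl⟩
    · rw [lcaUpdate_before hj hji hi hb, h.par u v hb hvu]
    · rw [lcaUpdate_left hj hji hi, if_neg (by omega)]

theorem LcaTable.row (h : LcaTable n par i (i + 1) L) : LcaTable n par (i + 1) 0 L :=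
  ⟨fun u hu => h.self u hu.of_row, fun u v hu => h.comm u v hu.of_row,
    fun u v hu => h.par u v hu.of_row⟩

theorem ErrorList.row {A : ℤ → ℝ} {c : ℤ} (h : ErrorList n d i (i + 1) L A c) (hi : i < n) :
    ErrorList n d (i + 1) 0 L A c :=
  ⟨h.nonneg, by nlinarith [h.le], h.mem, fun u v hu => h.exists_eq u v hu.of_row⟩

/-- Write k - x = m - f with f the fractional part of x and m = k - ⌊x⌋. The bound leaves -2 ≤ m ≤
2. For m = -2 the value 2 + f is at most 2, which forces f = 0, and it coincides with 2 - f. -/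
theorem abs_intCast_sub_le_two {x : ℝ} {k : ℤ} (h : |(k : ℝ) - x| ≤ 2) :
    |(k : ℝ) - x| = Int.fract x ∨ |(k : ℝ) - x| = 1 - Int.fract x ∨
      |(k : ℝ) - x| = 1 + Int.fract x ∨ |(k : ℝ) - x| = 2 - Int.fract x := by
  have h0 := Int.fract_nonneg x
  have h1 := Int.fract_lt_one x
  have hx : x = ⌊x⌋ + Int.fract x := (Int.floor_add_fract x).symm
  set f := Int.fract x
  obtain ⟨m, hm⟩ : ∃ m : ℤ, k - ⌊x⌋ = m := ⟨_, rfl⟩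
  have e : (k : ℝ) - x = m - f := by
    rw [← hm]
    push_cast
    linarith
  rw [e] at h ⊢
  obtain ⟨ha, hb⟩ := abs_le.1 h
  have h2 : m < 3 := by exact_mod_cast (by linarith : (m : ℝ) < 3)
  have h3 : -3 < m := by exact_mod_cast (by linarith : (-3 : ℝ) < m)
  rcases (show m = -2 ∨ m = -1 ∨ m = 0 ∨ m = 1 ∨ m = 2 by omega) with
    rfl | rfl | rfl | rfl | rfl <;> push_cast at ha ⊢
  · right; right; right
    rw [abs_of_nonpos (by linarith)]
    linarith
  · right; right; left
    rw [abs_of_nonpos (by linarith)]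
    linarith
  · left
    rw [abs_of_nonpos (by linarith)]
    linarith
  · right; left
    rw [abs_of_nonneg (by linarith)]
  · right; right; right
    rw [abs_of_nonneg (by linarith)]

theorem ErrorList.succ {A A' : ℤ → ℝ} {c : ℤ} (h : ErrorList n d i j L A c) (hj : 0 ≤ j)
    (hji : j ≤ i) (hi : i < n) {f : ℝ}
    (hf : f = Int.fract (d i + d j - 2 * d (lcaUpdate n par i j L (i * n + j))))
    (hA : ∀ x, 0 ≤ x → x < c → A' x = A x) (hA0 : A' c = f) (hA1 : A' (c + 1) = 1 - f)
    (hA2 : A' (c + 2) = 1 + f) (hA3 : A' (c + 3) = 2 - f) :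
    ErrorList n d i (j + 1) (lcaUpdate n par i j L) A' (c + 4) := by
  have f0 : 0 ≤ f := hf ▸ Int.fract_nonneg _
  have f1 : f ≤ 1 := hf ▸ (Int.fract_lt_one _).le
  have c0 := h.nonneg
  refine ⟨by omega, by have := h.le; linarith, fun x hx hxc => ?_, fun u v hu k hk => ?_⟩
  · rcases (show x < c ∨ x = c ∨ x = c + 1 ∨ x = c + 2 ∨ x = c + 3 by omega) with
      hlt | rfl | rfl | rfl | rfl
    · rw [hA x hx hlt]
      exact h.mem x hx hlt
    · rw [hA0]; constructor <;> linarith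
    · rw [hA1]; constructor <;> linarith
    · rw [hA2]; constructor <;> linarith
    · rw [hA3]; constructor <;> linarith
  · rcases hu.of_succ with hb | ⟨rfl, rfl⟩
    · rw [lcaUpdate_before hj hji hi hb] at hk ⊢
      obtain ⟨x, hx, hxc, he⟩ := h.exists_eq u v hb k hk
      exact ⟨x, hx, by omega, by rw [hA x hx hxc, he]⟩
    · rcases abs_intCast_sub_le_two hk with he | he | he | he <;> rw [he, ← hf]
      · exact ⟨c, by omega, by omega, hA0⟩
      · exact ⟨c + 1, by omega, by omega, hA1⟩
      · exact ⟨c + 2, by omega, by omega, hA2⟩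
      · exact ⟨c + 3, by omega, by omega, hA3⟩

end

namespace RealRAM
open IExpr BExpr Program

/-- Compute the lowest common ancestor of a pair of vertices. -/
def lcaEntry : Program :=
  .seq (.branch (.ile (.var 77) (.var 78)) (.setIVar 79 (.var 77))
    (.setIVar 79 (.arr 7 (.add (.arr 8 (.arr 4 (.var 77))) (.var 78)))))
    (.seq (.setIArr 7 (.add (.arr 8 (.var 77)) (.var 78)) (.var 79))
      (.setIArr 7 (.add (.arr 8 (.var 78)) (.var 77)) (.var 79)))

/-- Append the errors that can occur on the path between a pair of vertices. -/
def errorEntry : Program :=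
  .seq (.seq (.setRVar 10 (.sub (.sub (.add (.arr 1 (.var 77)) (.arr 1 (.var 78)))
        (.arr 1 (.var 79))) (.arr 1 (.var 79))))
      (.setRVar 10 (.sub (.var 10) (.ofInt (.floor (.var 10))))))
    (.seq (.seq (.setRArr 3 (.var 1) (.var 10))
        (.setRArr 3 (.add (.var 1) (.const 1)) (.sub (.ofInt (.const 1)) (.var 10))))
      (.seq (.seq (.setRArr 3 (.add (.var 1) (.const 2)) (.add (.ofInt (.const 1)) (.var 10)))
          (.setRArr 3 (.add (.var 1) (.const 3)) (.sub (.ofInt (.const 2)) (.var 10))))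
        (.setIVar 1 (.add (.var 1) (.const 4)))))

/-- Compute the lowest common ancestors of all pairs and the candidates for the optimal error. -/
def lcaProgram : Program :=
  .seq (.seq (.setIVar 76 (.const 0)) (.setIVar 1 (.const 0)))
    (.seq
      (.forTo 77 (.const 0) (.var 0)
        (.seq (.setIArr 8 (.var 77) (.var 76))
          (.seq (.forTo 78 (.const 0) (.add (.var 77) (.const 1)) (.seq lcaEntry errorEntry))
            (.setIVar 76 (.add (.var 76) (.var 0))))))
      (.setRVar 0 (.ofInt (.const 2))))

theorem lcaEntry_ends {n i j : ℤ} {par : ℤ → ℤ} {s : Store} (h77 : s.ivar 77 = i)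
    (h78 : s.ivar 78 = j) (h4 : s.iarr 4 = par) (hj : 0 ≤ j) (hji : j ≤ i) (hi : i < n)
    (hpar : ∀ i, 1 ≤ i → i < n → 0 ≤ par i ∧ par i < i)
    (h8 : ∀ t, 0 ≤ t → t ≤ i → s.iarr 8 t = t * n) :
    Ends lcaEntry s 100 (fun s' => s'.iarr 7 = lcaUpdate n par i j (s.iarr 7) ∧
      s'.ivar 79 = lcaUpdate n par i j (s.iarr 7) (i * n + j)) := by
  refine (Ends.of_exec rfl ?_).of_le (by simp [Program.steps, lcaEntry, IExpr.cost, BExpr.cost])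
  rw [lcaUpdate_left hj hji hi]
  by_cases hij : i ≤ j
  · simp [lcaEntry, exec, BExpr.eval, IExpr.eval, h77, h78, hij, lcaUpdate, Store.setI_ivar,
      Store.setIA_iarr, h8 i (by omega) le_rfl, h8 j hj hji]
  · have hp := hpar i (by omega) hi
    simp [lcaEntry, exec, BExpr.eval, IExpr.eval, h77, h78, hij, lcaUpdate, Store.setI_ivar,
      Store.setIA_iarr, h8 i (by omega) le_rfl, h8 j hj hji, h4, h8 (par i) hp.1 hp.2.le]

theorem errorEntry_ends {i j z c : ℤ} {d A : ℤ → ℝ} {s : Store} (h77 : s.ivar 77 = i)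
    (h78 : s.ivar 78 = j) (h79 : s.ivar 79 = z) (h1 : s.rarr 1 = d) (h3 : s.rarr 3 = A)
    (hc : s.ivar 1 = c) {f : ℝ} (hf : f = Int.fract (d i + d j - 2 * d z)) :
    Ends errorEntry s 100 (fun s' => s'.ivar 1 = c + 4 ∧ (∀ x, x < c → s'.rarr 3 x = A x) ∧
      s'.rarr 3 c = f ∧ s'.rarr 3 (c + 1) = 1 - f ∧ s'.rarr 3 (c + 2) = 1 + f ∧
      s'.rarr 3 (c + 3) = 2 - f) := by
  refine (Ends.of_exec rfl ?_).of_le (by simp [Program.steps, errorEntry, IExpr.cost, RExpr.cost])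
  -- Without multiplication the program subtracts d z twice.
  have e : d i + d j - d z - d z - ⌊d i + d j - d z - d z⌋ = f := by
    rw [hf, Int.fract, show d i + d j - 2 * d z = d i + d j - d z - d z by ring]
  simp only [errorEntry, exec, IExpr.eval, RExpr.eval, Store.setI_ivar, Store.setR_rvar, if_true,
    Store.setR_ivar, Store.setR_rarr, Store.setRA_rarr, Store.setRA_rvar, Store.setRA_ivar,
    Store.setI_rarr, h77, h78, h79, h1, h3, hc, e, Store.setRA_rvar]
  refine ⟨trivial, fun x hx => ?_, ?_, ?_, ?_, ?_⟩
  · rw [Function.update_of_ne (by omega), Function.update_of_ne (by omega),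
      Function.update_of_ne (by omega), Function.update_of_ne (by omega)]
  · rw [Function.update_of_ne (by omega), Function.update_of_ne (by omega),
      Function.update_of_ne (by omega), Function.update_self]
  · rw [Function.update_of_ne (by omega), Function.update_of_ne (by omega),
      Function.update_self]
    norm_num
  · rw [Function.update_of_ne (by omega), Function.update_self]
    norm_num
  · rw [Function.update_self]
    norm_num

/-- The pairs j ≤ i are visited row by row, so the entry of (`par i`, j) is available when that of
(i, j) is needed. The padding value for the next sort becomes 2: this keeps all thresholds in [0, 2]
and harms nothing, as 2 can always be met. -/
theorem lcaProgram_ends : ∃ K : ℕ, ∀ (n : ℤ) (par : ℤ → ℤ) (d : ℤ → ℝ) (s : Store), 1 ≤ n →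
    s.ivar 0 = n → s.iarr 4 = par → s.rarr 1 = d →
    (∀ i, 1 ≤ i → i < n → 0 ≤ par i ∧ par i < i) →
    Ends lcaProgram s (K * (n.toNat * n.toNat)) (fun s' => s'.rvar 0 = 2 ∧
      LcaTable n par n 0 (s'.iarr 7) ∧ ErrorList n d n 0 (s'.iarr 7) (s'.rarr 3) (s'.ivar 1)) := by
  refine ⟨10000, fun n par d s hn h0 h4 h1 hpar => ?_⟩
  refine Ends.of_le (Ends.seq_frame (R := fun s' => s'.ivar 76 = 0 ∧ s'.ivar 1 = 0)
    (Ends.of_exec rfl ?_) (fun s₁ hf₁ h₁ => Ends.seq_frame (Ends.forTo_frame (M := n) (z := 0)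
      (c := 1000 * n.toNat + 1000) rfl (fun s' => 0 ≤ s'.ivar 77 ∧ s'.ivar 77 ≤ n ∧
        s'.ivar 76 = s'.ivar 77 * n ∧ (∀ t, 0 ≤ t → t < s'.ivar 77 → s'.iarr 8 t = t * n) ∧
        LcaTable n par (s'.ivar 77) 0 (s'.iarr 7) ∧
        ErrorList n d (s'.ivar 77) 0 (s'.iarr 7) (s'.rarr 3) (s'.ivar 1))
        rfl ?_ (fun s' hf _ => ?_) ?_)
      (fun s₂ hf₂ h₂ => Ends.of_exec rfl ?_))) ?_
  · simp [exec, Store.setI_ivar, IExpr.eval]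
  · simp only [Store.setI_ivar, if_true, OfNat.one_ne_ofNat, Nat.reduceEqDiff, if_false,
      Store.setI_iarr, Store.setI_rarr, h₁.1, h₁.2]
    have hno : ∀ u v, ¬ PairBefore 0 0 u v := fun u v h => by
      have := h.1; have := h.2; have := h.3; omega
    exact ⟨le_rfl, by omega, by simp, fun t _ _ => by omega,
      ⟨fun u h => absurd h (hno _ _), fun u v h => absurd h (hno _ _),
        fun u v h => absurd h (hno _ _)⟩, le_rfl, by simp, fun x _ _ => by omega,
        fun u v h => absurd h (hno _ _)⟩
  · exact (hf.ivar rfl).trans ((hf₁.ivar rfl).trans h0)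
  · rintro s₂ hf ⟨k77, -, k76, k8, kL, kE⟩ hlt
    have l0 : s₂.ivar 0 = n := by rw [hf.ivar rfl, hf₁.ivar rfl, h0]
    have l4 : s₂.iarr 4 = par := by rw [hf.iarr rfl, hf₁.iarr rfl, h4]
    have l1 : s₂.rarr 1 = d := by rw [hf.rarr rfl, hf₁.rarr rfl, h1]
    obtain ⟨i, hi⟩ : ∃ i, s₂.ivar 77 = i := ⟨_, rfl⟩
    rw [hi] at k77 k76 k8 kL kE hlt
    refine Ends.of_le (Ends.seq_frame (R := fun s' => (∀ t, 0 ≤ t → t ≤ i → s'.iarr 8 t = t * n))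
      (Ends.of_exec rfl ?_) (fun s₃ hf₃ h₃ => Ends.seq_frame (Ends.forTo_frame (M := i + 1) (z := 0)
        (c := 200) rfl (fun s' => 0 ≤ s'.ivar 78 ∧ s'.ivar 78 ≤ i + 1 ∧
          LcaTable n par i (s'.ivar 78) (s'.iarr 7) ∧
          ErrorList n d i (s'.ivar 78) (s'.iarr 7) (s'.rarr 3) (s'.ivar 1)) rfl ?_
          (fun s' hf _ => ?_) ?_)
        (fun s₄ hf₄ h₄ => Ends.of_exec rfl ?_))) ?_
    · simp only [exec, IExpr.eval, Store.setIA_iarr, if_true, hi, k76]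
      intro t ht hti
      rcases hti.eq_or_lt with rfl | hti
      · rw [Function.update_self]
      · rw [Function.update_of_ne (by omega), k8 t ht hti]
    · simp only [Store.setI_ivar, if_true, OfNat.one_ne_ofNat, if_false, Store.setI_iarr,
        Store.setI_rarr]
      rw [hf₃.iarr rfl, hf₃.rarr rfl, hf₃.ivar rfl]
      exact ⟨le_rfl, by omega, kL, kE⟩
    · have : s'.ivar 77 = i := by rw [hf.ivar rfl, hf₃.ivar rfl, hi]
      simp only [IExpr.eval, this]
    · rintro s₄ hf₄ ⟨m78, m78', mL, mE⟩ mlt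
      have n77 : s₄.ivar 77 = i := by rw [hf₄.ivar rfl, hf₃.ivar rfl, hi]
      have n4 : s₄.iarr 4 = par := by rw [hf₄.iarr rfl, hf₃.iarr rfl, l4]
      have n1 : s₄.rarr 1 = d := by rw [hf₄.rarr rfl, hf₃.rarr rfl, l1]
      obtain ⟨j, hj⟩ : ∃ j, s₄.ivar 78 = j := ⟨_, rfl⟩
      rw [hj] at m78 mL mE mlt
      refine Ends.of_le (Ends.seq_frame (lcaEntry_ends n77 hj n4 m78 (by omega) hlt hpar
        (by rw [hf₄.iarr rfl]; exact h₃)) (fun s₅ hf₅ h₅ => (errorEntry_ends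
          ((hf₅.ivar rfl).trans n77) ((hf₅.ivar rfl).trans hj) h₅.2 ((hf₅.rarr rfl).trans n1)
          (hf₅.rarr rfl) (hf₅.ivar rfl) rfl).frame.mono le_rfl ?_)) (by norm_num)
      rintro s₆ ⟨hf₆, e1, eA, e3, e4, e5, e6⟩ -
      simp only [Store.setI_ivar, if_true, OfNat.one_ne_ofNat, if_false, Store.setI_iarr,
        Store.setI_rarr, e1, hj]
      rw [hf₆.iarr rfl, h₅.1]
      exact ⟨by omega, by omega, mL.succ m78 (by omega) hlt hpar,
        mE.succ m78 (by omega) hlt rfl (fun x _ hx => eA x hx) e3 e4 e5 e6⟩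
    · obtain ⟨q1, q2, q3, q4, q5⟩ := h₄
      rw [show s₄.ivar 78 = i + 1 by omega] at q4 q5
      intro _
      have r0 : s₄.ivar 0 = n := by rw [hf₄.ivar rfl, hf₃.ivar rfl, l0]
      have r76 : s₄.ivar 76 = i * n := by rw [hf₄.ivar rfl, hf₃.ivar rfl, k76]
      have r8 : s₄.iarr 8 = s₃.iarr 8 := hf₄.iarr rfl
      simp only [exec, IExpr.eval, Store.setI_ivar, if_true, Nat.reduceEqDiff, OfNat.one_ne_ofNat,
        if_false, Store.setI_iarr, Store.setI_rarr, hi, r0, r76, r8]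
      exact ⟨by omega, by omega, by ring, fun t ht hti => h₃ t ht (by omega), q4.row, q5.row hlt⟩
    · simp only [Program.steps, IExpr.cost]
      have : (i + 1 - 0).toNat ≤ n.toNat := by omega
      omega
  · obtain ⟨q1, q2, q3, q4, q5, q6, q7⟩ := h₂
    rw [show s₂.ivar 77 = n by omega] at q6 q7
    simp only [exec, IExpr.eval, RExpr.eval, Store.setR_rvar, Store.setR_ivar, Store.setR_iarr,
      Store.setR_rarr, if_true]
    exact ⟨by norm_num, q6, q7⟩
  · simp only [Program.steps, IExpr.cost, RExpr.cost, sub_zero]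
    have : 1 ≤ n.toNat := by omega
    nlinarith [Nat.mul_le_mul this this]

end RealRAM

/-! ### Weights of paths in terms of the distances from the root -/

namespace EdgeRounding

section
variable {V M : Type*} {G : SimpleGraph V}

theorem walkWeight_append [AddMonoid M] (f : G.edgeSet → M) {u v w : V} (p : G.Walk u v)
    (q : G.Walk v w) : walkWeight f (p.append q) = walkWeight f p + walkWeight f q := by
  induction p with
  | nil => simp [walkWeight]
  | cons h p ih => simp [walkWeight, ih, add_assoc]

theorem walkWeight_reverse [AddCommMonoid M] (f : G.edgeSet → M) {u v : V} (p : G.Walk u v) :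
    walkWeight f p.reverse = walkWeight f p := by
  induction p with
  | nil => rfl
  | @cons u x w h p ih =>
    have : (⟨s(x, u), h.symm⟩ : G.edgeSet) = ⟨s(u, x), h⟩ := Subtype.ext Sym2.eq_swap
    rw [SimpleGraph.Walk.reverse_cons, walkWeight_append, ih]
    simp [walkWeight, this, add_comm]

/-- The signed error is additive along a walk, hence itself a walk weight, namely that of the signed
errors of the edges. -/
theorem absError_eq (ω : G.edgeSet → ℝ≥0) (r : G.edgeSet → ℕ) {u v : V} (p : G.Walk u v) :
    absError ω r p = |walkWeight (fun e => (r e : ℝ) - ω e) p| := by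
  rw [absError]
  congr 1
  induction p with
  | nil => simp [walkWeight]
  | cons h p ih =>
    simp only [walkWeight, ← ih]
    push_cast
    ring

end

section
variable {n : ℕ} {G : SimpleGraph (Fin n)} {L : EdgeListing G} {A B pos par idx : ℤ → ℤ}

/-- A property shared by the two ends of every listed edge is carried along walks, and every edge of
the graph is listed. -/
theorem connectedList (hG : G.IsTree) (hA : ∀ e : Fin (n - 1), A ((e : ℕ) : ℤ) = (L.dart e).fst)
    (hB : ∀ e : Fin (n - 1), B ((e : ℕ) : ℤ) = (L.dart e).snd) : ConnectedList n A B := by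
  obtain ⟨v₀⟩ := hG.connected.nonempty
  have hn := v₀.pos
  have hmem : ∀ j : ℤ, 0 ≤ j → j < (n : ℤ) - 1 → ∃ e : Fin (n - 1), ((e : ℕ) : ℤ) = j :=
    fun j h1 h2 => ⟨⟨j.toNat, by omega⟩, by simp; omega⟩
  refine ⟨by omega, fun j h1 h2 => ?_, fun j h1 h2 => ?_, fun P hP u v hu hun hv hvn hPu => ?_⟩
  · obtain ⟨e, rfl⟩ := hmem j h1 h2
    rw [hA]
    have := (L.dart e).fst.isLt
    omega
  · obtain ⟨e, rfl⟩ := hmem j h1 h2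
    rw [hB]
    have := (L.dart e).snd.isLt
    omega
  · have hadj : ∀ a b : Fin n, G.Adj a b → P a → P b := by
      intro a b hab
      obtain ⟨e, he⟩ := L.bijective.2 ⟨s(a, b), hab⟩
      have he' : (L.dart e).edge = s(a, b) := congrArg Subtype.val he
      have hiff := hP e (by omega) (by omega)
      rw [hA, hB] at hiff
      rcases SimpleGraph.dart_edge_eq_mk'_iff'.1 he' with ⟨h1, h2⟩ | ⟨h1, h2⟩
      · rw [h1, h2] at hiff
        exact hiff.1
      · rw [h1, h2] at hiff
        exact hiff.2
    have hwalk : ∀ {a b : Fin n} (_ : G.Walk a b), P a → P b := by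
      intro a b p
      induction p with
      | nil => exact id
      | cons h p ih => exact fun ha => ih (hadj _ _ h ha)
    obtain ⟨p⟩ := hG.connected.preconnected ⟨u.toNat, by omega⟩ ⟨v.toNat, by omega⟩
    have := hwalk p
    simp only [Int.toNat_of_nonneg hu, Int.toNat_of_nonneg hv] at this
    exact this hPu

variable (hA : ∀ e : Fin (n - 1), A ((e : ℕ) : ℤ) = (L.dart e).fst)
  (hB : ∀ e : Fin (n - 1), B ((e : ℕ) : ℤ) = (L.dart e).snd)
  (hT : Traversal n A B n pos par idx)

include hT in
theorem exists_edge {i : ℤ} (hi : 1 ≤ i) (hin : i < n) :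
    ∃ e : Fin (n - 1), ((e : ℕ) : ℤ) = idx i := by
  have h1 := hT.idx_nonneg i hi hin
  have h2 := hT.idx_lt i hi hin
  exact ⟨⟨(idx i).toNat, by omega⟩, by simp; omega⟩

include hT in
theorem exists_vertex {i : ℤ} (hi : 0 ≤ i) (hin : i < n) :
    ∃ v : Fin n, pos ((v : ℕ) : ℤ) = i := by
  obtain ⟨v, hv, hvn, h⟩ := hT.surj i hi hin
  exact ⟨⟨v.toNat, by omega⟩, by simpa [Int.toNat_of_nonneg hv] using h⟩

include hT in
theorem pos_injective {u v : Fin n} (h : pos ((u : ℕ) : ℤ) = pos ((v : ℕ) : ℤ)) : u = v := by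
  have := hT.inj u v (by omega) (by omega) (by omega) (by omega) h
    (hT.pos_bounds (by omega) (by omega)).1
  exact Fin.ext (by omega)

include hA hB hT in
theorem edge_eq {i : ℤ} (hi : 1 ≤ i) (hin : i < n) {e : Fin (n - 1)}
    (he : ((e : ℕ) : ℤ) = idx i) {u v : Fin n} (hu : pos ((u : ℕ) : ℤ) = i)
    (hv : pos ((v : ℕ) : ℤ) = par i) : (L.dart e).edge = s(u, v) := by
  have h := hT.edge i hi hin
  rw [← he, hA, hB] at h
  rw [SimpleGraph.dart_edge_eq_mk'_iff']
  rcases h with ⟨h1, h2⟩ | ⟨h1, h2⟩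
  · exact .inl ⟨pos_injective hT (h1.trans hu.symm), pos_injective hT (h2.trans hv.symm)⟩
  · exact .inr ⟨pos_injective hT (h1.trans hv.symm), pos_injective hT (h2.trans hu.symm)⟩

variable {T : ParentTree} (hn : T.n = n) (hpar : T.par = par)

include hA hB hT hn hpar in
-- From two distinct vertices step to the parent of the one with the larger position and use
-- induction on the sum of positions. The bound on the support excludes a return to the vertex just
-- left. The weight obeys the recurrence of `lca`, so no graph-theoretic description of lowest
-- common ancestors is required.
theorem exists_path {X : ℤ → ℝ} {g : G.edgeSet → ℝ}
    (hX : ∀ i : ℤ, 1 ≤ i → i < n → ∀ e : Fin (n - 1), ((e : ℕ) : ℤ) = idx i →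
      X i = X (par i) + g (L.edge e)) :
    ∀ (m : ℕ) (u v : Fin n), (pos ((u : ℕ) : ℤ) + pos ((v : ℕ) : ℤ)).toNat = m →
      ∃ p : G.Walk u v, p.IsPath ∧
        (∀ w ∈ p.support, pos ((w : ℕ) : ℤ) ≤ max (pos ((u : ℕ) : ℤ)) (pos ((v : ℕ) : ℤ))) ∧
        walkWeight g p = T.dist X (pos ((u : ℕ) : ℤ)) (pos ((v : ℕ) : ℤ)) := by
  intro m
  induction m using Nat.strong_induction_on with
  | _ m ih =>
    have key : ∀ u v : Fin n, (pos ((u : ℕ) : ℤ) + pos ((v : ℕ) : ℤ)).toNat = m →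
        pos ((v : ℕ) : ℤ) < pos ((u : ℕ) : ℤ) → ∃ p : G.Walk u v, p.IsPath ∧
        (∀ w ∈ p.support, pos ((w : ℕ) : ℤ) ≤ max (pos ((u : ℕ) : ℤ)) (pos ((v : ℕ) : ℤ))) ∧
        walkWeight g p = T.dist X (pos ((u : ℕ) : ℤ)) (pos ((v : ℕ) : ℤ)) := by
      intro u v hm hlt
      have hu := hT.pos_bounds (v := u) (by omega) (by omega)
      have hv := hT.pos_bounds (v := v) (by omega) (by omega)
      obtain ⟨i, hi⟩ : ∃ i, pos ((u : ℕ) : ℤ) = i := ⟨_, rfl⟩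
      obtain ⟨j, hj⟩ : ∃ j, pos ((v : ℕ) : ℤ) = j := ⟨_, rfl⟩
      rw [hi, hj] at hm hlt ⊢
      rw [hi] at hu
      rw [hj] at hv
      have hp0 := hT.par_nonneg i (by omega) hu.2
      have hpl := hT.par_lt i (by omega) hu.2
      obtain ⟨w, hw⟩ := exists_vertex hT hp0 (by omega)
      obtain ⟨e, he⟩ := exists_edge hT (by omega) hu.2
      have hedge := edge_eq hA hB hT (by omega) hu.2 he hi hw
      obtain ⟨p, hp, hps, hpw⟩ := ih _ (by omega) w v rfl
      rw [hw, hj] at hps hpw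
      have hadj : G.Adj u w := by
        rw [← SimpleGraph.mem_edgeSet, ← hedge]
        exact (L.dart e).edge_mem
      refine ⟨.cons hadj p, ?_, ?_, ?_⟩
      · rw [SimpleGraph.Walk.cons_isPath_iff]
        refine ⟨hp, fun hmem => ?_⟩
        have := hps u hmem
        rw [hi] at this
        have := max_lt hpl hlt
        omega
      · intro x hx
        rw [SimpleGraph.Walk.support_cons, List.mem_cons] at hx
        rcases hx with rfl | hx
        · rw [hi]; exact le_max_left _ _
        · exact (hps x hx).trans (max_le_max_right _ hpl.le)
      · have : (⟨s(u, w), hadj⟩ : G.edgeSet) = L.edge e := Subtype.ext hedge.symm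
        rw [walkWeight, this, hpw, ParentTree.dist, ParentTree.dist, hX i (by omega) hu.2 e he,
          T.lca_par i j hv.1 hlt (by omega), hpar]
        ring
    intro u v hm
    rcases lt_trichotomy (pos ((v : ℕ) : ℤ)) (pos ((u : ℕ) : ℤ)) with h | h | h
    · exact key u v hm h
    · obtain rfl := pos_injective hT h
      have hu := hT.pos_bounds (v := v) (by omega) (by omega)
      refine ⟨.nil, .nil, by simp, ?_⟩
      rw [walkWeight, ParentTree.dist, T.lca_self _ hu.1 (by omega)]
      ring
    · obtain ⟨p, hp, hps, hpw⟩ := key v u (by omega) h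
      have hu := hT.pos_bounds (v := u) (by omega) (by omega)
      have hv := hT.pos_bounds (v := v) (by omega) (by omega)
      refine ⟨p.reverse, hp.reverse, fun w hw => ?_, ?_⟩
      · rw [max_comm]
        exact hps w (by simpa using hw)
      · rw [walkWeight_reverse, hpw, ParentTree.dist, ParentTree.dist,
          T.lca_comm _ _ hu.1 (by omega) hv.1 (by omega)]
        ring

include hA hB hT hn hpar in
/-- The error on the path between two vertices is the distance that arises from the errors on the
paths from the root. -/
theorem absError_eq_dist (hG : G.IsTree) {X : ℤ → ℝ} {ω : G.edgeSet → ℝ≥0} {r : G.edgeSet → ℕ}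
    (hX : ∀ i : ℤ, 1 ≤ i → i < n → ∀ e : Fin (n - 1), ((e : ℕ) : ℤ) = idx i →
      X i = X (par i) + (r (L.edge e) - ω (L.edge e))) {u v : Fin n} {p : G.Walk u v}
    (hp : p.IsPath) :
    absError ω r p = |T.dist X (pos ((u : ℕ) : ℤ)) (pos ((v : ℕ) : ℤ))| := by
  obtain ⟨q, hq, -, hw⟩ := exists_path hA hB hT hn hpar
    (g := fun e => (r e : ℝ) - ω e) hX _ u v rfl
  have : p = q := congrArg Subtype.val ((hG.isAcyclic.subsingleton_path u v).elim ⟨p, hp⟩ ⟨q, hq⟩)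
  rw [absError_eq, this, hw]

/-- Parents have smaller numbers, so the values can be defined one vertex after the other. -/
theorem exists_rootSum (hp0 : ∀ i : ℤ, 1 ≤ i → i < n → 0 ≤ par i)
    (hpl : ∀ i : ℤ, 1 ≤ i → i < n → par i < i) (a : ℤ → ℤ) :
    ∃ x : ℤ → ℤ, x 0 = 0 ∧ ∀ i : ℤ, 1 ≤ i → i < n → x i = x (par i) + a i := by
  have key : ∀ m : ℕ, ∃ x : ℤ → ℤ, x 0 = 0 ∧
      ∀ i : ℤ, 1 ≤ i → i < n → i ≤ m → x i = x (par i) + a i := by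
    intro m
    induction m with
    | zero => exact ⟨fun _ => 0, rfl, fun i h1 _ h2 => by push_cast at h2; omega⟩
    | succ m ih =>
      obtain ⟨x, x0, hx⟩ := ih
      refine ⟨Function.update x (m + 1) (x (par (m + 1)) + a (m + 1)), ?_, fun i h1 h2 h3 => ?_⟩
      · rw [Function.update_of_ne (by omega), x0]
      · have h4 := hp0 i h1 h2
        have h5 := hpl i h1 h2
        push_cast at h3
        rw [Function.update_of_ne (a := par i) (by omega)]
        rcases h3.eq_or_lt with rfl | h3
        · rw [Function.update_self]
        · rw [Function.update_of_ne (by omega), hx i h1 h2 (by omega)]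
  obtain ⟨x, x0, hx⟩ := key n
  exact ⟨x, x0, fun i h1 h2 => hx i h1 h2 h2.le⟩

include hT in
-- The n - 1 vertices other than the root inject into the n - 1 listed edges, so every edge leads
-- from a vertex to its parent.
theorem exists_idx_eq (e : Fin (n - 1)) : ∃ i, 1 ≤ i ∧ i < (n : ℤ) ∧ idx i = ((e : ℕ) : ℤ) := by
  have := Finset.surj_on_of_inj_on_of_card_le (s := Finset.Ico (1 : ℤ) n)
    (t := Finset.Ico (0 : ℤ) (n - 1)) (fun i _ => idx i)
    (fun i hi => by
      rw [Finset.mem_Ico] at hi ⊢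
      exact ⟨hT.idx_nonneg i hi.1 hi.2, hT.idx_lt i hi.1 hi.2⟩)
    (fun i j hi hj h => by
      rw [Finset.mem_Ico] at hi hj
      exact hT.idx_inj hi.1 hi.2 hj.1 hj.2 h)
    (by simp) ((e : ℕ) : ℤ) (by rw [Finset.mem_Ico]; omega)
  obtain ⟨i, hi, h⟩ := this
  rw [Finset.mem_Ico] at hi
  exact ⟨i, hi.1, hi.2, h.symm⟩

end

end EdgeRounding

namespace RealRAM
open IExpr BExpr Program

/-! ### Preparing the dynamic program -/

/-- Number the vertices and compute their distances from the root. -/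
def rootProgram : Program := .seq orderProgram distProgram

theorem rootProgram_ends : ∃ K : ℕ, ∀ (n : ℤ) (s : Store), s.ivar 0 = n →
    ConnectedList n (s.iarr 0) (s.iarr 1) →
    Ends rootProgram s (K * (n.toNat * n.toNat)) (fun s' =>
      Traversal n (s.iarr 0) (s.iarr 1) n (s'.iarr 3) (s'.iarr 4) (s'.iarr 5) ∧ s'.rarr 1 0 = 0 ∧
      ∀ i, 1 ≤ i → i < n → s'.rarr 1 i = s'.rarr 1 (s'.iarr 4 i) + s.rarr 0 (s'.iarr 5 i)) := by
  obtain ⟨K₁, hK₁⟩ := orderProgram_ends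
  obtain ⟨K₂, hK₂⟩ := distProgram_ends
  refine ⟨K₁ + K₂, fun n s h0 hG => ?_⟩
  have hn := hG.n_pos
  refine Ends.of_le (Ends.seq_frame (hK₁ n s h0 hG) (fun s₁ hf₁ h₁ =>
    (hK₂ n (s₁.iarr 4) s₁ hn ((hf₁.ivar rfl).trans h0) rfl fun i h2 h3 =>
      ⟨h₁.par_nonneg i h2 h3, h₁.par_lt i h2 h3⟩).frame.mono le_rfl ?_)) ?_
  · rintro s₂ ⟨hf₂, h₂⟩
    rw [hf₂.iarr rfl, hf₂.iarr (a := 4) rfl, hf₂.iarr (a := 5) rfl, ← hf₁.rarr (a := 0) rfl]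
    exact ⟨h₁, h₂⟩
  · have h1 : 1 ≤ n.toNat := by omega
    nlinarith [Nat.mul_le_mul_left (K₂ * n.toNat) h1]

/-- Compute the candidates for the rounded distances and the sorted list of their errors. -/
def levelProgram : Program :=
  .seq candidateProgram (.seq sortProgram (.seq copyProgram offsetProgram))

/-- The store holds the candidates for the roundings of the distances `d` and the sorted list of
their errors. -/
structure HoldsLevels (n : ℤ) (d : ℤ → ℝ) (s : Store) : Prop where
  N_pos : 1 ≤ s.ivar 27
  N_le : s.ivar 27 ≤ 12 * n
  x_eq : ∀ v k, 0 ≤ v → v < n → 0 ≤ k → k < 5 → s.iarr 6 (5 * v + k) = ⌊d v⌋ + k - 2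
  e_eq : ∀ v k, 0 ≤ v → v < n → 0 ≤ k → k < 5 →
    s.rarr 2 (5 * v + k) = s.iarr 6 (5 * v + k) - d v
  S_mono : ∀ p q, 0 ≤ p → p ≤ q → q < s.ivar 27 → s.rarr 5 p ≤ s.rarr 5 q
  S_zero : s.rarr 5 0 = -100
  S_le : ∀ p, 0 ≤ p → p < s.ivar 27 → s.rarr 5 p ≤ 2
  exists_S_eq : ∀ v k, 0 ≤ v → v < n → 0 ≤ k → k < 5 →
    ∃ p, 0 ≤ p ∧ p < s.ivar 27 ∧ s.rarr 5 p = s.rarr 2 (5 * v + k)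
  off : ∀ t, 0 ≤ t → t < 10 * n → s.iarr 9 t = t * s.ivar 27

theorem CandidatesOK.bounds {n : ℤ} {d : ℤ → ℝ} {s : Store} (h : CandidatesOK d (5 * n) s) {x : ℤ}
    (hx : 0 ≤ x) (hxn : x < 5 * n + 1) : -100 ≤ s.rarr 3 x ∧ s.rarr 3 x ≤ 2 := by
  rcases hx.eq_or_lt with rfl | hx
  · rw [h.1]; norm_num
  -- Behind the sentinel, cell x holds candidate number x - 1 = 5v + k; v and k are recovered by
  -- division.
  · obtain ⟨h1, h2, h3⟩ := h.2 ((x - 1) / 5) ((x - 1) % 5) (by omega) (by omega) (by omega)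
      (by omega)
    have hk0 : (0 : ℝ) ≤ (((x - 1) % 5 : ℤ) : ℝ) := by
      exact_mod_cast (by omega : 0 ≤ (x - 1) % 5)
    have hk4 : (((x - 1) % 5 : ℤ) : ℝ) ≤ 4 := by exact_mod_cast (by omega : (x - 1) % 5 ≤ 4)
    rw [show x = 5 * ((x - 1) / 5) + (x - 1) % 5 + 1 by omega, h3, h2, h1]
    have a1 := Int.floor_le (d ((x - 1) / 5))
    have a2 := Int.lt_floor_add_one (d ((x - 1) / 5))
    simp only [Int.cast_sub, Int.cast_add, Int.cast_ofNat]
    constructor <;> linarith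

/-- Since m + 1 ≤ 2^m, a quadratic bound for the first sort comes for free; its list has only O(n)
entries. -/
theorem two_pow_mul_le {c : ℤ} {m : ℕ} (h : (2 : ℤ) ^ m ≤ 2 * c) :
    2 ^ m * (m + 1) ≤ 4 * (c.toNat * c.toNat) := by
  have h1 : 2 ^ m ≤ 2 * c.toNat := by zify; omega
  have h2 : m + 1 ≤ 2 * c.toNat := (Nat.lt_two_pow_self (n := m)).trans_le h1
  calc 2 ^ m * (m + 1) ≤ (2 * c.toNat) * (2 * c.toNat) := Nat.mul_le_mul h1 h2
    _ = _ := by ring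

theorem levelProgram_ends : ∃ K : ℕ, ∀ (n : ℤ) (d : ℤ → ℝ) (s : Store), 1 ≤ n → s.ivar 0 = n →
    s.rarr 1 = d →
    Ends levelProgram s (K * (n.toNat * n.toNat)) (fun s' => HoldsLevels n d s') := by
  obtain ⟨K₁, hK₁⟩ := candidateProgram_ends
  obtain ⟨K₂, hK₂⟩ := sortProgram_ends
  obtain ⟨K₃, hK₃⟩ := copyProgram_ends
  obtain ⟨K₄, hK₄⟩ := offsetProgram_ends
  refine ⟨K₁ + K₂ * 144 + K₃ * 12 + K₄, fun n d s hn h0 h1 => ?_⟩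
  refine Ends.of_le (Ends.seq_frame (hK₁ n s hn h0)
    (c' := K₂ * (4 * ((6 * n.toNat) * (6 * n.toNat))) + (K₃ * (12 * n.toNat) + K₄ * n.toNat))
    (fun s₁ hf₁ h₁ => ?_)) ?_
  · rw [h1] at h₁
    obtain ⟨hc, hr, hC⟩ := h₁
    obtain ⟨m, hm1, hm2, hm⟩ := hK₂ (5 * n + 1) s₁ (by omega) hc
    have hNle : (2 : ℤ) ^ m ≤ 12 * n := by omega
    have hN1 : (1 : ℤ) ≤ 2 ^ m := one_le_pow₀ (by norm_num)
    refine Ends.of_le (Ends.seq_frame hm (fun s₂ hf₂ h₂ => Ends.seq_frame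
      (hK₃ (2 ^ m) s₂ hN1 h₂.1) (fun s₃ hf₃ h₃ =>
        (hK₄ n (2 ^ m) s₃ hn ?_ h₃.1).frame.mono le_rfl ?_))) ?_
    · rw [hf₃.ivar rfl, hf₂.ivar rfl, hf₁.ivar rfl, h0]
    · rintro s₄ ⟨hf₄, h₄⟩
      obtain ⟨h20, hmono, hmem, hval⟩ := h₂
      have e27 : s₄.ivar 27 = 2 ^ m := by rw [hf₄.ivar rfl, h₃.1]
      have e6 : s₄.iarr 6 = s₁.iarr 6 := by rw [hf₄.iarr rfl, hf₃.iarr rfl, hf₂.iarr rfl]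
      have e2 : s₄.rarr 2 = s₁.rarr 2 := by rw [hf₄.rarr rfl, hf₃.rarr rfl, hf₂.rarr rfl]
      have e5 : ∀ p, 0 ≤ p → p < 2 ^ m → s₄.rarr 5 p = s₂.rarr 3 p := by
        rw [hf₄.rarr rfl]
        exact h₃.2
      have hbd : ∀ p, 0 ≤ p → p < 2 ^ m → -100 ≤ s₂.rarr 3 p ∧ s₂.rarr 3 p ≤ 2 := by
        intro p hp hpN
        rcases hval p hp hpN with ⟨x, hx, hxc, h⟩ | h
        · rw [h]; exact hC.bounds hx hxc
        · rw [h, hr]; norm_num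
      refine ⟨by omega, by omega, fun v k hv hvn hk hk5 => ?_, fun v k hv hvn hk hk5 => ?_,
        fun p q hp hpq hq => ?_, ?_, fun p hp hpN => ?_, fun v k hv hvn hk hk5 => ?_, ?_⟩
      · rw [e6]
        exact (hC.2 v k hv hk hk5 (by omega)).1
      · rw [e6, e2]
        exact (hC.2 v k hv hk hk5 (by omega)).2.1
      · rw [e27] at hq
        rw [e5 p hp (by omega), e5 q (by omega) hq]
        exact hmono p q hp hpq hq
      · rw [e5 0 le_rfl (by omega)]
        -- The sentinel occurs in the sorted list and nothing there is smaller, so it stands first.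
        obtain ⟨y, hy, hyN, h⟩ := hmem 0 le_rfl (by omega)
        rw [hC.1] at h
        exact le_antisymm (h ▸ hmono 0 y le_rfl hy hyN) (hbd 0 le_rfl (by omega)).1
      · rw [e27] at hpN
        rw [e5 p hp hpN]
        exact (hbd p hp hpN).2
      · obtain ⟨y, hy, hyN, h⟩ := hmem (5 * v + k + 1) (by omega) (by omega)
        exact ⟨y, hy, by omega, by
          rw [e5 y hy hyN, h, (hC.2 v k hv hk hk5 (by omega)).2.2, e2]⟩
      · rw [e27]
        exact h₄
    · have q1 := two_pow_mul_le hm2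
      have q2 : (5 * n + 1).toNat ≤ 6 * n.toNat := by omega
      have q3 : ((2 : ℤ) ^ m).toNat ≤ 12 * n.toNat := by omega
      have q4 := q1.trans (Nat.mul_le_mul_left 4 (Nat.mul_le_mul q2 q2))
      have q5 := Nat.mul_le_mul_left K₂ q4
      have q6 := Nat.mul_le_mul_left K₃ q3
      omega
  · have h1 : n.toNat ≤ n.toNat * n.toNat := Nat.le_mul_self _
    have := Nat.mul_le_mul_left K₁ h1
    have := Nat.mul_le_mul_left (K₃ * 12) h1
    have := Nat.mul_le_mul_left K₄ h1
    nlinarith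

/-- Compute everything that the dynamic program and the search for the optimal error need. -/
def prepareProgram : Program := .seq rootProgram (.seq levelProgram lcaProgram)

/-- The fields `lca_self`, `lca_comm` and `lca_par` are the recurrences satisfied by the computed
table, so the table itself serves as `lca`. Real array 3 is used twice, first for the candidate
errors and then for the candidate thresholds. -/
theorem prepareProgram_ends : ∃ K : ℕ, ∀ (n : ℤ) (s : Store), s.ivar 0 = n →
    ConnectedList n (s.iarr 0) (s.iarr 1) → (∀ j, 0 ≤ j → j < n - 1 → 0 ≤ s.rarr 0 j) →
    Ends prepareProgram s (K * (n.toNat * n.toNat)) (fun s' => s'.rvar 0 = 2 ∧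
      Traversal n (s.iarr 0) (s.iarr 1) n (s'.iarr 3) (s'.iarr 4) (s'.iarr 5) ∧
      ∃ I : Levels, Holds I s' ∧ I.n = n ∧ I.N ≤ 12 * n ∧
        (∀ i, 1 ≤ i → i < n → I.d i = I.d (I.par i) + s.rarr 0 (s'.iarr 5 i)) ∧
        (∀ i j, I.lca i j = s'.iarr 7 (i * n + j)) ∧
        ErrorList n I.d n 0 (s'.iarr 7) (s'.rarr 3) (s'.ivar 1)) := by
  obtain ⟨K₁, hK₁⟩ := rootProgram_ends
  obtain ⟨K₂, hK₂⟩ := levelProgram_ends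
  obtain ⟨K₃, hK₃⟩ := lcaProgram_ends
  refine ⟨K₁ + K₂ + K₃, fun n s h0 hG hw => ?_⟩
  have hn := hG.n_pos
  refine Ends.of_le (Ends.seq_frame (hK₁ n s h0 hG) (fun s₁ hf₁ h₁ => Ends.seq_frame
    (hK₂ n (s₁.rarr 1) s₁ hn ((hf₁.ivar rfl).trans h0) rfl) (fun s₂ hf₂ h₂ =>
      (hK₃ n (s₁.iarr 4) (s₁.rarr 1) s₂ hn ?_ (hf₂.iarr rfl) (hf₂.rarr rfl)
        fun i h2 h3 => ⟨h₁.1.par_nonneg i h2 h3, h₁.1.par_lt i h2 h3⟩).frame.mono le_rfl ?_)))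
    (le_of_eq (by ring))
  · rw [hf₂.ivar rfl, hf₁.ivar rfl, h0]
  · rintro s₃ ⟨hf₃, h₃, hL, hE⟩
    obtain ⟨hT, hd0, hd⟩ := h₁
    have e3 : s₃.iarr 3 = s₁.iarr 3 := by rw [hf₃.iarr rfl, hf₂.iarr rfl]
    have e4 : s₃.iarr 4 = s₁.iarr 4 := by rw [hf₃.iarr rfl, hf₂.iarr rfl]
    have e5 : s₃.iarr 5 = s₁.iarr 5 := by rw [hf₃.iarr rfl, hf₂.iarr rfl]
    have e0 : s₃.ivar 0 = n := by rw [hf₃.ivar rfl, hf₂.ivar rfl, hf₁.ivar rfl, h0]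
    have hbef : ∀ {u v : ℤ}, 0 ≤ v → v ≤ u → u < n → PairBefore n 0 u v :=
      fun h1 h2 h3 => ⟨h1, h2, .inl h3⟩
    refine ⟨h₃, by rw [e3, e4, e5]; exact hT, ?_⟩
    refine ⟨{
      n := n
      par := s₁.iarr 4
      d := s₁.rarr 1
      lca := fun i j => s₃.iarr 7 (i * n + j)
      n_pos := hn
      par_nonneg := hT.par_nonneg
      par_lt := hT.par_lt
      d_zero := hd0
      d_par_le := fun i h1 h2 => by
        have := hw (s₁.iarr 5 i) (hT.idx_nonneg i h1 h2) (hT.idx_lt i h1 h2)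
        rw [hd i h1 h2]
        linarith
      lca_self := fun i h1 h2 => hL.self i (hbef h1 le_rfl h2)
      lca_comm := fun i j h1 h2 h3 h4 => by
        rcases le_total j i with h | h
        · exact hL.comm i j (hbef h3 h h2)
        · exact (hL.comm j i (hbef h1 h h4)).symm
      lca_par := fun i j h1 h2 h3 => hL.par i j (hbef h1 h2.le h3) h2
      x := s₂.iarr 6
      e := s₂.rarr 2
      S := s₂.rarr 5
      N := s₂.ivar 27
      N_pos := h₂.N_pos
      x_eq := h₂.x_eq
      e_eq := h₂.e_eq
      S_mono := h₂.S_mono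
      S_zero := h₂.S_zero
      S_le := h₂.S_le
      exists_S_eq := h₂.exists_S_eq }, ⟨e0, hf₃.ivar rfl, e4, hf₃.iarr rfl, hf₃.rarr rfl,
        hf₃.rarr rfl, ?_⟩, rfl, h₂.N_le, ?_, fun i j => rfl, hE⟩
    · have e9 : s₃.iarr 9 = s₂.iarr 9 := hf₃.iarr rfl
      exact fun t h1 h2 => (congrFun e9 t).trans (h₂.off t h1 h2)
    · rw [e5]
      exact hd

/-! ### The complete program -/

/-- Determine the optimal error and a rounding that attains it. -/
def solveProgram : Program := .seq sortProgram (.seq searchProgram outputProgram)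

/-- The padded list has 2^m ≤ 2c ≤ 8n² thresholds, so sorting costs O(n² m). The search makes O(m)
decisions, each of cost O(nN) with N ≤ 12n. -/
theorem solveProgram_ends : ∃ K : ℕ, ∀ (n : ℤ) (I : Levels) (A : ℤ → ℝ) (c : ℤ) (s : Store),
    Holds I s → I.n = n → I.N ≤ 12 * n → s.rvar 0 = 2 → s.rarr 3 = A → s.ivar 1 = c →
    c ≤ 4 * n ^ 2 → (∀ x, 0 ≤ x → x < c → 0 ≤ A x ∧ A x ≤ 2) →
    (∃ x, 0 ≤ x ∧ x < c ∧ A x = 2) →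
    (∀ i j, 1 ≤ i → i < n → 1 ≤ j → j < n → s.iarr 5 i = s.iarr 5 j → i = j) →
    Ends solveProgram s (K * (n.toNat ^ 2 * (Nat.log 2 (8 * n.toNat ^ 2) + 1))) (fun s' => ∃ ε y,
      (∀ x, 0 ≤ x → x < c → (∃ y, I.IsGood (A x) y) → ε ≤ A x) ∧ I.IsGood ε y ∧
      ∀ i, 1 ≤ i → i < n → s'.iarr 2 (s.iarr 5 i) = y i - y (I.par i)) := by
  obtain ⟨K₁, hK₁⟩ := sortProgram_ends
  obtain ⟨K₂, hK₂⟩ := searchProgram_ends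
  obtain ⟨K₃, hK₃⟩ := outputProgram_ends
  refine ⟨K₁ * 8 + K₂ * 12 + K₃, fun n I A c s hh hIn hIN hr hA hc hcn hbd htwo hinj => ?_⟩
  subst hIn
  have hn := I.n_pos
  have hNp := I.N_pos
  obtain ⟨m, hm1, hm2, hm⟩ := hK₁ c s (by obtain ⟨x, h1, h2, -⟩ := htwo; omega) hc
  have hpow : 2 ^ m ≤ 8 * I.n.toNat ^ 2 := by
    zify
    rw [Int.toNat_of_nonneg (by omega)]
    linarith
  have hlog : m ≤ Nat.log 2 (8 * I.n.toNat ^ 2) :=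
    Nat.le_log_of_pow_le (by norm_num) hpow
  refine Ends.of_le (Ends.seq_frame hm (fun s₁ hf₁ h₁ => Ends.seq_frame
    (hK₂ I (s₁.rarr 3) m s₁ (hh.of_frame hf₁ rfl) rfl h₁.1 h₁.2.1 ?_ ?_)
    (c' := K₃ * I.n.toNat) (fun s₂ hf₂ h₂ => ?_))) ?_
  · intro x hx hxm
    rcases h₁.2.2.2 x hx hxm with ⟨y, hy, hyc, h⟩ | h
    · rw [h, hA]; exact hbd y hy hyc
    · rw [h, hr]; norm_num
  · obtain ⟨x, hx, hxc, h⟩ := htwo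
    obtain ⟨y, hy, hym, h'⟩ := h₁.2.2.1 x hx hxc
    exact ⟨y, hy, hym, by rw [h', hA, h]⟩
  · obtain ⟨ε, hdec, h9, hmin⟩ := h₂
    have e5 : s₂.iarr 5 = s.iarr 5 := by rw [hf₂.iarr rfl, hf₁.iarr rfl]
    refine (hK₃ I ε s₂ ((hh.of_frame hf₁ rfl).of_frame hf₂ rfl) hdec h9
      (by rw [e5]; exact hinj)).mono le_rfl ?_
    rintro s₃ ⟨y, hy, hout⟩
    refine ⟨ε, y, fun x hx hxc hex => ?_, hy, by rw [e5] at hout; exact hout⟩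
    obtain ⟨z, hz, hzm, h⟩ := h₁.2.2.1 x hx hxc
    rw [hA] at h
    rw [← h] at hex ⊢
    exact hmin z hz hzm hex
  · set l := Nat.log 2 (8 * I.n.toNat ^ 2) + 1
    have hl : m + 1 ≤ l := by omega
    have hN : I.N.toNat ≤ 12 * I.n.toNat := by omega
    have q1 := Nat.mul_le_mul_left K₁ (Nat.mul_le_mul hpow hl)
    have q2 := Nat.mul_le_mul_left K₂ (Nat.mul_le_mul (Nat.mul_le_mul_left I.n.toNat hN) hl)
    have q3 : I.n.toNat ≤ I.n.toNat ^ 2 * l := by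
      have h1 : 1 ≤ l := by omega
      have h2 : I.n.toNat ≤ I.n.toNat ^ 2 := Nat.le_self_pow (by norm_num) _
      nlinarith
    have q4 := Nat.mul_le_mul_left K₃ q3
    calc _ ≤ K₁ * (8 * I.n.toNat ^ 2 * l) + (K₂ * (I.n.toNat * (12 * I.n.toNat) * l) +
        K₃ * (I.n.toNat ^ 2 * l)) := by omega
      _ = _ := by ring

end RealRAM

/-! ### Optimality -/

theorem ParentTree.dist_self (T : ParentTree) (X : ℤ → ℝ) {i : ℤ} (hi : 0 ≤ i) (hin : i < T.n) :
    T.dist X i i = 0 := by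
  rw [ParentTree.dist, T.lca_self i hi hin]
  ring

theorem ParentTree.dist_comm (T : ParentTree) (X : ℤ → ℝ) {i j : ℤ} (hi : 0 ≤ i) (hin : i < T.n)
    (hj : 0 ≤ j) (hjn : j < T.n) : T.dist X i j = T.dist X j i := by
  rw [ParentTree.dist, ParentTree.dist, T.lca_comm i j hi hin hj hjn]
  ring

namespace EdgeRounding

/-- Let r' be any rounding and E its largest error. If E ≤ 2, then E is a candidate threshold that
the distances of r' satisfy, so ε ≤ E by minimality. If E ≥ 2, then ε ≤ 2 ≤ E. The errors of r are
at most ε in turn. -/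
theorem isOptimalRounding {n : ℕ} {G : SimpleGraph (Fin n)} {L : EdgeListing G}
    {A B pos par idx : ℤ → ℤ}
    (hA : ∀ e : Fin (n - 1), A ((e : ℕ) : ℤ) = (L.dart e).fst)
    (hB : ∀ e : Fin (n - 1), B ((e : ℕ) : ℤ) = (L.dart e).snd)
    (hT : Traversal n A B n pos par idx) {T : ParentTree} (hn : T.n = n) (hpar : T.par = par)
    (hG : G.IsTree) {ω : G.edgeSet → ℝ≥0} {r : G.edgeSet → ℕ} {y : ℤ → ℤ} {ε : ℝ}
    (hd : ∀ i : ℤ, 1 ≤ i → i < n → ∀ e : Fin (n - 1), ((e : ℕ) : ℤ) = idx i →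
      T.d i = T.d (par i) + ω (L.edge e))
    (hr : ∀ i : ℤ, 1 ≤ i → i < n → ∀ e : Fin (n - 1), ((e : ℕ) : ℤ) = idx i →
      y i = y (par i) + r (L.edge e))
    (hy : T.IsGood ε y)
    (hmin : ∀ i j k : ℤ, 0 ≤ i → i < n → 0 ≤ j → j < n → |(k : ℝ) - T.dist T.d i j| ≤ 2 →
      (∃ x, T.IsGood |(k : ℝ) - T.dist T.d i j| x) → ε ≤ |(k : ℝ) - T.dist T.d i j|) :
    IsOptimalRounding ω r := by
  have := hG.connected.nonempty
  have herr : ∀ (r : G.edgeSet → ℕ) (y : ℤ → ℤ), (∀ i : ℤ, 1 ≤ i → i < n → ∀ e : Fin (n - 1),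
      ((e : ℕ) : ℤ) = idx i → y i = y (par i) + r (L.edge e)) → ∀ (u v : Fin n) (p : G.Walk u v),
      p.IsPath → absError ω r p =
        |T.dist (fun v => (y v : ℝ) - T.d v) (pos ((u : ℕ) : ℤ)) (pos ((v : ℕ) : ℤ))| :=
    fun r y hr u v p hp => absError_eq_dist hA hB hT hn hpar hG (fun i h1 h2 e he => by
      rw [hr i h1 h2 e he, hd i h1 h2 e he]
      push_cast
      ring) hp
  have hbd : ∀ u : Fin n, 0 ≤ pos ((u : ℕ) : ℤ) ∧ pos ((u : ℕ) : ℤ) < T.n := fun u => by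
    rw [hn]
    exact hT.pos_bounds (by omega) (by omega)
  -- The pair (0, 0) with k = 2 shows that 2 is among the candidates.
  have hε : ε ≤ 2 := by
    have h := T.dist_self T.d (i := 0) le_rfl (by have := T.n_pos; omega)
    have h2 : |((2 : ℤ) : ℝ) - T.dist T.d 0 0| = 2 := by rw [h]; norm_num
    have := hmin 0 0 2 le_rfl (by have := T.n_pos; omega) le_rfl (by have := T.n_pos; omega)
    rw [h2] at this
    exact this le_rfl T.exists_isGood_two
  intro r'
  obtain ⟨⟨u, v, p, hp, hmax⟩, -⟩ := isGreatest_maxError ω r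
  obtain ⟨⟨u', v', p', hp', hmax'⟩, hub⟩ := isGreatest_maxError ω r'
  rw [herr r y hr u v p hp] at hmax
  -- `IsGood` is silent about one-vertex paths. If the maximum is attained on such a path, it is 0.
  rcases eq_or_ne u v with rfl | huv
  · rw [hmax, T.dist_self _ (hbd u).1 (hbd u).2, abs_zero, hmax']
    exact abs_nonneg _
  · have hle : maxError ω r ≤ ε := by
      rw [hmax]
      exact hy.2.2 _ _ (hbd u).1 (hbd u).2 (hbd v).1 (hbd v).2
        fun h => huv (pos_injective hT h)
    refine hle.trans ?_
    have hexa : ∀ i : ℤ, ∃ a : ℤ, ∀ e : Fin (n - 1), ((e : ℕ) : ℤ) = idx i →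
        a = r' (L.edge e) := by
      intro i
      by_cases h : ∃ e : Fin (n - 1), ((e : ℕ) : ℤ) = idx i
      · obtain ⟨e, he⟩ := h
        refine ⟨r' (L.edge e), fun e' he' => ?_⟩
        rw [show e = e' from Fin.ext (by omega)]
      · exact ⟨0, fun e he => absurd ⟨e, he⟩ h⟩
    choose a ha using hexa
    obtain ⟨x, x0, hx⟩ := exists_rootSum hT.par_nonneg hT.par_lt a
    have hx' := herr r' x (fun i h1 h2 e he => by rw [hx i h1 h2, ha i e he])
    have hgood : T.IsGood (maxError ω r') x := by
      refine ⟨x0, fun i h1 h2 => ?_, fun i j h1 h2 h3 h4 _ => ?_⟩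
      · rw [hn] at h2
        obtain ⟨e, he⟩ := exists_edge hT h1 h2
        rw [hpar, hx i h1 h2, ha i e he]
        omega
      · obtain ⟨u, rfl⟩ := exists_vertex hT h1 (by omega)
        obtain ⟨v, rfl⟩ := exists_vertex hT h3 (by omega)
        obtain ⟨q, hq, -⟩ := hG.existsUnique_path u v
        rw [← hx' u v q hq]
        exact hub ⟨u, v, q, hq, rfl⟩
    -- The integer k is the weight that r' gives to the path where its largest error occurs,
    -- expressed by rounded distances.
    obtain ⟨k, hk⟩ : ∃ k : ℤ, maxError ω r' =
        |(k : ℝ) - T.dist T.d (pos ((u' : ℕ) : ℤ)) (pos ((v' : ℕ) : ℤ))| := by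
      refine ⟨x (pos ((u' : ℕ) : ℤ)) + x (pos ((v' : ℕ) : ℤ)) -
        2 * x (T.lca (pos ((u' : ℕ) : ℤ)) (pos ((v' : ℕ) : ℤ))), ?_⟩
      rw [hmax', hx' u' v' p' hp', ParentTree.dist, ParentTree.dist]
      congr 1
      push_cast
      ring
    rcases le_total (maxError ω r') 2 with h2 | h2
    · have hu := hbd u'
      have hv := hbd v'
      rw [hk] at h2 hgood ⊢
      exact hmin _ _ k hu.1 (by omega) hv.1 (by omega) h2 ⟨x, hgood⟩
    · exact hε.trans h2

end EdgeRounding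

/-- Taking logarithms in 2^l ≤ 8(n + 1)² gives (l + 1) log 2 ≤ 4 log 2 + 2 log (n + 1), and log 2 ≤
log (n + 1) turns this into 6 log (n + 1). -/
theorem natLog_le_mul_log {n : ℕ} (hn : 1 ≤ n) :
    ((Nat.log 2 (8 * n ^ 2) : ℕ) : ℝ) + 1 ≤ 6 / Real.log 2 * Real.log (n + 1) := by
  have h2 : 0 < Real.log 2 := Real.log_pos (by norm_num)
  have hn' : (1 : ℝ) ≤ n := by exact_mod_cast hn
  have hl : Real.log 2 ≤ Real.log (n + 1) := Real.log_le_log (by norm_num) (by linarith)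
  have h1 : (2 : ℝ) ^ Nat.log 2 (8 * n ^ 2) ≤ 2 ^ 3 * ((n : ℝ) + 1) ^ 2 := by
    have h : ((2 ^ Nat.log 2 (8 * n ^ 2) : ℕ) : ℝ) ≤ ((8 * n ^ 2 : ℕ) : ℝ) := by
      exact_mod_cast Nat.pow_log_le_self 2 (by positivity)
    push_cast at h
    nlinarith
  have h3 := Real.log_le_log (by positivity) h1
  rw [Real.log_pow, Real.log_mul (by positivity) (by positivity), Real.log_pow, Real.log_pow] at h3
  push_cast at h3
  rw [div_mul_eq_mul_div, le_div_iff₀ h2]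
  linarith

theorem mainTheorem3 :
    ∃ (P : RealRAM.Program) (C : ℝ),
      ∀ (n : ℕ) (G : SimpleGraph (Fin n)), G.IsTree →
        ∀ (ω : G.edgeSet → ℝ≥0) (L : EdgeRounding.EdgeListing G) (s : RealRAM.Store),
          EdgeRounding.IsInput ω L s →
            ∃ (t : ℕ) (s' : RealRAM.Store) (r : G.edgeSet → ℕ),
              RealRAM.Runs P s t s' ∧
              (t : ℝ) ≤ C * ((n : ℝ) ^ 2 * Real.log ((n : ℝ) + 1)) ∧
              EdgeRounding.IsOutput r L s' ∧
              EdgeRounding.IsOptimalRounding ω r := by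
  obtain ⟨K₁, hK₁⟩ := RealRAM.prepareProgram_ends
  obtain ⟨K₂, hK₂⟩ := RealRAM.solveProgram_ends
  refine ⟨.seq RealRAM.prepareProgram RealRAM.solveProgram, (K₁ + K₂) * (6 / Real.log 2),
    fun n G hG ω L s ⟨hs0, hs⟩ => ?_⟩
  have hA : ∀ e : Fin (n - 1), s.iarr 0 ((e : ℕ) : ℤ) = (L.dart e).fst := fun e => (hs e).1
  have hB : ∀ e : Fin (n - 1), s.iarr 1 ((e : ℕ) : ℤ) = (L.dart e).snd := fun e => (hs e).2.1
  have hn : 1 ≤ n := by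
    obtain ⟨v⟩ := hG.connected.nonempty
    exact v.pos
  obtain ⟨t, s', hrun, ht, I, pos, par, idx, hT, hIn, hIpar, hId, ε, y, hmin, hy, hout⟩ :
      RealRAM.Ends (.seq RealRAM.prepareProgram RealRAM.solveProgram) s
      (K₁ * (n * n) + K₂ * (n ^ 2 * (Nat.log 2 (8 * n ^ 2) + 1))) (fun s' =>
        ∃ (I : Levels) (pos par idx : ℤ → ℤ), Traversal n (s.iarr 0) (s.iarr 1) n pos par idx ∧
        I.n = n ∧ I.par = par ∧
        (∀ i : ℤ, 1 ≤ i → i < n → I.d i = I.d (par i) + s.rarr 0 (idx i)) ∧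
        ∃ ε y, (∀ i j k : ℤ, 0 ≤ i → i < n → 0 ≤ j → j < n → |(k : ℝ) - I.dist I.d i j| ≤ 2 →
          (∃ x, I.IsGood |(k : ℝ) - I.dist I.d i j| x) → ε ≤ |(k : ℝ) - I.dist I.d i j|) ∧
        I.IsGood ε y ∧ ∀ i : ℤ, 1 ≤ i → i < n → s'.iarr 2 (idx i) = y i - y (par i)) := by
    refine RealRAM.Ends.of_le (RealRAM.Ends.seq_frame
      (hK₁ n s hs0 (EdgeRounding.connectedList hG hA hB) fun j h1 h2 => ?_)
      (c' := K₂ * (n ^ 2 * (Nat.log 2 (8 * n ^ 2) + 1))) (fun s₁ hf₁ h₁ => ?_))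
      (by simp)
    · have := (hs ⟨j.toNat, by omega⟩).2.2
      simp only [Int.toNat_of_nonneg h1] at this
      rw [this]
      exact NNReal.coe_nonneg _
    · obtain ⟨hr, hT, I, hh, hIn, hIN, hd, hlca, hE⟩ := h₁
      have hle := hE.le
      have hpair : ∀ i j k : ℤ, 0 ≤ j → j ≤ i → i < n → |(k : ℝ) - I.dist I.d i j| ≤ 2 →
          ∃ x, 0 ≤ x ∧ x < s₁.ivar 1 ∧ s₁.rarr 3 x = |(k : ℝ) - I.dist I.d i j| := by
        intro i j k h1 h2 h3 h4
        have := hE.exists_eq i j ⟨h1, h2, .inl h3⟩ k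
        rw [← hlca] at this
        exact this h4
      have htwo : ∃ x, 0 ≤ x ∧ x < s₁.ivar 1 ∧ s₁.rarr 3 x = 2 := by
        have h2 : |((2 : ℤ) : ℝ) - I.dist I.d 0 0| = 2 := by
          rw [I.dist_self I.d le_rfl (by omega)]
          norm_num
        rw [← h2]
        exact hpair 0 0 2 le_rfl le_rfl (by omega) h2.le
      have hsolve := hK₂ n I (s₁.rarr 3) (s₁.ivar 1) s₁ hh hIn hIN hr rfl rfl (by linarith) hE.mem
        htwo fun i j h1 h2 h3 h4 => hT.idx_inj h1 h2 h3 h4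
      rw [Int.toNat_natCast] at hsolve
      refine hsolve.mono le_rfl ?_
      rintro s₂ ⟨ε, y, hmin, hy, hout⟩
      refine ⟨I, _, _, _, hT, hIn, hh.par.symm, by rw [hh.par]; exact hd, ε, y,
        fun i j k h1 h2 h3 h4 h5 h6 => ?_, hy, by rw [hh.par]; exact hout⟩
      rcases le_total j i with hji | hji
      · obtain ⟨x, hx, hxc, he⟩ := hpair i j k h3 hji h2 h5
        rw [← he] at h6 ⊢
        exact hmin x hx hxc h6
      · rw [I.dist_comm I.d h1 (by omega) h3 (by omega)] at h5 h6 ⊢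
        obtain ⟨x, hx, hxc, he⟩ := hpair j i k h1 hji h4 h5
        rw [← he] at h6 ⊢
        exact hmin x hx hxc h6
  -- Every listed edge joins some vertex to its parent, and rounded distances do not decrease along
  -- it.
  have hnonneg : ∀ e : Fin (n - 1), 0 ≤ s'.iarr 2 ((e : ℕ) : ℤ) := by
    intro e
    obtain ⟨i, h1, h2, he⟩ := EdgeRounding.exists_idx_eq hT e
    have := hy.2.1 i h1 (by omega)
    rw [hIpar] at this
    rw [← he, hout i h1 h2]
    omega
  -- The output is turned into a function on edges by inverting the listing; `toNat` changes nothing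
  -- because the values are nonnegative.
  let r : G.edgeSet → ℕ := fun E =>
    (s'.iarr 2 ((((Equiv.ofBijective _ L.bijective).symm E : Fin (n - 1)) : ℕ) : ℤ)).toNat
  have hr : ∀ e : Fin (n - 1), s'.iarr 2 ((e : ℕ) : ℤ) = (r (L.edge e) : ℤ) := by
    intro e
    have : (Equiv.ofBijective _ L.bijective).symm (L.edge e) = e :=
      Equiv.ofBijective_symm_apply_apply _ L.bijective e
    simp only [r, this]
    exact (Int.toNat_of_nonneg (hnonneg e)).symm
  refine ⟨t, s', r, hrun, ?_, hr, EdgeRounding.isOptimalRounding hA hB hT hIn hIpar hG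
    (fun i h1 h2 e he => ?_) (fun i h1 h2 e he => ?_) hy hmin⟩
  · have ht' : (t : ℝ) ≤ K₁ * (n * n) + K₂ * (n ^ 2 * ((Nat.log 2 (8 * n ^ 2) : ℕ) + 1)) := by
      exact_mod_cast ht
    have hlog := natLog_le_mul_log hn
    have hlog1 : (1 : ℝ) ≤ ((Nat.log 2 (8 * n ^ 2) : ℕ) : ℝ) + 1 := by
      have : (0 : ℝ) ≤ ((Nat.log 2 (8 * n ^ 2) : ℕ) : ℝ) := Nat.cast_nonneg _
      linarith
    calc (t : ℝ) ≤ K₁ * (n * n) + K₂ * (n ^ 2 * ((Nat.log 2 (8 * n ^ 2) : ℕ) + 1)) := ht'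
      _ ≤ K₁ * (n ^ 2 * (6 / Real.log 2 * Real.log (n + 1))) +
          K₂ * (n ^ 2 * (6 / Real.log 2 * Real.log (n + 1))) := by
        refine add_le_add (mul_le_mul_of_nonneg_left ?_ (Nat.cast_nonneg _)) (by gcongr)
        calc (n : ℝ) * n = n ^ 2 * 1 := by ring
          _ ≤ _ := by gcongr; exact hlog1.trans hlog
      _ = _ := by ring
  · rw [hId i h1 h2, ← he, (hs e).2.2]
  · have := hout i h1 h2
    rw [← he, hr] at this
    omega
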